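/- \textbf{Setting.} Let $\mathbb{L}/\mathbb{K}$ be a finite Galois extension of fields with group $\mathrm{G}\cong(\mathbb{Z}/2\mathbb{Z})^m$, a fixed such isomorphism giving generators $\theta_1,\dots,\theta_m$ and the Hamming weight $w_{\mathrm H}$ on $\mathrm{G}$; put $N=2^m$. Let $\alpha_1,\dots,\alpha_m\in\mathbb{L}^\times$ be such that $\theta_i(\alpha_j)=\alpha_j$ for $i\ne j$, and $\theta_i(\alpha_i)=-\alpha_i$ if $\mathrm{char}\,\mathbb{K}\neq2$, $\theta_i(\alpha_i)=\alpha_i+1$ if $\mathrm{char}\,\mathbb{K}=2$. The products of distinct $\alpha_i$ form a $\mathbb{K}$-basis $\mathcal{B}$ of $\mathbb{L}$, split as $\mathcal{B}_{m-1}\cup\mathcal{B}_{m-1}\alpha_m$. For $0\le r\le m$, \[\mathrm{RM}_{\mathbb{L}/\mathbb{K}}(r,m)=\Big\{\sum_{g\in\mathrm{G},\,w_{\mathrm H}(g)\le r}f_g\,g\Big\}\subseteq\mathbb{L}[\mathrm{G}],\] whose elements are viewed as $\mathbb{K}$-endomorphisms $x\mapsto\sum_g f_g\,g(x)$ of $\mathbb{L}$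 and, in the basis $\mathcal{B}$, as matrices in $\mathbb{K}^{N\times N}$; its minimum distance $d$ is the least rank of a nonzero element. The folding of a $2^{n}\times2^{n}$ matrix $\mathbf{E}$ with respect to $a=\alpha_n$ is $(a^{-1}\mathbf{I}\;\;\mathbf{I})\,\mathbf{E}\,\binom{\mathbf{I}}{-a^{-1}\mathbf{I}}$ if $\mathrm{char}\,\mathbb{K}\ne2$, and $(\mathbf{I}\;\;a\mathbf{I})\,\mathbf{E}\,\binom{\mathbf{I}}{a^{-1}\mathbf{I}}$ if $\mathrm{char}\,\mathbb{K}=2$; it has size $2^{n-1}\times2^{n-1}$. \emph{Folding assumption} on $\mathbf{E}\in\mathbb{K}^{N\times N}$: the iterated foldings of $\mathbf{E}$ with respect to $\alpha_m,\alpha_{m-1},\dots$, of size $2^{m-i}\times2^{m-i}$ for $1\le i\le \min(r+1,m)$, all have the same rank as $\mathbf{E}$. A deterministic algorithm over a field is an algebraic computation tree; each executed operation $+,-,\times,/$ and each test for zero counts as one operation, constants of the field being available for free. Let $\mathcal{M}_{\mathbb{K}}(\mathbb{L})$ be the least worst-case number of operations in $\mathbb{K}$ that suffices to multiply two elements of $\mathbb{L}$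 given by coordinates in $\mathcal{B}$. \textbf{Theorem.} Let $\omega>2$ and $C_\omega$ be real numbers. There is a constant $\kappa>0$, depending only on $\omega$ and $C_\omega$, such that the following holds for all $\mathbb{L}/\mathbb{K}$, $m$, $r$, $(\alpha_i)$ as above for which, for every $n$, the product of two $n\times n$ matrices over $\mathbb{L}$ can be computed by an arithmetic circuit (only $+,-,\times$ and constants) with at most $C_\omega n^\omega$ operations in $\mathbb{L}$. There is a deterministic algorithm over $\mathbb{K}$ which, for every input $\mathbf{Y}=\mathbf{C}+\mathbf{E}\in\mathbb{K}^{N\times N}$ with $\mathbf{C}\in\mathrm{RM}_{\mathbb{L}/\mathbb{K}}(r,m)$, $t=\mathrm{Rk}(\mathbf{E})<d/2$ and $\mathbf{E}$ satisfying the folding assumption, returns $\mathbf{C}$ after at most \[\kappa\,\max(t,1)^{\omega-1}\,N\,\mathcal{M}_{\mathbb{K}}(\mathbb{L})\] operations in $\mathbb{K}$. Hence, whenever $\mathcal{M}_{\mathbb{K}}(\mathbb{L})\le C_M N\log N$, it uses at most $\kappa\,C_M\max(t,1)^{\omega-1}N^2\log N$ operations in $\mathbb{K}$. -/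

import Mathlib

/-! ### Algebraic computations over a field, with an operation count -/

/-- The four arithmetic operations of a field. -/
inductive ArithOp : Type
  | add
  | sub
  | mul
  | div

/-- A deterministic algorithm over the field `K` with inputs `x i`, `i : I`, and outputs indexed by
`O`, as an algebraic computation tree. It may read the inputs (registers `Sum.inl i`) and read and
write workspace registers (`Sum.inr d`, `d : ℕ`). -/
inductive CompTree (K I O : Type*) : Type _
  /-- stop, and return the contents of the given registers -/
  | output (out : O → I ⊕ ℕ) : CompTree K I O
  /-- load a constant of `K` into a workspace register -/
  | const (d : ℕ) (c : K) (next : CompTree K I O) : CompTree K I O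
  /-- apply one operation of `K` to two registers, store the result in a workspace register -/
  | arith (op : ArithOp) (d : ℕ) (a b : I ⊕ ℕ) (next : CompTree K I O) : CompTree K I O
  /-- branch according to whether a register contains zero -/
  | test (a : I ⊕ ℕ) (ifZero ifNonzero : CompTree K I O) : CompTree K I O

namespace CompTree

variable {K I O : Type*} [Field K]

/-- The effect of an arithmetic operation; division by zero is undefined. -/
noncomputable def _root_.ArithOp.apply (op : ArithOp) (u v : K) : Option K :=
  open Classical in
  match op with
  | .add => some (u + v)
  | .sub => some (u - v)
  | .mul => some (u * v)
  | .div => if v = 0 then none else some (u / v)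

/-- Execution on the input `x` with workspace `w`: the output together with the number of operations
in `K` that were executed (each arithmetic operation and each zero test counts one), or `none` if a
division by zero occurs. -/
noncomputable def exec (x : I → K) : CompTree K I O → (ℕ → K) → Option ((O → K) × ℕ)
  | output out, w => some (fun o => Sum.elim x w (out o), 0)
  | const d c next, w => exec x next (Function.update w d c)
  | arith op d a b next, w =>
      (op.apply (Sum.elim x w a) (Sum.elim x w b)).bind fun v =>
        (exec x next (Function.update w d v)).map fun s => (s.1, s.2 + 1)
  | test a p q, w =>
      open Classical in
      (if Sum.elim x w a = 0 then exec x p w else exec x q w).map fun s => (s.1, s.2 + 1)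

/-- Execution from the workspace filled with zeros. -/
noncomputable def run (T : CompTree K I O) (x : I → K) : Option ((O → K) × ℕ) :=
  exec x T fun _ => 0

/-- `T` is an arithmetic circuit (a straight-line program): it neither divides nor branches. -/
def IsCircuit : CompTree K I O → Prop
  | output _ => True
  | const _ _ next => IsCircuit next
  | arith op _ _ _ next => op ≠ ArithOp.div ∧ IsCircuit next
  | test _ _ _ => False

end CompTree

/-- For every `n`, the product of two `n × n` matrices over `F` is computed by an arithmetic circuit
over `F` with at most `C * n ^ ω` operations in `F`. -/
def MatMulBound (F : Type*) [Field F] (ω C : ℝ) : Prop :=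
  ∀ n : ℕ, ∃ T : CompTree F ((Fin n × Fin n) ⊕ (Fin n × Fin n)) (Fin n × Fin n), T.IsCircuit ∧
    ∀ A B : Matrix (Fin n) (Fin n) F, ∃ c : ℕ,
      T.run (Sum.elim (fun p => A p.1 p.2) (fun p => B p.1 p.2)) =
        some (fun p => (A * B) p.1 p.2, c) ∧
      (c : ℝ) ≤ C * (n : ℝ) ^ ω

/-! ### Extensions with Galois group `(ℤ/2ℤ)^m`, adapted generators and basis -/

section Codes

variable {K L : Type*} [Field K] [Field L] [Algebra K L] {m : ℕ}

/-- The generators `θ_i` of the Galois group given by an isomorphism `e : (ℤ/2ℤ)^m ≃ Gal(L/K)`. -/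
def theta (e : Multiplicative (Fin m → ZMod 2) ≃* (L ≃ₐ[K] L)) (i : Fin m) : L ≃ₐ[K] L :=
  e (Multiplicative.ofAdd (Pi.single i 1))

/-- `α_1, …, α_m` are Kummer (characteristic `≠ 2`), respectively Artin–Schreier (characteristic
`2`), generators of `L` over `K` dual to `θ_1, …, θ_m`: the automorphism `θ_i` fixes `α_j` for
`j ≠ i`, and it sends `α_i ≠ 0` to `-α_i`, respectively to `α_i + 1`. By Galois theory `α_i ^ 2`,
respectively `α_i ^ 2 + α_i`, then lies in `K`, and `L = K(α_1, …, α_m)`. -/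
def AdaptedGenerators (e : Multiplicative (Fin m → ZMod 2) ≃* (L ≃ₐ[K] L)) (α : Fin m → L) : Prop :=
  (∀ i, α i ≠ 0) ∧
  ∀ i j, theta e i (α j) =
    if i = j then (if ringChar K = 2 then α j + 1 else -α j) else α j

/-- The index set, with `N = 2 ^ m` elements, of the basis `𝓑` of `L` over `K`. -/
abbrev BIdx (m : ℕ) : Type := Fin m → Fin 2

/-- The basis `𝓑_m = 𝓑_{m-1} ∪ 𝓑_{m-1} α_m`, that is, the products of distinct `α_i`. -/
def basisElt (α : Fin m → L) (s : BIdx m) : L := ∏ i, α i ^ (s i : ℕ)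

/-- The element of `L` with coordinates `x` in the basis `𝓑`. -/
def ofCoords (α : Fin m → L) (x : BIdx m → K) : L := ∑ s, x s • basisElt α s

/-- `𝓜_K(L)`: the least number of operations in `K` that suffices, in the worst case, to multiply
two elements of `L` given by their coordinates in the basis `𝓑`. -/
noncomputable def mulCost (K : Type*) {L : Type*} [Field K] [Field L] [Algebra K L] {m : ℕ}
    (α : Fin m → L) : ℕ :=
  sInf {c : ℕ | ∃ T : CompTree K (BIdx m ⊕ BIdx m) (BIdx m), ∀ x y : BIdx m → K,
    ∃ (z : BIdx m → K) (c' : ℕ), T.run (Sum.elim x y) = some (z, c') ∧ c' ≤ c ∧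
      ofCoords α z = ofCoords α x * ofCoords α y}

/-! ### Binary rank metric Reed–Muller codes in the skew group algebra `L[G]` -/

/-- The `K`-endomorphism `x ↦ ∑ a_g g(x)` of `L` defined by `∑ a_g g ∈ L[G]`. -/
noncomputable def toEndo (f : SkewMonoidAlgebra L (L ≃ₐ[K] L)) : L →ₗ[K] L :=
  f.sum fun g a => a • g.toLinearMap

/-- The Hamming weight of an element of `G ≃ (ℤ/2ℤ)^m`. -/
def galWeight (e : Multiplicative (Fin m → ZMod 2) ≃* (L ≃ₐ[K] L)) (g : L ≃ₐ[K] L) : ℕ :=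
  hammingNorm (Multiplicative.toAdd (e.symm g))

/-- The code `RM_{L/K}(r, m)`: the `L`-subspace of `L[G]` of the elements supported on the group
elements of Hamming weight at most `r`. -/
def reedMuller (e : Multiplicative (Fin m → ZMod 2) ≃* (L ≃ₐ[K] L)) (r : ℕ) :
    Submodule L (SkewMonoidAlgebra L (L ≃ₐ[K] L)) where
  carrier := {f | ∀ g, f.coeff g ≠ 0 → galWeight e g ≤ r}
  zero_mem' := by
    intro g hg
    simp at hg
  add_mem' := by
    intro a b ha hb g hg
    by_cases h : a.coeff g = 0
    · refine hb g fun h' => hg ?_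
      simp [SkewMonoidAlgebra.coeff_add, h, h']
    · exact ha g h
  smul_mem' := by
    intro c a ha g hg
    refine ha g fun h => hg ?_
    simp [SkewMonoidAlgebra.coeff_smul, h]

/-- The minimum rank distance of a code in `L[G]`. -/
noncomputable def minRankDist (C : Submodule L (SkewMonoidAlgebra L (L ≃ₐ[K] L))) : ℕ :=
  sInf {d | ∃ f ∈ C, f ≠ 0 ∧ d = Module.finrank K (LinearMap.range (toEndo f))}

/-- `M` is the matrix in the basis `𝓑` of the endomorphism of `L` defined by `f ∈ L[G]`. -/
def IsMatrixOf (α : Fin m → L) (f : SkewMonoidAlgebra L (L ≃ₐ[K] L))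
    (M : Matrix (BIdx m) (BIdx m) K) : Prop :=
  ∀ t, toEndo f (basisElt α t) = ofCoords α fun s => M s t

/-- The code `RM_{L/K}(r, m)` as a matrix code in `K^{N × N}`. -/
def reedMullerMatrices (e : Multiplicative (Fin m → ZMod 2) ≃* (L ≃ₐ[K] L)) (α : Fin m → L)
    (r : ℕ) : Set (Matrix (BIdx m) (BIdx m) K) :=
  {M | ∃ f ∈ reedMuller e r, IsMatrixOf α f M}

end Codes

/-! ### Foldings -/

section Folding

variable {L : Type*} [Field L]

/-- The matrix product `(u₀ I  u₁ I) E (v₀ I ; v₁ I)`, where `E` is cut into four blocks according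
to the last coordinate of the indices. -/
def blockFold {n : ℕ} (u v : Fin 2 → L) (E : Matrix (BIdx (n + 1)) (BIdx (n + 1)) L) :
    Matrix (BIdx n) (BIdx n) L :=
  fun s t => ∑ a, ∑ b, u a * E (Fin.snoc s a) (Fin.snoc t b) * v b

/-- The folding of `E` with respect to `a` (which is the last generator `α_m`):
`(a⁻¹ I  I) E (I ; -a⁻¹ I)` in characteristic `≠ 2`, and `(I  a I) E (I ; a⁻¹ I)` in
characteristic `2`. Its entries lie in `K(α_m)` if those of `E` lie in `K`. -/
noncomputable def fold {n : ℕ} (a : L) (E : Matrix (BIdx (n + 1)) (BIdx (n + 1)) L) :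
    Matrix (BIdx n) (BIdx n) L :=
  if ringChar L = 2 then blockFold ![1, a] ![1, a⁻¹] E else blockFold ![a⁻¹, 1] ![1, -a⁻¹] E

/-- The iterated foldings of `E` (with respect to `α_m`, then `α_{m-1}`, and so on) have rank `t`
until the given depth, or until size `1 × 1` is reached. The `i`-th folding has its entries in
`K(α_{m-i+1}, …, α_m)`; its rank over this field and over `L` are the same. -/
def FoldingsHaveRank (t : ℕ) : (depth n : ℕ) → (Fin n → L) → Matrix (BIdx n) (BIdx n) L → Prop
  | 0, _, _, _ => True
  | _ + 1, 0, _, _ => True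
  | depth + 1, n + 1, α, E =>
      (fold (α (Fin.last n)) E).rank = t ∧
        FoldingsHaveRank t depth n (Fin.init α) (fold (α (Fin.last n)) E)

/-- The rank assumption on the error `E` for decoding `RM_{L/K}(r, m)`: the iterated foldings of `E`
until depth `r + 1` have the same rank as `E`. -/
def FoldingAssumption {K : Type*} [Field K] [Algebra K L] {m : ℕ} (α : Fin m → L) (r : ℕ)
    (E : Matrix (BIdx m) (BIdx m) K) : Prop :=
  FoldingsHaveRank E.rank (r + 1) m α (E.map (algebraMap K L))

end Folding

/-! Count indices from 0, put h = m - r - 1, and let L_h be the subfield fixed by θ_i for i < h, so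
that the products of distinct a_i, i < h, form a basis of L over L_h with 2^h elements. For an
endomorphism f = ∑ f_g g, the commutator with multiplication by a_p, divided by θ_p(a_p) - a_p, is
the part of f supported on the g that move a_p (`movePart_group`). In coordinates and up to a
nonzero factor, this is the folding (`fold_eq`).

Taking this part for all r + 1 indices p ≥ h kills every codeword, because only weights above r
could survive (`moveParts_toEndo`). Hence the last folding of the received word is that of the
error. Taking it for all indices ≥ h except one index p, and the complementary part at p, leaves at
most one group element of a codeword. That element fixes all a_i with i < h, so on their products
only an unknown multiple of the identity remains (`exceptPart_toEndo`).

The error is ∑ w_j F_j with t terms and F_j valued in K. Its last folding is ∑ w_j G_j with G_j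
valued in L_h. When the values of a map are fixed by θ_p, its part fixing a_p is the θ_p-conjugate
of its part moving a_p (`fixPart_eq`), so the exceptional part at p is ∑ w_j θ_p(G_j)
(`Prog.exceptPart_sum`). By the folding assumption the columns of the last folding span an L_h-space
of dimension t, which must then be the span of the w_j. Two things follow. The exceptional parts of
the error lie in this known space, which is proper because `minRankDist_le` gives t < 2^h; a
functional vanishing on it reveals the unknown multiple (`annihilator_inv_mul_sum`). Moreover the
semilinear map ∑ w_j c_j ↦ ∑ w_j θ_p(c_j) is known from its values on a basis of the space
(`PivotSystem.sum_conj`). It turns the part moving a_p into the part fixing a_p, and so the foldings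
of the error are undone one at a time for p = h, …, m - 1 (`Prog.Comp.unfoldStep`).

For the cost, an element of L serves as a column of length 2^h over L_h. Coefficients are extracted
by renaming registers, and a scalar times a column is one multiplication in L. Elimination treats
2^h columns against at most t pivots. Inversions, by the norm, cost O(2^m) multiplications but occur
at most t + 1 times. Linear operations cost O(2^m) operations in K, which is absorbed by the bound
2^m ≤ 2𝓜 of `two_pow_le_two_mul`. The total is at most 80 max(t,1) 2^m 𝓜, and max(t,1) ≤
max(t,1)^(ω-1) since ω > 2. -/

/-! ### Programs with operation counts. -/

/-- A program fragment in continuation passing style: given the first unused workspace register and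
what to do with its result, it yields a computation tree. -/
def Prog (K I O A : Type*) : Type _ :=
  ℕ → (A → ℕ → CompTree K I O) → CompTree K I O

/-- A workspace together with a bound for the registers in use. -/
structure Mem (K : Type*) where
  fresh : ℕ
  val : ℕ → K

/-- `ν` is a later state than `μ`: the registers in use are not overwritten. -/
def Mem.Ext {K : Type*} (μ ν : Mem K) : Prop :=
  μ.fresh ≤ ν.fresh ∧ ∀ d < μ.fresh, ν.val d = μ.val d

theorem Mem.Ext.refl {K : Type*} (μ : Mem K) : μ.Ext μ := ⟨le_rfl, fun _ _ => rfl⟩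

theorem Mem.Ext.trans {K : Type*} {μ ν ξ : Mem K} (h : μ.Ext ν) (h' : ν.Ext ξ) : μ.Ext ξ :=
  ⟨h.1.trans h'.1, fun d hd => (h'.2 d (hd.trans_le h.1)).trans (h.2 d hd)⟩

/-- In state `μ`, the register `a` is in use and contains `v`. -/
def Mem.Holds {K I : Type*} (x : I → K) (μ : Mem K) (a : I ⊕ ℕ) (v : K) : Prop :=
  (∀ d, a = Sum.inr d → d < μ.fresh) ∧ Sum.elim x μ.val a = v

theorem Mem.Holds.ext {K I : Type*} {x : I → K} {μ ν : Mem K} {a : I ⊕ ℕ} {v : K}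
    (h : μ.Holds x a v) (hμ : μ.Ext ν) : ν.Holds x a v := by
  refine ⟨fun d hd => (h.1 d hd).trans_le hμ.1, ?_⟩
  rw [← h.2]
  cases a with
  | inl i => rfl
  | inr d => exact hμ.2 d (h.1 d rfl)

/-- The state after writing `v` to the first unused register. -/
def Mem.push {K : Type*} (μ : Mem K) (v : K) : Mem K :=
  ⟨μ.fresh + 1, Function.update μ.val μ.fresh v⟩

theorem Mem.ext_push {K : Type*} (μ : Mem K) (v : K) : μ.Ext (μ.push v) :=
  ⟨Nat.le_succ _, fun _ hd => Function.update_of_ne hd.ne _ _⟩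

theorem Mem.holds_push {K I : Type*} (x : I → K) (μ : Mem K) (v : K) :
    (μ.push v).Holds x (Sum.inr μ.fresh) v := by
  refine ⟨fun d hd => ?_, ?_⟩
  · cases hd
    exact Nat.lt_succ_self _
  · simp [Mem.push]

namespace Prog

variable {K I O A B ι : Type*}

/-- Return a result without computing anything. -/
def pure (a : A) : Prog K I O A := fun n k => k a n

/-- Sequential composition. -/
def bind (p : Prog K I O A) (f : A → Prog K I O B) : Prog K I O B :=
  fun n k => p n fun a n' => f a n' k

/-- Load a constant. -/
def const (c : K) : Prog K I O (I ⊕ ℕ) := fun n k => .const n c (k (.inr n) (n + 1))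

/-- One arithmetic operation. -/
def arith (op : ArithOp) (a b : I ⊕ ℕ) : Prog K I O (I ⊕ ℕ) :=
  fun n k => .arith op n a b (k (.inr n) (n + 1))

/-- Branch according to whether a register contains zero. -/
def test (a : I ⊕ ℕ) (p q : Prog K I O A) : Prog K I O A := fun n k => .test a (p n k) (q n k)

/-- Run the program for all members of a list and collect the results. -/
def mapList [DecidableEq ι] [Inhabited A] (f : ι → Prog K I O A) : List ι → Prog K I O (ι → A)
  | [] => pure fun _ => default
  | i :: l => (f i).bind fun a => (mapList f l).bind fun g => pure (Function.update g i a)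

/-- Add up the results of the programs for the members of a list. -/
def sumList (zero : Prog K I O A) (add : A → A → Prog K I O A) (f : ι → Prog K I O A) :
    List ι → Prog K I O A
  | [] => zero
  | i :: l => (f i).bind fun a => (sumList zero add f l).bind fun b => add a b

/-- Apply `f 0, …, f (n - 1)` successively. -/
def iter (f : ℕ → A → Prog K I O A) : ℕ → A → Prog K I O A
  | 0, a => pure a
  | n + 1, a => (iter f n a).bind (f n)

/-- The first member of a list whose register does not contain zero. -/
def findNonzero (a : ι → I ⊕ ℕ) : List ι → Prog K I O (Option ι)
  | [] => pure none
  | i :: l => test (a i) (findNonzero a l) (pure (some i))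

/-- Use a computation tree as a subroutine, with its inputs in the registers `ρ` and its workspace
in the registers `η`. -/
def embed {I' O' : Type*} (ρ : I' → I ⊕ ℕ) :
    CompTree K I' O' → (ℕ → I ⊕ ℕ) → Prog K I O (O' → I ⊕ ℕ)
  | .output out, η => pure fun o => Sum.elim ρ η (out o)
  | .const d c next, η => fun n k =>
      .const n c (embed ρ next (Function.update η d (.inr n)) (n + 1) k)
  | .arith op d a b next, η => fun n k =>
      .arith op n (Sum.elim ρ η a) (Sum.elim ρ η b)
        (embed ρ next (Function.update η d (.inr n)) (n + 1) k)
  | .test a p q, η => test (Sum.elim ρ η a) (embed ρ p η) (embed ρ q η)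

variable [Field K]

/-- On the input `x`, the program runs from state `μ` to a result, a later state and a cost that
satisfy `Q`. -/
def Yields (x : I → K) (p : Prog K I O A) (μ : Mem K) (Q : A → Mem K → ℕ → Prop) : Prop :=
  ∃ a ν c, μ.Ext ν ∧ Q a ν c ∧ ∀ k, CompTree.exec x (p μ.fresh k) μ.val =
    (CompTree.exec x (k a ν.fresh) ν.val).map fun s => (s.1, s.2 + c)

variable {x : I → K} {p : Prog K I O A} {μ : Mem K}

theorem Yields.mono {Q R : A → Mem K → ℕ → Prop} (h : Yields x p μ Q)
    (hQ : ∀ a ν c, μ.Ext ν → Q a ν c → R a ν c) : Yields x p μ R := by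
  obtain ⟨a, ν, c, h1, h2, h3⟩ := h
  exact ⟨a, ν, c, h1, hQ a ν c h1 h2, h3⟩

theorem Yields.pure {Q : A → Mem K → ℕ → Prop} {a : A} (h : Q a μ 0) :
    Yields x (pure a : Prog K I O A) μ Q :=
  ⟨a, μ, 0, Mem.Ext.refl _, h, fun k => by simp [Prog.pure]⟩

theorem Yields.bind {f : A → Prog K I O B} {Q : A → Mem K → ℕ → Prop} {R : B → Mem K → ℕ → Prop}
    (hp : Yields x p μ Q)
    (hf : ∀ a ν c, μ.Ext ν → Q a ν c → Yields x (f a) ν fun b ξ c' => R b ξ (c + c')) :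
    Yields x (p.bind f) μ R := by
  obtain ⟨a, ν, c, h1, h2, h3⟩ := hp
  obtain ⟨b, ξ, c', h1', h2', h3'⟩ := hf a ν c h1 h2
  refine ⟨b, ξ, c + c', h1.trans h1', h2', fun k => ?_⟩
  rw [Prog.bind, h3, h3', Option.map_map]
  congr 1
  funext s
  simp [add_assoc, add_comm c']

/-- On the input `x`, the program runs from state `μ`, with at most `c` operations, to a result and
a later state that satisfy `R`. -/
def Comp (x : I → K) (μ : Mem K) (p : Prog K I O A) (c : ℕ) (R : Mem K → A → Prop) : Prop :=
  Yields x p μ fun a ν c' => R ν a ∧ c' ≤ c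

theorem Comp.mono {c c' : ℕ} {R S : Mem K → A → Prop} (h : Comp x μ p c R) (hc : c ≤ c')
    (hR : ∀ ν a, μ.Ext ν → R ν a → S ν a) : Comp x μ p c' S :=
  Yields.mono h fun a ν _ h1 h2 => ⟨hR ν a h1 h2.1, h2.2.trans hc⟩

theorem Comp.le {c c' : ℕ} {R : Mem K → A → Prop} (h : Comp x μ p c R) (hc : c ≤ c') :
    Comp x μ p c' R :=
  h.mono hc fun _ _ _ h => h

theorem Comp.pure {c : ℕ} {R : Mem K → A → Prop} {a : A} (h : R μ a) :
    Comp x μ (Prog.pure a : Prog K I O A) c R :=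
  Yields.pure ⟨h, Nat.zero_le _⟩

theorem Comp.bind {f : A → Prog K I O B} {c c' : ℕ} {R : Mem K → A → Prop} {S : Mem K → B → Prop}
    (hp : Comp x μ p c R) (hf : ∀ a ν, μ.Ext ν → R ν a → Comp x ν (f a) c' S) :
    Comp x μ (p.bind f) (c + c') S :=
  Yields.bind hp fun a ν _ h1 h2 =>
    Yields.mono (hf a ν h1 h2.1) fun _ _ _ _ h => ⟨h.1, Nat.add_le_add h2.2 h.2⟩

theorem Comp.const (c : K) :
    Comp x μ (const c : Prog K I O _) 0 fun ν a => ν.Holds x a c :=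
  ⟨_, μ.push c, 0, μ.ext_push c, ⟨Mem.holds_push x μ c, le_rfl⟩, fun k => by
    simp [Prog.const, CompTree.exec, Mem.push]⟩

theorem Comp.arith {op : ArithOp} {a b : I ⊕ ℕ} {u v w : K} (ha : μ.Holds x a u)
    (hb : μ.Holds x b v) (hw : op.apply u v = some w) :
    Comp x μ (arith op a b : Prog K I O _) 1 fun ν r => ν.Holds x r w :=
  ⟨_, μ.push w, 1, μ.ext_push w, ⟨Mem.holds_push x μ w, le_rfl⟩, fun k => by
    simp [Prog.arith, CompTree.exec, Mem.push, ha.2, hb.2, hw]⟩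

theorem Yields.test_zero {a : I ⊕ ℕ} {q : Prog K I O A} {Q : A → Mem K → ℕ → Prop}
    (ha : μ.Holds x a 0) (h : Yields x p μ fun b ν c => Q b ν (c + 1)) :
    Yields x (test a p q) μ Q := by
  obtain ⟨b, ν, c, h1, h2, h3⟩ := h
  refine ⟨b, ν, c + 1, h1, h2, fun k => ?_⟩
  simp [Prog.test, CompTree.exec, ha.2, h3]
  rfl

theorem Yields.test_ne {a : I ⊕ ℕ} {v : K} {q : Prog K I O A} {Q : A → Mem K → ℕ → Prop}
    (ha : μ.Holds x a v) (hv : v ≠ 0) (h : Yields x q μ fun b ν c => Q b ν (c + 1)) :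
    Yields x (test a p q) μ Q := by
  obtain ⟨b, ν, c, h1, h2, h3⟩ := h
  refine ⟨b, ν, c + 1, h1, h2, fun k => ?_⟩
  simp [Prog.test, CompTree.exec, ha.2, hv, h3]
  rfl

theorem Comp.mapList [DecidableEq ι] [Inhabited A] {f : ι → Prog K I O A} {c : ℕ}
    {R : ι → Mem K → A → Prop} (hR : ∀ i μ ν a, Mem.Ext μ ν → R i μ a → R i ν a) (l : List ι)
    (hf : ∀ i ∈ l, ∀ ν, μ.Ext ν → Comp x ν (f i) c (R i)) :
    Comp x μ (mapList f l) (l.length * c) fun ν g => ∀ i ∈ l, R i ν (g i) := by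
  induction l generalizing μ with
  | nil => exact Comp.pure (by simp)
  | cons i l ih =>
    have h1 := hf i (by simp) μ (Mem.Ext.refl _)
    refine (h1.bind (c' := l.length * c) fun a ν hν ha => ?_).le (by simp; ring_nf; rfl)
    refine Comp.bind (c' := 0)
      (ih (fun j hj ξ hξ => hf j (by simp [hj]) ξ (hν.trans hξ))) fun g ξ hξ hg => ?_
    refine Comp.pure fun j hj => ?_
    by_cases hji : j = i
    · subst hji
      simpa using hR _ _ _ _ hξ ha
    · rw [Function.update_of_ne hji]
      exact hg j (by simpa [hji] using hj)

theorem Comp.sumList {W : Type*} [AddCommMonoid W] {zero : Prog K I O A}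
    {add : A → A → Prog K I O A} {f : ι → Prog K I O A} {c d : ℕ} {R : Mem K → A → W → Prop}
    (hR : ∀ μ ν a w, Mem.Ext μ ν → R μ a w → R ν a w)
    (hzero : ∀ μ, Comp x μ zero 0 fun ν a => R ν a 0)
    (hadd : ∀ μ a b v w, R μ a v → R μ b w → Comp x μ (add a b) d fun ν r => R ν r (v + w))
    (w : ι → W) (l : List ι)
    (hf : ∀ i ∈ l, ∀ ν, μ.Ext ν → Comp x ν (f i) c fun ξ a => R ξ a (w i)) :
    Comp x μ (sumList zero add f l) (l.length * (c + d)) fun ν a => R ν a (l.map w).sum := by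
  induction l generalizing μ with
  | nil => simpa [Prog.sumList] using hzero μ
  | cons i l ih =>
    have h1 := hf i (by simp) μ (Mem.Ext.refl _)
    refine (h1.bind (c' := l.length * (c + d) + d) fun a ν hν ha => ?_).le
      (by simp; ring_nf; rfl)
    refine Comp.bind
      (ih (fun j hj ξ hξ => hf j (by simp [hj]) ξ (hν.trans hξ))) fun b ξ hξ hb => ?_
    simpa using hadd ξ a b _ _ (hR _ _ _ _ hξ ha) hb

theorem Comp.iter {f : ℕ → A → Prog K I O A} {c : ℕ → ℕ} {J : ℕ → Mem K → A → Prop} {n : ℕ}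
    {a : A} (h0 : J 0 μ a)
    (hf : ∀ i < n, ∀ ν b, μ.Ext ν → J i ν b → Comp x ν (f i b) (c i) (J (i + 1))) :
    Comp x μ (iter f n a) (∑ i ∈ Finset.range n, c i) (J n) := by
  induction n with
  | zero => exact Comp.pure h0
  | succ n ih =>
    rw [Finset.sum_range_succ]
    exact (ih fun i hi => hf i (by omega)).bind fun b ν hν hb => hf n (by omega) ν b hν hb

/-- Only tests are executed, so the memory is untouched. The index found is known to the rest of the
tree, because every outcome has its own branch. -/
theorem Comp.findNonzero {a : ι → I ⊕ ℕ} {v : ι → K} (l : List ι)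
    (ha : ∀ i ∈ l, μ.Holds x (a i) (v i)) :
    Comp x μ (findNonzero a l : Prog K I O _) l.length fun ν r => (ν = μ) ∧
      match r with
      | none => ∀ i ∈ l, v i = 0
      | some i => v i ≠ 0 := by
  induction l with
  | nil => exact Comp.pure (by simp)
  | cons i l ih =>
    by_cases hi : v i = 0
    · refine Yields.test_zero (hi ▸ ha i (by simp)) ?_
      refine Yields.mono (ih fun j hj => ha j (by simp [hj])) fun r ν c _ h => ?_
      refine ⟨⟨h.1.1, ?_⟩, by simpa using h.2⟩
      cases r with
      | none => simpa [hi] using h.1.2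
      | some j => exact h.1.2
    · exact Yields.test_ne (ha i (by simp)) hi (Yields.pure ⟨⟨rfl, hi⟩, by simp⟩)

/-- Every write of the subroutine goes to a fresh register and only the renaming `η` changes, so its
inputs survive and its count is unchanged. -/
theorem Yields.embed {I' O' : Type*} {ρ : I' → I ⊕ ℕ} {x' : I' → K} (T : CompTree K I' O')
    {η : ℕ → I ⊕ ℕ} {w : ℕ → K} {z : O' → K} {c : ℕ} (hρ : ∀ i, μ.Holds x (ρ i) (x' i))
    (hη : ∀ d, μ.Holds x (η d) (w d)) (hT : T.exec x' w = some (z, c)) :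
    Yields x (embed ρ T η : Prog K I O _) μ fun a ν c' => (∀ o, ν.Holds x (a o) (z o)) ∧ c' = c := by
  have key : ∀ {μ : Mem K} {η : ℕ → I ⊕ ℕ} {w : ℕ → K}, (∀ i, μ.Holds x (ρ i) (x' i)) →
      (∀ d, μ.Holds x (η d) (w d)) →
      ∀ a, μ.Holds x (Sum.elim ρ η a) (Sum.elim x' w a) := by
    rintro μ η w h1 h2 (a | a)
    exacts [h1 a, h2 a]
  have upd : ∀ {μ : Mem K} {η : ℕ → I ⊕ ℕ} {w : ℕ → K} (d : ℕ) (v : K),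
      (∀ d, μ.Holds x (η d) (w d)) →
      ∀ d', (μ.push v).Holds x (Function.update η d (Sum.inr μ.fresh) d')
        (Function.update w d v d') := by
    intro μ η w d v h d'
    by_cases hd : d' = d
    · subst hd
      simpa using Mem.holds_push x μ v
    · simpa [Function.update_of_ne hd] using (h d').ext (μ.ext_push v)
  induction T generalizing μ η w c with
  | output out =>
    simp only [CompTree.exec, Option.some.injEq, Prod.mk.injEq] at hT
    obtain ⟨rfl, rfl⟩ := hT
    exact Yields.pure ⟨fun o => key hρ hη _, rfl⟩
  | const d v next ih =>
    obtain ⟨a, ν, c', h1, h2, h3⟩ := ih (μ := μ.push v) (η := Function.update η d (.inr μ.fresh))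
      (fun i => (hρ i).ext (μ.ext_push v)) (upd d v hη) hT
    exact ⟨a, ν, c', (μ.ext_push v).trans h1, h2, h3⟩
  | arith op d a b next ih =>
    simp only [CompTree.exec, Option.bind_eq_some_iff, Option.map_eq_some_iff] at hT
    obtain ⟨v, hv, ⟨z', c₀⟩, hs, he⟩ := hT
    simp only [Prod.mk.injEq] at he
    obtain ⟨rfl, rfl⟩ := he
    obtain ⟨r, ν, c', h1, h2, h3⟩ := ih (μ := μ.push v) (η := Function.update η d (.inr μ.fresh))
      (fun i => (hρ i).ext (μ.ext_push v)) (upd d v hη) hs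
    refine ⟨r, ν, c' + 1, (μ.ext_push v).trans h1, ⟨h2.1, by rw [h2.2]⟩, fun k => ?_⟩
    have h3' := h3 k
    simp only [Mem.push] at h3'
    simp [Prog.embed, CompTree.exec, (key hρ hη a).2, (key hρ hη b).2, hv, h3']
    rfl
  | test a p q ihp ihq =>
    simp only [CompTree.exec, Option.map_eq_some_iff] at hT
    obtain ⟨⟨z', c₀⟩, hs, he⟩ := hT
    simp only [Prod.mk.injEq] at he
    obtain ⟨rfl, rfl⟩ := he
    by_cases h : Sum.elim x' w a = 0
    · rw [if_pos h] at hs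
      refine Yields.test_zero (h ▸ key hρ hη a) ((ihp hρ hη hs).mono fun r ν c' _ h => ?_)
      exact ⟨h.1, by rw [h.2]⟩
    · rw [if_neg h] at hs
      refine Yields.test_ne (key hρ hη a) h ((ihq hρ hη hs).mono fun r ν c' _ h => ?_)
      exact ⟨h.1, by rw [h.2]⟩

/-- The computation tree that runs a program and outputs its result. -/
def toTree (p : Prog K I O (O → I ⊕ ℕ)) : CompTree K I O := p 0 fun a _ => .output a

theorem Comp.run_toTree {p : Prog K I O (O → I ⊕ ℕ)} {c : ℕ} {z : O → K}
    (h : Comp x ⟨0, fun _ => 0⟩ p c fun ν a => ∀ o, ν.Holds x (a o) (z o)) :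
    ∃ c' ≤ c, (toTree p).run x = some (z, c') := by
  obtain ⟨a, ν, c', _, h2, h3⟩ := h
  refine ⟨c', h2.2, ?_⟩
  rw [CompTree.run, toTree]
  refine (h3 _).trans ?_
  simp only [CompTree.exec, Option.map_some, zero_add, Option.some.injEq, Prod.mk.injEq, and_true]
  funext o
  exact (h2.1 o).2

end Prog

/-! ### Coordinates over the fixed fields of θ_0, …, θ_{h-1}. -/

section Tower

/-- The index `s` with its `p`-th entry replaced by `ε`. -/
def setBit {m : ℕ} (s : BIdx m) (p : ℕ) (ε : Fin 2) : BIdx m := fun i => if i.val = p then ε else s i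

/-- The `p`-th entry of `s`. -/
def getBit {m : ℕ} (s : BIdx m) (p : ℕ) : Fin 2 := if h : p < m then s ⟨p, h⟩ else 0

/-- The indices of the products of distinct elements of `α_0, …, α_{p-1}`. -/
def low (m p : ℕ) : Finset (BIdx m) := Finset.univ.filter fun s => ∀ i : Fin m, p ≤ i.val → s i = 0

variable {m : ℕ}

theorem mem_low {p : ℕ} {s : BIdx m} : s ∈ low m p ↔ ∀ i : Fin m, p ≤ i.val → s i = 0 := by
  simp [low]

theorem low_top : low m m = Finset.univ := by
  ext s
  simp only [mem_low, Finset.mem_univ, iff_true]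
  intro i hi
  omega

theorem setBit_self (s : BIdx m) (p : ℕ) : setBit s p (getBit s p) = s := by
  funext i
  by_cases h : i.val = p
  · subst h
    simp [setBit, getBit]
  · simp [setBit, h]

theorem getBit_setBit {p : ℕ} (hp : p < m) (s : BIdx m) (ε : Fin 2) : getBit (setBit s p ε) p = ε := by
  simp [setBit, getBit, hp]

theorem getBit_setBit_of_ne {p q : ℕ} (h : q ≠ p) (s : BIdx m) (ε : Fin 2) :
    getBit (setBit s p ε) q = getBit s q := by
  simp [setBit, getBit, h]

theorem setBit_setBit (s : BIdx m) (p : ℕ) (ε ε' : Fin 2) :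
    setBit (setBit s p ε) p ε' = setBit s p ε' := by
  funext i
  simp only [setBit]
  split_ifs <;> rfl

theorem getBit_of_mem_low {p q : ℕ} {s : BIdx m} (hs : s ∈ low m p) (h : p ≤ q) : getBit s q = 0 := by
  rw [getBit]
  split_ifs with hq
  · exact mem_low.1 hs _ h
  · rfl

theorem low_mono {p q : ℕ} (h : p ≤ q) : low m p ⊆ low m q :=
  fun _ hs => mem_low.2 fun i hi => mem_low.1 hs i (h.trans hi)

theorem setBit_mem_low {p : ℕ} {s : BIdx m} (hs : s ∈ low m (p + 1)) : setBit s p 0 ∈ low m p := by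
  rw [mem_low] at hs ⊢
  intro i hi
  by_cases h : i.val = p
  · simp [setBit, h]
  · simpa [setBit, h] using hs i (by omega)

theorem setBit_one_mem_low {p : ℕ} {s : BIdx m} (hs : s ∈ low m p) (ε : Fin 2) :
    setBit s p ε ∈ low m (p + 1) := by
  rw [mem_low] at hs ⊢
  intro i hi
  have h : i.val ≠ p := by omega
  simpa [setBit, h] using hs i (by omega)

theorem sum_eq_sum_filter_getBit {A : Type*} [AddCommMonoid A] {p : ℕ} (hp : p < m)
    (S : Finset (BIdx m)) (hS : ∀ s ∈ S, ∀ ε, setBit s p ε ∈ S) (f : BIdx m → A) :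
    ∑ s ∈ S, f s = ∑ s ∈ S with getBit s p = 0, (f s + f (setBit s p 1)) := by
  rw [Finset.sum_add_distrib, ← Finset.sum_filter_add_sum_filter_not S fun s => getBit s p = 0]
  congr 1
  refine Finset.sum_nbij' (fun s => setBit s p 0) (fun s => setBit s p 1) ?_ ?_ ?_ ?_ ?_
  · intro s hs
    exact Finset.mem_filter.2 ⟨hS s (Finset.mem_filter.1 hs).1 0, getBit_setBit hp _ _⟩
  · intro s hs
    refine Finset.mem_filter.2 ⟨hS s (Finset.mem_filter.1 hs).1 1, ?_⟩
    rw [getBit_setBit hp]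
    decide
  · intro s hs
    have h := (Finset.mem_filter.1 hs).2
    have h1 : getBit s p = 1 := by omega
    simp only [setBit_setBit]
    rw [← h1, setBit_self]
  · intro s hs
    simp only [setBit_setBit]
    rw [← (Finset.mem_filter.1 hs).2, setBit_self]
  · intro s hs
    have h := (Finset.mem_filter.1 hs).2
    have h1 : getBit s p = 1 := by omega
    simp only [setBit_setBit]
    rw [← h1, setBit_self]

theorem sum_low_succ {A : Type*} [AddCommMonoid A] {p : ℕ} (hp : p < m) (f : BIdx m → A) :
    ∑ s ∈ low m (p + 1), f s = ∑ s ∈ low m p, (f s + f (setBit s p 1)) := by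
  rw [sum_eq_sum_filter_getBit hp]
  · refine Finset.sum_congr ?_ fun _ _ => rfl
    ext s
    simp only [Finset.mem_filter]
    constructor
    · rintro ⟨h1, h2⟩
      have := setBit_mem_low h1
      rwa [← h2, setBit_self] at this
    · exact fun h => ⟨low_mono (Nat.le_succ p) h, getBit_of_mem_low h le_rfl⟩
  · intro s hs ε
    have := setBit_one_mem_low (setBit_mem_low hs) ε
    rwa [setBit_setBit] at this

theorem low_zero : low m 0 = {0} := by
  ext s
  simp only [mem_low, Nat.zero_le, forall_const, Finset.mem_singleton]
  exact ⟨fun h => funext h, fun h i => congrFun h i⟩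

theorem card_low {p : ℕ} (hp : p ≤ m) : (low m p).card = 2 ^ p := by
  induction p with
  | zero => simp [low_zero]
  | succ p ih =>
    rw [Finset.card_eq_sum_ones, sum_low_succ (by omega), Finset.sum_const, ih (by omega)]
    simp [pow_succ]

variable {K L : Type*} [Field K] [Field L] [Algebra K L]

/-- Commuting involutions `θ_i`, `i < m`, and elements `a_i`, such that `θ_i` moves `a_i` and fixes
the others. -/
structure DualGenerators (m : ℕ) (θ : ℕ → L ≃ₐ[K] L) (a : ℕ → L) : Prop where
  comm : ∀ i j x, θ i (θ j x) = θ j (θ i x)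
  invol : ∀ i x, θ i (θ i x) = x
  fix : ∀ i j, i ≠ j → θ i (a j) = a j
  move : ∀ i < m, θ i (a i) - a i ≠ 0

variable (θ : ℕ → L ≃ₐ[K] L) (a : ℕ → L)

/-- The coefficients of `1` (for `ε = 0`) and `a_i` (for `ε = 1`) of an element of `L`, with respect
to its subfield fixed by `θ_i`. -/
noncomputable def coeffOp (i : ℕ) (ε : Fin 2) (x : L) : L :=
  if ε = 1 then (θ i x - x) / (θ i (a i) - a i) else x - a i * ((θ i x - x) / (θ i (a i) - a i))

/-- The coefficients of an element of `L` with respect to the products of distinct elements of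
`a_0, …, a_{h-1}`. -/
noncomputable def coord (s : BIdx m) : ℕ → L → L
  | 0, x => x
  | h + 1, x => coeffOp θ a h (getBit s h) (coord s h x)

/-- The product of the `a_i` with `s_i = 1`. -/
noncomputable def bas (s : BIdx m) : L := basisElt (fun i : Fin m => a i) s

/-- The dual basis of `bas`, with respect to the coefficient of the product of all `a_i`, `i < h`. -/
noncomputable def dualBas (s : BIdx m) : ℕ → L
  | 0 => 1
  | h + 1 => dualBas s h * (if getBit s h = 1 then 1 else -θ h (a h))

/-- The coefficient of the product of `a_0, …, a_{h-1}`. -/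
noncomputable def topCoord (m h : ℕ) (x : L) : L := coord θ a (fun _ : Fin m => 1) h x

variable {θ a} (hθ : DualGenerators m θ a)

/-- The elements of `L` fixed by `θ_i` for `i < h`. -/
def FixedBelow (θ : ℕ → L ≃ₐ[K] L) (h : ℕ) (x : L) : Prop := ∀ i < h, θ i x = x

theorem FixedBelow.mono {h h' : ℕ} {x : L} (hx : FixedBelow θ h x) (hh : h' ≤ h) :
    FixedBelow θ h' x := fun i hi => hx i (hi.trans_le hh)

theorem FixedBelow.mul {h : ℕ} {x y : L} (hx : FixedBelow θ h x) (hy : FixedBelow θ h y) :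
    FixedBelow θ h (x * y) := fun i hi => by rw [map_mul, hx i hi, hy i hi]

theorem FixedBelow.sum {ι : Type*} {h : ℕ} (S : Finset ι) {f : ι → L}
    (hf : ∀ i ∈ S, FixedBelow θ h (f i)) : FixedBelow θ h (∑ i ∈ S, f i) := fun i hi => by
  rw [map_sum]
  exact Finset.sum_congr rfl fun j hj => hf j hj i hi

theorem FixedBelow.inv {h : ℕ} {x : L} (hx : FixedBelow θ h x) : FixedBelow θ h x⁻¹ :=
  fun i hi => by rw [map_inv₀, hx i hi]

theorem coeffOp_mul {i : ℕ} {c : L} (hc : θ i c = c) (ε : Fin 2) (x : L) :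
    coeffOp θ a i ε (c * x) = c * coeffOp θ a i ε x := by
  simp only [coeffOp, map_mul, hc]
  split_ifs <;> ring

theorem coeffOp_add (i : ℕ) (ε : Fin 2) (x y : L) :
    coeffOp θ a i ε (x + y) = coeffOp θ a i ε x + coeffOp θ a i ε y := by
  simp only [coeffOp, map_add]
  split_ifs <;> ring

theorem coeffOp_decomp (i : ℕ) (x : L) : coeffOp θ a i 0 x + a i * coeffOp θ a i 1 x = x := by
  simp [coeffOp]

include hθ

theorem coeffOp_fixed {i : ℕ} (hi : i < m) (ε : Fin 2) (x : L) :
    θ i (coeffOp θ a i ε x) = coeffOp θ a i ε x := by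
  have hm := hθ.move i hi
  have hm' : a i - θ i (a i) ≠ 0 := fun h => hm (by linear_combination -h)
  simp only [coeffOp]
  split_ifs
  · simp only [map_div₀, map_sub, hθ.invol]
    field_simp
    ring
  · simp only [map_div₀, map_sub, hθ.invol, map_mul]
    field_simp
    ring

theorem coeffOp_comm {i j : ℕ} (hij : i ≠ j) (ε : Fin 2) (x : L) :
    θ i (coeffOp θ a j ε x) = coeffOp θ a j ε (θ i x) := by
  simp only [coeffOp]
  split_ifs <;>
  simp only [map_div₀, map_sub, map_mul, hθ.fix i j hij, hθ.comm i j]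

theorem coord_fixed {h : ℕ} (hh : h ≤ m) (s : BIdx m) (x : L) : FixedBelow θ h (coord θ a s h x) := by
  induction h with
  | zero => exact fun i hi => absurd hi (Nat.not_lt_zero _)
  | succ h ih =>
    intro i hi
    rw [coord]
    by_cases hih : i = h
    · subst hih
      exact coeffOp_fixed hθ hh _ _
    · rw [coeffOp_comm hθ hih, ih (by omega) i (by omega)]

omit hθ

theorem coord_mul {h : ℕ} {c : L} (hc : FixedBelow θ h c) (s : BIdx m) (x : L) :
    coord θ a s h (c * x) = c * coord θ a s h x := by
  induction h with
  | zero => rfl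
  | succ h ih => rw [coord, coord, ih (hc.mono (Nat.le_succ h)), coeffOp_mul (hc h (Nat.lt_succ_self h))]

theorem coord_add (h : ℕ) (s : BIdx m) (x y : L) :
    coord θ a s h (x + y) = coord θ a s h x + coord θ a s h y := by
  induction h with
  | zero => rfl
  | succ h ih => rw [coord, coord, coord, ih, coeffOp_add]

/-- `coord` as an additive map. -/
noncomputable def coordHom (θ : ℕ → L ≃ₐ[K] L) (a : ℕ → L) (h : ℕ) (s : BIdx m) : L →+ L :=
  AddMonoidHom.mk' (coord θ a s h) (coord_add h s)

theorem coord_sum {ι : Type*} (h : ℕ) (s : BIdx m) (S : Finset ι) (f : ι → L) :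
    coord θ a s h (∑ i ∈ S, f i) = ∑ i ∈ S, coord θ a s h (f i) :=
  map_sum (coordHom θ a h s) f S

theorem coord_sub (h : ℕ) (s : BIdx m) (x y : L) :
    coord θ a s h (x - y) = coord θ a s h x - coord θ a s h y :=
  map_sub (coordHom θ a h s) x y

theorem coord_congr {h : ℕ} {s s' : BIdx m} (hs : ∀ i < h, getBit s i = getBit s' i) (x : L) :
    coord θ a s h x = coord θ a s' h x := by
  induction h with
  | zero => rfl
  | succ h ih => rw [coord, coord, ih fun i hi => hs i (by omega), hs h (Nat.lt_succ_self h)]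

theorem dualBas_congr {h : ℕ} {s s' : BIdx m} (hs : ∀ i < h, getBit s i = getBit s' i) :
    dualBas θ a s h = dualBas θ a s' h := by
  induction h with
  | zero => rfl
  | succ h ih => rw [dualBas, dualBas, ih fun i hi => hs i (by omega), hs h (Nat.lt_succ_self h)]

theorem bas_zero : bas a (0 : BIdx m) = 1 := by simp [bas, basisElt]

theorem bas_setBit_one {p : ℕ} (hp : p < m) (s : BIdx m) :
    bas a (setBit s p 1) = a p * bas a (setBit s p 0) := by
  simp only [bas, basisElt]
  rw [← Finset.mul_prod_erase _ _ (Finset.mem_univ (⟨p, hp⟩ : Fin m)),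
    ← Finset.mul_prod_erase _ _ (Finset.mem_univ (⟨p, hp⟩ : Fin m)),
    Finset.prod_congr rfl (g := fun i : Fin m => a i ^ (setBit s p 0 i : ℕ))]
  · simp [setBit]
  · intro i hi
    have : i.val ≠ p := fun h => (Finset.mem_erase.1 hi).1 (Fin.ext h)
    simp [setBit, this]

theorem bas_setBit_low {p : ℕ} (hp : p < m) {s : BIdx m} (hs : s ∈ low m p) :
    bas a (setBit s p 1) = a p * bas a s := by
  rw [bas_setBit_one hp, ← getBit_of_mem_low hs le_rfl, setBit_self]

theorem map_bas_of_getBit (hθ : DualGenerators m θ a) {i : ℕ} {s : BIdx m} (hs : getBit s i = 0) :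
    θ i (bas a s) = bas a s := by
  simp only [bas, basisElt, map_prod, map_pow]
  refine Finset.prod_congr rfl fun j _ => ?_
  by_cases hij : i = j.val
  · subst hij
    have : s j = 0 := by simpa [getBit] using hs
    simp [this]
  · rw [hθ.fix i j hij]

theorem topCoord_succ {h : ℕ} (hh : h < m) (x : L) :
    topCoord θ a m (h + 1) x = coeffOp θ a h 1 (topCoord θ a m h x) := by
  rw [topCoord, coord, topCoord]
  simp [getBit, hh]

include hθ in
-- In a quadratic step, the coefficient of 1 in x is the coefficient of a in -θ(a)x. By induction
-- every coordinate is the top one after multiplication by an element of L, so elements of L can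
-- represent functionals.
theorem coord_eq_topCoord {h : ℕ} (hh : h ≤ m) (s : BIdx m) (x : L) :
    coord θ a s h x = topCoord θ a m h (dualBas θ a s h * x) := by
  induction h generalizing x with
  | zero => simp [coord, topCoord, dualBas]
  | succ h ih =>
    have hm := hθ.move h hh
    have hc : FixedBelow θ h (if getBit s h = 1 then (1 : L) else -θ h (a h)) := by
      intro i hi
      split_ifs
      · simp
      · rw [map_neg, hθ.comm, hθ.fix i h (by omega)]
    rw [topCoord_succ (by omega), coord]
    rw [show dualBas θ a s (h + 1) * x =
      (if getBit s h = 1 then (1 : L) else -θ h (a h)) * (dualBas θ a s h * x) by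
        rw [dualBas]; ring, topCoord, coord_mul hc, ← topCoord, ← ih (by omega)]
    by_cases hs : getBit s h = 1
    · simp [hs]
    · simp only [coeffOp, hs, if_false, if_true, map_mul, map_neg, hθ.invol]
      field_simp
      ring

include hθ in
-- One step of the tower is the identity -θ(a) c(y) + c(a y) = y, where c is the coefficient of a.
theorem sum_topCoord_mul_dualBas {h : ℕ} (hh : h ≤ m) (x : L) :
    ∑ s ∈ low m h, topCoord θ a m h (x * bas a s) * dualBas θ a s h = x := by
  induction h generalizing x with
  | zero => simp [low_zero, coord, topCoord, dualBas, bas_zero]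
  | succ h ih =>
    have hm := hθ.move h hh
    rw [sum_low_succ (by omega)]
    refine Eq.trans (Finset.sum_congr rfl fun s hs => ?_) (ih (by omega) x)
    have h1 : dualBas θ a (setBit s h 1) h = dualBas θ a s h :=
      dualBas_congr fun i hi => getBit_setBit_of_ne (by omega) _ _
    have ha : FixedBelow θ h (a h) := fun i hi => hθ.fix i h (by omega)
    have h2 : topCoord θ a m h (x * (a h * bas a s)) = a h * topCoord θ a m h (x * bas a s) := by
      rw [topCoord, show x * (a h * bas a s) = a h * (x * bas a s) by ring, coord_mul ha]
      rfl
    rw [bas_setBit_low (by omega) hs, dualBas, dualBas, getBit_setBit (by omega),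
      getBit_of_mem_low hs le_rfl, h1]
    rw [topCoord_succ (by omega), topCoord_succ (by omega), h2]
    simp only [coeffOp, if_true, map_mul]
    rw [if_neg (by decide)]
    field_simp
    ring

end Tower

/-! ### The same coordinates in terms of coefficients in K. -/

section Coordinates

variable {K L : Type*} [Field K] [Field L] [Algebra K L] {m : ℕ}
variable {θ : ℕ → L ≃ₐ[K] L} {a : ℕ → L}

/-- The element of `L` with coordinates `X` with respect to `bas a`. -/
noncomputable def ofC (a : ℕ → L) (X : BIdx m → K) : L := ofCoords (fun i : Fin m => a i) X

/-- The coordinates of `coeffOp θ a p ε x` in terms of those of `x`. -/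
def partCoords (p : ℕ) (ε : Fin 2) (X : BIdx m → K) : BIdx m → K :=
  fun q => if getBit q p = 0 then X (setBit q p ε) else 0

theorem ofC_eq (X : BIdx m → K) : ofC a X = ∑ s, X s • bas a s := rfl

theorem ofC_add (X Y : BIdx m → K) : ofC a (X + Y) = ofC a X + ofC a Y := by
  simp [ofC_eq, add_smul, Finset.sum_add_distrib]

theorem ofC_sub (X Y : BIdx m → K) : ofC a (X - Y) = ofC a X - ofC a Y := by
  simp [ofC_eq, sub_smul, Finset.sum_sub_distrib]

theorem ofC_smul (c : K) (X : BIdx m → K) : ofC a (c • X) = c • ofC a X := by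
  simp [ofC_eq, mul_smul, Finset.smul_sum]

theorem ofC_zero : ofC a (0 : BIdx m → K) = 0 := by simp [ofC_eq]

theorem ofC_single (s : BIdx m) (c : K) : ofC a (Pi.single s c) = c • bas a s := by
  rw [ofC_eq, Finset.sum_eq_single s]
  · simp
  · intro q _ hq
    simp [hq]
  · simp

theorem ofC_split {p : ℕ} (hp : p < m) (X : BIdx m → K) :
    ofC a X = ofC a (partCoords p 0 X) + a p * ofC a (partCoords p 1 X) := by
  have h : ∀ (ε : Fin 2), ofC a (partCoords p ε X) =
      ∑ s ∈ Finset.univ with getBit s p = 0, X (setBit s p ε) • bas a s := by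
    intro ε
    rw [ofC_eq, Finset.sum_filter]
    refine Finset.sum_congr rfl fun s _ => ?_
    simp only [partCoords]
    split_ifs <;> simp
  rw [h, h, ofC_eq, sum_eq_sum_filter_getBit hp _ (fun _ _ _ => Finset.mem_univ _),
    Finset.mul_sum, ← Finset.sum_add_distrib]
  refine Finset.sum_congr rfl fun s hs => ?_
  have h0 : setBit s p 0 = s := by
    rw [← (Finset.mem_filter.1 hs).2, setBit_self]
  rw [bas_setBit_one hp, h0, mul_smul_comm]

theorem map_ofC_partCoords (hθ : DualGenerators m θ a) (p : ℕ) (ε : Fin 2) (X : BIdx m → K) :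
    θ p (ofC a (partCoords p ε X)) = ofC a (partCoords p ε X) := by
  rw [ofC_eq, map_sum]
  refine Finset.sum_congr rfl fun s _ => ?_
  rw [map_smul]
  by_cases h : getBit s p = 0
  · rw [map_bas_of_getBit hθ h]
  · simp [partCoords, h]

theorem coeffOp_ofC (hθ : DualGenerators m θ a) {p : ℕ} (hp : p < m) (ε : Fin 2) (X : BIdx m → K) :
    coeffOp θ a p ε (ofC a X) = ofC a (partCoords p ε X) := by
  have hm := hθ.move p hp
  have h0 := map_ofC_partCoords hθ p 0 X
  have h1 := map_ofC_partCoords hθ p 1 X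
  have h : (θ p (ofC a X) - ofC a X) / (θ p (a p) - a p) = ofC a (partCoords p 1 X) := by
    rw [ofC_split hp X, map_add, map_mul, h0, h1]
    field_simp
    ring
  rw [coeffOp, h]
  split_ifs with hε
  · rw [hε]
  · rw [show ε = 0 by omega, ofC_split hp X]
    ring

theorem map_ofC (hθ : DualGenerators m θ a) {p : ℕ} (hp : p < m) {c₀ c₁ : K}
    (hc : θ p (a p) = algebraMap K L c₀ + algebraMap K L c₁ * a p) (X : BIdx m → K) :
    θ p (ofC a X) =
      ofC a fun q => if getBit q p = 1 then c₁ * X q else X q + c₀ * X (setBit q p 1) := by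
  rw [ofC_split hp X, map_add, map_mul, map_ofC_partCoords hθ, map_ofC_partCoords hθ, hc,
    ofC_split hp fun q => if getBit q p = 1 then c₁ * X q else X q + c₀ * X (setBit q p 1)]
  have h0 : partCoords p 0
      (fun q => if getBit q p = 1 then c₁ * X q else X q + c₀ * X (setBit q p 1)) =
      partCoords p 0 X + c₀ • partCoords p 1 X := by
    funext q
    simp only [partCoords, Pi.add_apply, Pi.smul_apply, getBit_setBit hp, setBit_setBit]
    split_ifs <;> simp_all
  have h1 : partCoords p 1
      (fun q => if getBit q p = 1 then c₁ * X q else X q + c₀ * X (setBit q p 1)) =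
      c₁ • partCoords p 1 X := by
    funext q
    simp only [partCoords, Pi.smul_apply, getBit_setBit hp]
    split_ifs <;> simp_all
  rw [h0, h1, ofC_add, ofC_smul, ofC_smul, Algebra.smul_def, Algebra.smul_def]
  ring

/-- The coordinates of `coord θ a s h x` in terms of those of `x`. -/
def coordCoords (s : BIdx m) : ℕ → (BIdx m → K) → BIdx m → K
  | 0, X => X
  | h + 1, X => partCoords h (getBit s h) (coordCoords s h X)

theorem coord_ofC (hθ : DualGenerators m θ a) {h : ℕ} (hh : h ≤ m) (s : BIdx m) (X : BIdx m → K) :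
    coord θ a s h (ofC a X) = ofC a (coordCoords s h X) := by
  induction h with
  | zero => rfl
  | succ h ih => rw [coord, ih (by omega), coeffOp_ofC hθ hh, coordCoords]

/-- The first `h` entries of `s`, followed by the other entries of `q`. -/
def mergeBits (h : ℕ) (s q : BIdx m) : BIdx m := fun i => if i.val < h then s i else q i

/-- Taking a coefficient only moves entries and fills in zeros; this is why it costs no operation.
-/
theorem coordCoords_apply {h : ℕ} (hh : h ≤ m) (s q : BIdx m) (X : BIdx m → K) :
    coordCoords s h X q = if ∀ i < h, getBit q i = 0 then X (mergeBits h s q) else 0 := by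
  induction h generalizing q with
  | zero =>
    have h0 : mergeBits 0 s q = q := by
      funext i
      simp [mergeBits]
    simp [coordCoords, h0]
  | succ h ih =>
    rw [coordCoords, partCoords]
    by_cases hq : getBit q h = 0
    · rw [if_pos hq, ih (by omega)]
      have h1 : (∀ i < h, getBit (setBit q h (getBit s h)) i = 0) ↔
          ∀ i < h + 1, getBit q i = 0 := by
        constructor
        · intro H i hi
          rcases Nat.lt_succ_iff_lt_or_eq.1 hi with hi | rfl
          · rw [← getBit_setBit_of_ne (by omega : i ≠ h)]
            exact H i hi
          · exact hq
        · intro H i hi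
          rw [getBit_setBit_of_ne (by omega)]
          exact H i (by omega)
      have h2 : mergeBits h s (setBit q h (getBit s h)) = mergeBits (h + 1) s q := by
        funext i
        simp only [mergeBits, setBit, getBit, dif_pos (Nat.lt_of_succ_le hh)]
        by_cases h3 : i.val < h
        · rw [if_pos h3, if_pos (by omega)]
        · by_cases h4 : i.val = h
          · rw [if_neg h3, if_pos h4, if_pos (by omega)]
            congr 1
            exact Fin.ext h4.symm
          · rw [if_neg h3, if_neg h4, if_neg (by omega)]
      simp only [h1, h2]
    · rw [if_neg hq, if_neg fun H => hq (H h (Nat.lt_succ_self h))]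

/-- The operator `coord θ a s m` reads off the coefficient at `s`, which gives linear independence
directly. -/
theorem ofC_injective (hθ : DualGenerators m θ a) :
    Function.Injective (ofC a : (BIdx m → K) → L) := by
  have key : ∀ X : BIdx m → K, ofC a X = 0 → X = 0 := by
    intro X hX
    funext s
    have h1 := coord_ofC hθ le_rfl s X
    have h2 : coordCoords s m X = Pi.single 0 (X s) := by
      funext q
      rw [coordCoords_apply le_rfl]
      have h3 : mergeBits m s q = s := by
        funext i
        simp [mergeBits]
      rw [h3]
      by_cases hq : q = 0
      · subst hq
        simp [getBit]
      · rw [Pi.single_eq_of_ne hq, if_neg]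
        intro H
        refine hq (funext fun i => ?_)
        simpa [getBit] using H i i.isLt
    rw [h2, ofC_single, bas_zero, hX, show coord θ a s m 0 = 0 from map_zero (coordHom θ a m s)] at h1
    simpa using h1.symm
  intro X Y hXY
  exact sub_eq_zero.1 (key (X - Y) (by rw [ofC_sub, hXY, sub_self]))

theorem coord_bas (hθ : DualGenerators m θ a) {h : ℕ} (hh : h ≤ m) {s t : BIdx m}
    (hs : s ∈ low m h) (ht : t ∈ low m h) :
    coord θ a s h (bas a t) = if s = t then 1 else 0 := by
  have h0 : bas a t = ofC a (Pi.single t (1 : K)) := by rw [ofC_single, one_smul]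
  have h1 : coordCoords s h (Pi.single t (1 : K)) = if s = t then Pi.single 0 1 else 0 := by
    funext q
    rw [coordCoords_apply hh]
    by_cases hq : q = 0
    · subst hq
      have : mergeBits h s 0 = s := by
        funext i
        simp only [mergeBits]
        split_ifs with hi
        · rfl
        · exact (mem_low.1 hs i (by omega)).symm
      rw [this, if_pos (by simp [getBit])]
      split_ifs with hst <;> simp [hst]
    · have h2 : (if s = t then Pi.single 0 (1 : K) else 0 : BIdx m → K) q = 0 := by
        split_ifs <;> simp [hq]
      rw [h2, ite_eq_right_iff]
      intro H
      refine Pi.single_eq_of_ne (fun hm => hq (funext fun i => ?_)) _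
      by_cases hi : i.val < h
      · simpa [getBit] using H i hi
      · have := congrFun hm i
        rw [mem_low.1 ht i (by omega)] at this
        simpa [mergeBits, hi] using this
  rw [h0, coord_ofC hθ hh, h1]
  split_ifs
  · rw [ofC_single, one_smul, bas_zero]
  · exact ofC_zero

/-- Used to find a pivot over the fixed field by zero tests on the entries in `K`. -/
theorem coord_ofC_ne_zero (hθ : DualGenerators m θ a) {h : ℕ} (hh : h ≤ m) {X : BIdx m → K}
    {q : BIdx m} (hq : X q ≠ 0) : coord θ a (mergeBits h q 0) h (ofC a X) ≠ 0 := by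
  rw [coord_ofC hθ hh, ← ofC_zero (K := K) (a := a) (m := m)]
  intro H
  have h1 := congrFun (ofC_injective hθ H) (mergeBits h 0 q)
  rw [coordCoords_apply hh, if_pos] at h1
  · refine hq ?_
    have h2 : mergeBits h (mergeBits h q 0) (mergeBits h 0 q) = q := by
      funext i
      simp only [mergeBits]
      split_ifs <;> rfl
    rwa [h2] at h1
  · intro i hi
    simp only [getBit, mergeBits]
    split_ifs <;> simp

theorem mergeBits_mem_low (h : ℕ) (q : BIdx m) : mergeBits h q 0 ∈ low m h := by
  rw [mem_low]
  intro i hi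
  simp [mergeBits, hi]

end Coordinates

/-! ### Parts of an endomorphism that move or fix given generators. -/

section Parts

variable {K L : Type*} [Field K] [Field L] [Algebra K L] {m : ℕ}

/-- The part of the endomorphism `f = ∑ f_g g` given by the `g` that do not fix `a_p`. -/
noncomputable def movePart (θ : ℕ → L ≃ₐ[K] L) (a : ℕ → L) (p : ℕ) (f : L → L) : L → L :=
  fun x => (f (a p * x) - a p * f x) / (θ p (a p) - a p)

/-- The part of the endomorphism `f = ∑ f_g g` given by the `g` that fix `a_p`. -/
noncomputable def fixPart (θ : ℕ → L ≃ₐ[K] L) (a : ℕ → L) (p : ℕ) (f : L → L) : L → L :=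
  fun x => f x - movePart θ a p f x

/-- The part of the endomorphism `f = ∑ f_g g` given by the `g` that fix none of
`a_{p-1}, …, a_{p-j}`. -/
noncomputable def moveParts (θ : ℕ → L ≃ₐ[K] L) (a : ℕ → L) (f : L → L) (p : ℕ) : ℕ → L → L
  | 0 => f
  | j + 1 => movePart θ a (p - 1 - j) (moveParts θ a f p j)

variable {θ : ℕ → L ≃ₐ[K] L} {a : ℕ → L}

theorem movePart_add (p : ℕ) (f g : L → L) :
    movePart θ a p (fun x => f x + g x) = fun x => movePart θ a p f x + movePart θ a p g x := by
  funext x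
  simp only [movePart]
  ring

theorem moveParts_add (f g : L → L) (p j : ℕ) :
    moveParts θ a (fun x => f x + g x) p j =
      fun x => moveParts θ a f p j x + moveParts θ a g p j x := by
  induction j with
  | zero => rfl
  | succ j ih => rw [moveParts, ih, movePart_add]; rfl

theorem fixPart_add (p : ℕ) (f g : L → L) :
    fixPart θ a p (fun x => f x + g x) = fun x => fixPart θ a p f x + fixPart θ a p g x := by
  funext x
  simp only [fixPart, movePart]
  ring

theorem movePart_sum {ι : Type*} (S : Finset ι) (p : ℕ) (u : ι → L) (f : ι → L → L) :
    movePart θ a p (fun x => ∑ j ∈ S, u j * f j x) =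
      fun x => ∑ j ∈ S, u j * movePart θ a p (f j) x := by
  funext x
  simp only [movePart]
  rw [Finset.mul_sum, ← Finset.sum_sub_distrib, Finset.sum_div]
  exact Finset.sum_congr rfl fun j _ => by ring

theorem moveParts_sum {ι : Type*} (S : Finset ι) (u : ι → L) (f : ι → L → L) (p j : ℕ) :
    moveParts θ a (fun x => ∑ i ∈ S, u i * f i x) p j =
      fun x => ∑ i ∈ S, u i * moveParts θ a (f i) p j x := by
  induction j with
  | zero => rfl
  | succ j ih => rw [moveParts, ih, movePart_sum]; rfl

theorem fixPart_sum {ι : Type*} (S : Finset ι) (p : ℕ) (u : ι → L) (f : ι → L → L) :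
    fixPart θ a p (fun x => ∑ j ∈ S, u j * f j x) =
      fun x => ∑ j ∈ S, u j * fixPart θ a p (f j) x := by
  funext x
  simp only [fixPart]
  rw [movePart_sum, ← Finset.sum_sub_distrib]
  exact Finset.sum_congr rfl fun j _ => by ring

variable (hθ : DualGenerators m θ a)
include hθ

theorem map_movePart {i p : ℕ} (hip : i ≠ p) (f : L → L) (x : L) :
    θ i (movePart θ a p f x) = movePart θ a p (fun y => θ i (f y)) x := by
  simp only [movePart, map_div₀, map_sub, map_mul, hθ.fix i p hip, hθ.comm i p]

theorem map_moveParts {i p : ℕ} (hip : p ≤ i) (f : L → L) {j : ℕ} (hj : j ≤ p) (x : L) :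
    θ i (moveParts θ a f p j x) = moveParts θ a (fun y => θ i (f y)) p j x := by
  induction j generalizing x with
  | zero => rfl
  | succ j ih =>
    rw [moveParts, map_movePart hθ (by omega), moveParts]
    congr 1
    funext y
    exact ih (by omega) y

theorem moveParts_fixed {f : L → L} {p : ℕ} (hf : ∀ x, FixedBelow θ p (f x)) {j : ℕ} (hj : j ≤ p)
    (x : L) : FixedBelow θ (p - j) (moveParts θ a f p j x) := by
  induction j generalizing x with
  | zero => exact hf x
  | succ j ih =>
    intro i hi
    rw [moveParts, map_movePart hθ (by omega)]
    congr 1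
    funext y
    exact ih (by omega) y i (by omega)

/-- When f has values fixed by θ, the conjugate of (f(ax) - a f(x)) / (θ(a) - a) is (f(ax) - θ(a)
f(x)) / (a - θ(a)), and the two add up to f(x). -/
theorem fixPart_eq {p : ℕ} (hp : p < m) {f : L → L} (hf : ∀ x, θ p (f x) = f x) (x : L) :
    fixPart θ a p f x = θ p (movePart θ a p f x) := by
  have hm := hθ.move p hp
  have hm' : a p - θ p (a p) ≠ 0 := fun h => hm (by linear_combination -h)
  simp only [fixPart, movePart, map_div₀, map_sub, map_mul, hf, hθ.invol]
  field_simp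
  ring

omit hθ

/-- Since g(ax) - a g(x) = (g(a) - a) g(x), the terms with g(a) = a cancel and the others acquire
the factor θ(a) - a, which is divided out. -/
theorem movePart_group [Fintype (L ≃ₐ[K] L)] [DecidableEq L] {p : ℕ}
    (hm : θ p (a p) - a p ≠ 0)
    (hg : ∀ g : L ≃ₐ[K] L, g (a p) = a p ∨ g (a p) = θ p (a p)) (c : (L ≃ₐ[K] L) → L) :
    movePart θ a p (fun x => ∑ g, c g * g x) =
      fun x => ∑ g, (if g (a p) = a p then 0 else c g) * g x := by
  funext x
  simp only [movePart]
  rw [Finset.mul_sum, ← Finset.sum_sub_distrib, Finset.sum_div]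
  refine Finset.sum_congr rfl fun g _ => ?_
  split_ifs with h
  · rw [map_mul, h]
    ring
  · rw [map_mul, (hg g).resolve_left h]
    field_simp

theorem fixPart_group [Fintype (L ≃ₐ[K] L)] [DecidableEq L] {p : ℕ}
    (hm : θ p (a p) - a p ≠ 0)
    (hg : ∀ g : L ≃ₐ[K] L, g (a p) = a p ∨ g (a p) = θ p (a p)) (c : (L ≃ₐ[K] L) → L) :
    fixPart θ a p (fun x => ∑ g, c g * g x) =
      fun x => ∑ g, (if g (a p) = a p then c g else 0) * g x := by
  funext x
  simp only [fixPart]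
  rw [movePart_group hm hg, ← Finset.sum_sub_distrib]
  refine Finset.sum_congr rfl fun g _ => ?_
  split_ifs <;> ring

theorem moveParts_group [Fintype (L ≃ₐ[K] L)] [DecidableEq L] {p : ℕ}
    (hm : ∀ q < p, θ q (a q) - a q ≠ 0)
    (hg : ∀ q < p, ∀ g : L ≃ₐ[K] L, g (a q) = a q ∨ g (a q) = θ q (a q)) (c : (L ≃ₐ[K] L) → L)
    {j : ℕ} (hj : j ≤ p) :
    ∃ c' : (L ≃ₐ[K] L) → L, moveParts θ a (fun x => ∑ g, c g * g x) p j =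
      (fun x => ∑ g, c' g * g x) ∧
      ∀ g, c' g ≠ 0 → c g ≠ 0 ∧ ∀ q, p - j ≤ q → q < p → g (a q) ≠ a q := by
  induction j with
  | zero => exact ⟨c, rfl, fun g hg => ⟨hg, fun q h1 h2 => by omega⟩⟩
  | succ j ih =>
    obtain ⟨c', h1, h2⟩ := ih (by omega)
    refine ⟨fun g => if g (a (p - 1 - j)) = a (p - 1 - j) then 0 else c' g, ?_, ?_⟩
    · rw [moveParts, h1, movePart_group (hm _ (by omega)) (hg _ (by omega))]
    · intro g hgc
      simp only [ne_eq, ite_eq_left_iff, not_forall] at hgc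
      obtain ⟨h3, h4⟩ := hgc
      refine ⟨(h2 g h4).1, fun q hq1 hq2 => ?_⟩
      by_cases hq : q = p - 1 - j
      · rwa [hq]
      · exact (h2 g h4).2 q (by omega) hq2

end Parts

/-! ### Column reduction over a fixed field, with columns stored as elements of L. -/

section Reduced

variable {K L : Type*} [Field K] [Field L] [Algebra K L] {m : ℕ}
variable {θ : ℕ → L ≃ₐ[K] L} {a : ℕ → L} {h : ℕ}

/-- The elements `u k`, `k ∈ P`, are combinations, with the coefficients of the `β k`, of the
elements `φ s`, and they are reduced with respect to their coefficients at the pivots `k ∈ P`. -/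
structure PivotSystem (θ : ℕ → L ≃ₐ[K] L) (a : ℕ → L) (h : ℕ) (φ : BIdx m → L)
    (P : Finset (BIdx m)) (u β : BIdx m → L) : Prop where
  subset : P ⊆ low m h
  coord_eq : ∀ k ∈ P, ∀ l ∈ P, coord θ a k h (u l) = if k = l then 1 else 0
  comb : ∀ k ∈ P, u k = ∑ s ∈ low m h, coord θ a s h (β k) * φ s

variable {φ : BIdx m → L} {P : Finset (BIdx m)} {u β : BIdx m → L}

theorem PivotSystem.coord_sum (hP : PivotSystem θ a h φ P u β) {c : BIdx m → L}
    (hc : ∀ k ∈ P, FixedBelow θ h (c k)) {k : BIdx m} (hk : k ∈ P) :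
    coord θ a k h (∑ l ∈ P, c l * u l) = c k := by
  rw [_root_.coord_sum, Finset.sum_eq_single k]
  · rw [coord_mul (hc k hk), hP.coord_eq k hk k hk, if_pos rfl, mul_one]
  · intro l hl hlk
    rw [coord_mul (hc l hl), hP.coord_eq k hk l hl, if_neg hlk.symm, mul_zero]
  · exact fun h => absurd hk h

/-- `v` is a combination of the `u k` with coefficients fixed by `θ_i`, `i < h`. -/
def InSpan (θ : ℕ → L ≃ₐ[K] L) (a : ℕ → L) (h : ℕ) (P : Finset (BIdx m)) (u : BIdx m → L) (v : L) :
    Prop := v = ∑ k ∈ P, coord θ a k h v * u k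

theorem PivotSystem.inSpan (hP : PivotSystem θ a h φ P u β) {c : BIdx m → L}
    (hc : ∀ k ∈ P, FixedBelow θ h (c k)) {v : L} (hv : v = ∑ k ∈ P, c k * u k) :
    InSpan θ a h P u v := by
  rw [InSpan]
  conv_lhs => rw [hv]
  refine Finset.sum_congr rfl fun k hk => ?_
  rw [hv, hP.coord_sum hc hk]

variable {ι : Type*} [Fintype ι] {w : ι → L} {F : ι → BIdx m → L}

section Matrices

variable (hP : PivotSystem θ a h φ P u β) (hF : ∀ j s, FixedBelow θ h (F j s))
  (hφ : ∀ s ∈ low m h, φ s = ∑ j, w j * F j s) (hθ : DualGenerators m θ a) (hh : h ≤ m)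

/-- The coefficients of the `u l` with respect to the `w j`. -/
noncomputable def combMatrix (θ : ℕ → L ≃ₐ[K] L) (a : ℕ → L) (h : ℕ) (β : BIdx m → L)
    (F : ι → BIdx m → L) : Matrix ι (BIdx m) L :=
  fun j l => ∑ s ∈ low m h, coord θ a s h (β l) * F j s

include hF hθ hh

omit [Fintype ι] in
theorem combMatrix_fixed (j : ι) (l : BIdx m) : FixedBelow θ h (combMatrix θ a h β F j l) :=
  FixedBelow.sum _ fun s _ => (coord_fixed hθ hh s _).mul (hF j s)

include hP hφ

omit hF hθ hh in
theorem PivotSystem.eq_sum_combMatrix {l : BIdx m} (hl : l ∈ P) :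
    u l = ∑ j, w j * combMatrix θ a h β F j l := by
  rw [hP.comb l hl]
  simp only [combMatrix, Finset.mul_sum]
  rw [Finset.sum_comm]
  refine Finset.sum_congr rfl fun s hs => ?_
  rw [hφ s hs, Finset.mul_sum]
  exact Finset.sum_congr rfl fun j _ => by ring

/-- Expressing the `u l` through the `w j` and reading coordinates at the pivots must return the
identity matrix. So `combMatrix` has a left inverse, which bounds the number of pivots by the number
of `w j`. -/
theorem PivotSystem.coord_mul_combMatrix :
    (Matrix.of fun (k : P) (j : ι) => coord θ a k.1 h (w j)) *
      (Matrix.of fun (j : ι) (l : P) => combMatrix θ a h β F j l.1) = 1 := by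
  ext k l
  rw [Matrix.mul_apply, Matrix.one_apply]
  have h1 := hP.coord_eq k k.2 l l.2
  rw [hP.eq_sum_combMatrix hφ l.2, _root_.coord_sum] at h1
  simp only [Subtype.ext_iff]
  rw [← h1]
  refine Finset.sum_congr rfl fun j _ => ?_
  rw [mul_comm (w j), coord_mul (combMatrix_fixed hF hθ hh j l), mul_comm]
  rfl

theorem PivotSystem.card_le : P.card ≤ Fintype.card ι := by
  have h1 := hP.coord_mul_combMatrix hF hφ hθ hh
  calc P.card = Fintype.card P := (Fintype.card_coe P).symm
    _ = (1 : Matrix P P L).rank := Matrix.rank_one.symm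
    _ ≤ _ := by rw [← h1]; exact Matrix.rank_mul_le_left _ _
    _ ≤ Fintype.card ι := Matrix.rank_le_card_width _

variable (hcard : P.card = Fintype.card ι)
include hcard

/-- With as many pivots as `w j` the matrices are square, and a one-sided inverse is two-sided. -/
theorem PivotSystem.combMatrix_mul_coord [DecidableEq ι] (j j' : ι) :
    ∑ l ∈ P, combMatrix θ a h β F j l * coord θ a l h (w j') = if j = j' then 1 else 0 := by
  have h1 := (Matrix.mul_eq_one_comm_of_equiv (Fintype.equivOfCardEq (by rw [Fintype.card_coe, hcard]))).1
    (hP.coord_mul_combMatrix hF hφ hθ hh)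
  have h2 := congrFun (congrFun h1 j) j'
  rw [Matrix.mul_apply, Matrix.one_apply] at h2
  rw [← h2, ← Finset.sum_coe_sort]
  rfl

/-- When the counts agree, the `w j` are themselves combinations of the `u l`, so both families have
the same span over the fixed field. -/
theorem PivotSystem.inSpan_of_card {c : ι → L} (hc : ∀ j, FixedBelow θ h (c j)) :
    InSpan θ a h P u (∑ j, w j * c j) := by
  classical
  have h1 : ∀ j', w j' = ∑ l ∈ P, coord θ a l h (w j') * u l := by
    intro j'
    have h2 : ∀ l ∈ P, coord θ a l h (w j') * u l =
        ∑ j, w j * (combMatrix θ a h β F j l * coord θ a l h (w j')) := by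
      intro l hl
      rw [hP.eq_sum_combMatrix hφ hl, Finset.mul_sum]
      exact Finset.sum_congr rfl fun j _ => by ring
    rw [Finset.sum_congr rfl h2, Finset.sum_comm]
    simp_rw [← Finset.mul_sum, hP.combMatrix_mul_coord hF hφ hθ hh hcard]
    simp
  refine hP.inSpan (c := fun l => ∑ j, c j * coord θ a l h (w j))
    (fun l _ => FixedBelow.sum _ fun j _ => (hc j).mul (coord_fixed hθ hh l _)) ?_
  simp_rw [Finset.sum_mul]
  rw [Finset.sum_comm]
  refine Finset.sum_congr rfl fun j _ => ?_
  conv_lhs => rw [h1 j]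
  rw [Finset.sum_mul]
  exact Finset.sum_congr rfl fun l _ => by ring

/-- The image of the semilinear extension of `θ_p`: the elements `∑ w_j θ_p(c_j)` are determined by
`∑ w_j c_j` and the images of the `u l`. -/
theorem PivotSystem.sum_conj (p : ℕ) {c : ι → L} (hc : ∀ j, FixedBelow θ h (c j)) {φ' : BIdx m → L}
    (hφ' : ∀ s ∈ low m h, φ' s = ∑ j, w j * θ p (F j s)) :
    ∑ j, w j * θ p (c j) = ∑ l ∈ P, (∑ s ∈ low m h, θ p (coord θ a s h (β l)) * φ' s) *
      θ p (coord θ a l h (∑ j, w j * c j)) := by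
  classical
  have h1 : ∀ l, ∑ s ∈ low m h, θ p (coord θ a s h (β l)) * φ' s =
      ∑ j, w j * θ p (combMatrix θ a h β F j l) := by
    intro l
    simp only [combMatrix, map_sum, map_mul, Finset.mul_sum]
    rw [Finset.sum_comm]
    refine Finset.sum_congr rfl fun s hs => ?_
    rw [hφ' s hs, Finset.mul_sum]
    exact Finset.sum_congr rfl fun j _ => by ring
  have h2 : ∀ l : BIdx m, coord θ a l h (∑ j, w j * c j) = ∑ j, coord θ a l h (w j) * c j := by
    intro l
    rw [_root_.coord_sum]
    refine Finset.sum_congr rfl fun j _ => ?_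
    rw [mul_comm, coord_mul (hc j), mul_comm]
  simp_rw [h1, h2, Finset.sum_mul]
  rw [Finset.sum_comm]
  refine Finset.sum_congr rfl fun j _ => ?_
  -- Now `θ p` can be pulled out of the sum over the pivots, and inside it `combMatrix` meets its
  -- inverse.
  simp_rw [mul_assoc, ← map_mul]
  rw [← Finset.mul_sum, ← map_sum]
  congr 2
  simp_rw [Finset.mul_sum]
  rw [Finset.sum_comm]
  simp_rw [← mul_assoc, ← Finset.sum_mul, hP.combMatrix_mul_coord hF hφ hθ hh hcard]
  simp

end Matrices

section Insert

variable (hθ : DualGenerators m θ a) (hh : h ≤ m)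

/-- What is left of `v` after subtracting the combination of the `u k` with the same coefficients at
the pivots. -/
noncomputable def residue (θ : ℕ → L ≃ₐ[K] L) (a : ℕ → L) (h : ℕ) (P : Finset (BIdx m))
    (u : BIdx m → L) (v : L) : L := v - ∑ k ∈ P, coord θ a k h v * u k

include hθ hh

theorem PivotSystem.coord_residue (hP : PivotSystem θ a h φ P u β) (v : L) {k : BIdx m} (hk : k ∈ P) :
    coord θ a k h (residue θ a h P u v) = 0 := by
  rw [residue, coord_sub, hP.coord_sum (fun l _ => coord_fixed hθ hh l v) hk, sub_self]

variable {t : BIdx m} {π : BIdx m}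

/-- One step of the reduction: `u'` and `β'` extend `u` and `β` by a new pivot. -/
theorem PivotSystem.insert (hP : PivotSystem θ a h φ P u β) {u' β' : BIdx m → L} (ht : t ∈ low m h)
    (hπ : π ∈ low m h) (hne : coord θ a π h (residue θ a h P u (φ t)) ≠ 0)
    (hu : u' π = (coord θ a π h (residue θ a h P u (φ t)))⁻¹ * residue θ a h P u (φ t))
    (hβ : β' π = (coord θ a π h (residue θ a h P u (φ t)))⁻¹ *
      (bas a t - ∑ k ∈ P, coord θ a k h (φ t) * β k))
    (hu' : ∀ k ∈ P, u' k = u k - coord θ a π h (u k) * u' π)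
    (hβ' : ∀ k ∈ P, β' k = β k - coord θ a π h (u k) * β' π) :
    π ∉ P ∧ PivotSystem θ a h φ (insert π P) u' β' ∧
      (∀ v, InSpan θ a h P u v → InSpan θ a h (insert π P) u' v) ∧
      InSpan θ a h (insert π P) u' (φ t) := by
  set r := residue θ a h P u (φ t) with hr
  set c := coord θ a π h r with hc
  have hπP : π ∉ P := fun hk => hne (hP.coord_residue hθ hh _ hk)
  have hcf : FixedBelow θ h c := coord_fixed hθ hh _ _
  have hππ : coord θ a π h (u' π) = 1 := by
    rw [hu, coord_mul hcf.inv, ← hc, inv_mul_cancel₀ hne]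
  have hkπ : ∀ k ∈ P, coord θ a k h (u' π) = 0 := by
    intro k hk
    rw [hu, coord_mul hcf.inv, hP.coord_residue hθ hh _ hk, mul_zero]
  -- The map z ↦ ∑ coord_s(z) φ_s is linear over the fixed field, so performing the same operation
  -- on `β` as on `u` keeps the record of combinations valid.
  have hcomb : ∀ {c : L} {y z : L}, FixedBelow θ h c →
      ∑ s ∈ low m h, coord θ a s h (y - c * z) * φ s =
      ∑ s ∈ low m h, coord θ a s h y * φ s - c * ∑ s ∈ low m h, coord θ a s h z * φ s := by
    intro c y z hc
    rw [Finset.mul_sum, ← Finset.sum_sub_distrib]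
    refine Finset.sum_congr rfl fun s _ => ?_
    rw [coord_sub, coord_mul hc]
    ring
  have hnew : u' π = ∑ s ∈ low m h, coord θ a s h (β' π) * φ s := by
    have h1 : ∑ s ∈ low m h, coord θ a s h (bas a t - ∑ k ∈ P, coord θ a k h (φ t) * β k) * φ s
        = r := by
      have h2 : ∀ s ∈ low m h, coord θ a s h (bas a t - ∑ k ∈ P, coord θ a k h (φ t) * β k) * φ s =
          (if s = t then φ s else 0) -
            ∑ k ∈ P, coord θ a k h (φ t) * (coord θ a s h (β k) * φ s) := by
        intro s hs
        rw [coord_sub, coord_bas hθ hh hs ht, _root_.coord_sum, sub_mul, Finset.sum_mul]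
        congr 1
        · split_ifs <;> simp
        · refine Finset.sum_congr rfl fun k _ => ?_
          rw [coord_mul (coord_fixed hθ hh _ _), mul_assoc]
      rw [Finset.sum_congr rfl h2, Finset.sum_sub_distrib, Finset.sum_ite_eq' _ t, if_pos ht,
        Finset.sum_comm, hr, residue]
      congr 1
      refine Finset.sum_congr rfl fun k hk => ?_
      rw [← Finset.mul_sum, ← hP.comb k hk]
    rw [hu, hβ, ← h1, Finset.mul_sum]
    refine Finset.sum_congr rfl fun s _ => ?_
    rw [coord_mul hcf.inv, mul_assoc]
  have hred : PivotSystem θ a h φ (Insert.insert π P) u' β' := by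
    refine ⟨Finset.insert_subset hπ hP.subset, ?_, ?_⟩
    · intro k hk l hl
      rw [Finset.mem_insert] at hk hl
      rcases hk with rfl | hk <;> rcases hl with rfl | hl
      · rw [hππ, if_pos rfl]
      · rw [hu' l hl, coord_sub, coord_mul (coord_fixed hθ hh _ _), hππ, mul_one, sub_self, if_neg]
        rintro rfl
        exact hπP hl
      · rw [hkπ k hk, if_neg]
        rintro rfl
        exact hπP hk
      · rw [hu' l hl, coord_sub, coord_mul (coord_fixed hθ hh _ _), hkπ k hk, mul_zero, sub_zero,
          hP.coord_eq k hk l hl]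
    · intro k hk
      rw [Finset.mem_insert] at hk
      rcases hk with rfl | hk
      · exact hnew
      · rw [hu' k hk, hβ' k hk, hcomb (coord_fixed hθ hh _ _), ← hP.comb k hk, ← hnew]
  have hold : ∀ v, InSpan θ a h P u v → InSpan θ a h (Insert.insert π P) u' v := by
    intro v hv
    rw [InSpan, Finset.sum_insert hπP]
    -- The new coordinate of an element of the old span is forced by the old ones. Hence what is
    -- subtracted from the `u k` is put back by the new term.
    have h1 : coord θ a π h v = ∑ k ∈ P, coord θ a k h v * coord θ a π h (u k) := by
      conv_lhs => rw [hv]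
      rw [_root_.coord_sum]
      exact Finset.sum_congr rfl fun k _ => coord_mul (coord_fixed hθ hh _ _) _ _
    have h2 : ∑ k ∈ P, coord θ a k h v * u' k =
        ∑ k ∈ P, coord θ a k h v * u k - coord θ a π h v * u' π := by
      rw [h1, Finset.sum_mul, ← Finset.sum_sub_distrib]
      refine Finset.sum_congr rfl fun k hk => ?_
      rw [hu' k hk]
      ring
    rw [h2, ← hv]
    ring
  refine ⟨hπP, hred, hold, ?_⟩
  have h1 : InSpan θ a h P u (∑ k ∈ P, coord θ a k h (φ t) * u k) :=
    hP.inSpan (fun k _ => coord_fixed hθ hh k (φ t)) rfl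
  have h2 := hold _ h1
  have h3 : φ t = c * u' π + ∑ k ∈ P, coord θ a k h (φ t) * u k := by
    rw [hu, ← mul_assoc, mul_inv_cancel₀ hne, one_mul, hr, residue]
    ring
  refine hred.inSpan (c := fun k => (if k = π then c else 0) +
    coord θ a k h (∑ k ∈ P, coord θ a k h (φ t) * u k)) ?_ ?_
  · intro k _ i hi
    rw [map_add, coord_fixed hθ hh _ _ i hi]
    congr 1
    split_ifs
    · exact hcf i hi
    · exact map_zero _
  · simp_rw [add_mul]
    rw [Finset.sum_add_distrib, ← h2]
    simp only [ite_mul, zero_mul]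
    rw [Finset.sum_ite_eq' _ π, if_pos (Finset.mem_insert_self _ _)]
    exact h3

omit hθ hh

theorem PivotSystem.empty : PivotSystem θ a h φ ∅ u β := by
  constructor <;> simp

end Insert

end Reduced

/-! ### Foldings of matrices as parts of endomorphisms. -/

section FoldRank

variable {K L : Type*} [Field K] [Field L] [Algebra K L] {m : ℕ}
variable {θ : ℕ → L ≃ₐ[K] L} {a : ℕ → L}

/-- An index of shorter length, filled up with zeros. -/
def extBits (m : ℕ) {n : ℕ} (s : BIdx n) : BIdx m := fun i => if h : i.val < n then s ⟨i, h⟩ else 0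

theorem extBits_snoc (m : ℕ) {n : ℕ} (s : BIdx n) (ε : Fin 2) :
    extBits m (Fin.snoc s ε : BIdx (n + 1)) = setBit (extBits m s) n ε := by
  funext i
  simp only [extBits, setBit, Fin.snoc]
  by_cases h1 : i.val < n
  · simp [h1, h1.ne, Nat.lt_succ_of_lt h1, Fin.castLT]
  · by_cases h2 : i.val = n
    · simp [h2]
    · rw [dif_neg (by omega), if_neg h2, dif_neg h1]

theorem extBits_mem_low (m : ℕ) {n : ℕ} (s : BIdx n) : extBits m s ∈ low m n :=
  mem_low.2 fun i hi => by simp [extBits, hi]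

theorem extBits_self (s : BIdx m) : extBits m s = s := by
  funext i
  simp [extBits]

/-- The row weights of the folding glue two blocks into coordinates at the next lower level, by x =
x_0 + a x_1. The column weights then combine f(x) and f(ax) into a multiple of f(ax) - a f(x): the
factor is a⁻¹ in characteristic 2, where signs do not matter, and -a⁻² otherwise. -/
theorem fold_eq (hθ : DualGenerators m θ a) {n : ℕ} (hn : n < m) (ha : a n ≠ 0)
    {M : Matrix (BIdx (n + 1)) (BIdx (n + 1)) L} {f : L → L} {c : L} (hc : c ≠ 0)
    (hM : ∀ s t, M s t = c * coord θ a (extBits m s) (n + 1) (f (bas a (extBits m t)))) :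
    ∃ c' : L, c' ≠ 0 ∧ ∀ s t, fold (a n) M s t =
      c' * coord θ a (extBits m s) n (movePart θ a n f (bas a (extBits m t))) := by
  have hm := hθ.move n hn
  have haf : FixedBelow θ n (a n) := fun i hi => hθ.fix i n hi.ne
  have hdf : FixedBelow θ n (θ n (a n) - a n) := fun i hi => by
    rw [map_sub, hθ.comm, hθ.fix i n hi.ne]
  have h1 : ∀ s ε t ε', M (Fin.snoc s ε) (Fin.snoc t ε') =
      c * coeffOp θ a n ε (coord θ a (extBits m s) n (f (bas a (setBit (extBits m t) n ε')))) := by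
    intro s ε t ε'
    rw [hM, extBits_snoc, extBits_snoc, coord, getBit_setBit hn,
      coord_congr fun i hi => getBit_setBit_of_ne hi.ne _ _]
  have h2 : ∀ t : BIdx n, bas a (setBit (extBits m t) n 0) = bas a (extBits m t) := by
    intro t
    rw [← getBit_of_mem_low (extBits_mem_low m t) le_rfl, setBit_self]
  have h3 : ∀ t : BIdx n, bas a (setBit (extBits m t) n 1) = a n * bas a (extBits m t) := fun t =>
    bas_setBit_low hn (extBits_mem_low m t)
  have h4 : ∀ s t : BIdx n, coord θ a (extBits m s) n (movePart θ a n f (bas a (extBits m t))) =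
      (θ n (a n) - a n)⁻¹ * (coord θ a (extBits m s) n (f (a n * bas a (extBits m t))) -
        a n * coord θ a (extBits m s) n (f (bas a (extBits m t)))) := by
    intro s t
    rw [movePart, div_eq_inv_mul, coord_mul hdf.inv, coord_sub, coord_mul haf]
  by_cases hchar : ringChar L = 2
  · have : CharP L 2 := ringChar.of_eq hchar
    have h22 : (2 : L) = 0 := CharTwo.two_eq_zero
    refine ⟨c * (a n)⁻¹ * (θ n (a n) - a n),
      mul_ne_zero (mul_ne_zero hc (inv_ne_zero ha)) hm, fun s t => ?_⟩
    rw [fold, if_pos hchar, blockFold, h4]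
    simp only [Fin.sum_univ_two, h1, h2, h3, Matrix.cons_val_zero, Matrix.cons_val_one]
    have d1 := coeffOp_decomp (θ := θ) (a := a) n
      (coord θ a (extBits m s) n (f (bas a (extBits m t))))
    have d2 := coeffOp_decomp (θ := θ) (a := a) n
      (coord θ a (extBits m s) n (f (a n * bas a (extBits m t))))
    field_simp
    linear_combination a n * d1 + d2 +
      a n * coord θ a (extBits m s) n (f (bas a (extBits m t))) * h22
  · refine ⟨-(c * (a n)⁻¹ * (a n)⁻¹ * (θ n (a n) - a n)), neg_ne_zero.2
      (mul_ne_zero (mul_ne_zero (mul_ne_zero hc (inv_ne_zero ha)) (inv_ne_zero ha)) hm),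
      fun s t => ?_⟩
    rw [fold, if_neg hchar, blockFold, h4]
    simp only [Fin.sum_univ_two, h1, h2, h3, Matrix.cons_val_zero, Matrix.cons_val_one]
    have d1 := coeffOp_decomp (θ := θ) (a := a) n
      (coord θ a (extBits m s) n (f (bas a (extBits m t))))
    have d2 := coeffOp_decomp (θ := θ) (a := a) n
      (coord θ a (extBits m s) n (f (a n * bas a (extBits m t))))
    field_simp
    linear_combination a n * d1 - d2

theorem moveParts_movePart (f : L → L) (n j : ℕ) :
    moveParts θ a (movePart θ a n f) n j = moveParts θ a f (n + 1) (j + 1) := by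
  induction j with
  | zero => rfl
  | succ j ih =>
    rw [moveParts, ih]
    conv_rhs => rw [moveParts]
    rw [show n - 1 - j = n + 1 - 1 - (j + 1) by omega]

theorem rank_of_foldingsHaveRank (hθ : DualGenerators m θ a) (ha : ∀ i, a i ≠ 0) {t k : ℕ} (d : ℕ)
    (hd : k + d + 1 ≤ m) {M : Matrix (BIdx (k + d + 1)) (BIdx (k + d + 1)) L} {f : L → L} {c : L}
    (hc : c ≠ 0)
    (hM : ∀ s t, M s t = c * coord θ a (extBits m s) (k + d + 1) (f (bas a (extBits m t))))
    (hr : FoldingsHaveRank t (d + 1) (k + d + 1) (fun i => a i) M) :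
    ∃ c' : L, (Matrix.of fun s t : BIdx k => c' * coord θ a (extBits m s) k
      (moveParts θ a f (k + d + 1) (d + 1) (bas a (extBits m t)))).rank = t := by
  induction d generalizing f c with
  | zero =>
    obtain ⟨c', _, h1⟩ := fold_eq hθ (n := k) hd (ha k) hc hM
    refine ⟨c', ?_⟩
    rw [← hr.1]
    congr 1
    ext s t
    exact (h1 s t).symm
  | succ d ih =>
    obtain ⟨c', hc', h1⟩ := fold_eq hθ (n := k + d + 1) hd (ha _) hc hM
    obtain ⟨c'', h2⟩ := ih (by omega) hc' h1 hr.2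
    refine ⟨c'', ?_⟩
    rw [moveParts_movePart] at h2
    exact h2

/-- If the columns of the last folding lie in the span of the `u l`, its matrix factors through a
space with basis indexed by `P`. -/
theorem le_card_of_foldingsHaveRank (hθ : DualGenerators m θ a) (ha : ∀ i, a i ≠ 0) {t k d : ℕ}
    (hd : m = k + d + 1) {M : Matrix (BIdx m) (BIdx m) L} {f : L → L}
    (hM : ∀ s t, M s t = coord θ a s m (f (bas a t)))
    (hr : FoldingsHaveRank t (d + 1) m (fun i => a i) M) {P : Finset (BIdx m)} {u : BIdx m → L}
    (hP : ∀ s ∈ low m k, InSpan θ a k P u (moveParts θ a f m (d + 1) (bas a s))) : t ≤ P.card := by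
  subst hd
  obtain ⟨c, h1⟩ := rank_of_foldingsHaveRank hθ ha d le_rfl one_ne_zero
    (fun s t => by rw [hM, one_mul, extBits_self, extBits_self]) hr
  rw [← h1]
  have h2 : (Matrix.of fun s t : BIdx k => c * coord θ a (extBits (k + d + 1) s) k
      (moveParts θ a f (k + d + 1) (d + 1) (bas a (extBits (k + d + 1) t)))) =
      (Matrix.of fun (s : BIdx k) (l : P) => c * coord θ a (extBits (k + d + 1) s) k (u l)) *
      (Matrix.of fun (l : P) (t : BIdx k) => coord θ a l.1 k
        (moveParts θ a f (k + d + 1) (d + 1) (bas a (extBits (k + d + 1) t)))) := by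
    ext s t
    rw [Matrix.mul_apply, Matrix.of_apply]
    conv_lhs => rw [hP _ (extBits_mem_low _ t), coord_sum, ← Finset.sum_coe_sort, Finset.mul_sum]
    refine Finset.sum_congr rfl fun l _ => ?_
    rw [coord_mul (coord_fixed hθ (by omega) _ _), Matrix.of_apply, Matrix.of_apply]
    ring
  rw [h2]
  refine (Matrix.rank_mul_le_left _ _).trans ((Matrix.rank_le_card_width _).trans ?_)
  rw [Fintype.card_coe]

end FoldRank

/-! ### Programs for the arithmetic of L. -/

section FieldPrograms

variable {K L : Type*} [Field K] [Field L] [Algebra K L] {m : ℕ}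

/-- What the programs for the arithmetic of `L` rely on: `T` multiplies two elements of `L` with at
most `M` operations, and `2 ^ m ≤ 2 * M`; the constants `c₀` and `c₁` describe the action of the
`θ_p`. -/
structure MulSetting (θ : ℕ → L ≃ₐ[K] L) (a : ℕ → L) (c₀ c₁ : K)
    (T : CompTree K (BIdx m ⊕ BIdx m) (BIdx m)) (M : ℕ) : Prop where
  dual : DualGenerators m θ a
  surj : Function.Surjective (ofC a : (BIdx m → K) → L)
  conj : ∀ p < m, θ p (a p) = algebraMap K L c₀ + algebraMap K L c₁ * a p
  mul : ∀ X Y : BIdx m → K, ∃ Z c, T.run (Sum.elim X Y) = some (Z, c) ∧ c ≤ M ∧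
    ofC a Z = ofC a X * ofC a Y
  le : 2 ^ m ≤ 2 * M

variable {θ : ℕ → L ≃ₐ[K] L} {a : ℕ → L} {c₀ c₁ : K}
  {T : CompTree K (BIdx m ⊕ BIdx m) (BIdx m)} {M : ℕ}

/-- The coefficient of 1 in x = x · 1 is computed twice: it is x, because x is a scalar for the
coordinate map, and it is the entry of x at index 0. -/
theorem exists_algebraMap_eq (hθ : DualGenerators m θ a)
    (hs : Function.Surjective (ofC a : (BIdx m → K) → L)) {x : L} (hx : FixedBelow θ m x) :
    ∃ c : K, x = ofC (m := m) a (Pi.single 0 c) := by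
  obtain ⟨X, hX⟩ := hs x
  refine ⟨X 0, ?_⟩
  have h1 : coord θ a (0 : BIdx m) m x = x := by
    conv_lhs => rw [← mul_one x, coord_mul hx, ← bas_zero (m := m) (a := a)]
    rw [coord_bas hθ le_rfl (by simp [low_top]) (by simp [low_top]), if_pos rfl, mul_one]
  rw [← h1, ← hX, coord_ofC hθ le_rfl]
  congr 1
  funext q
  rw [coordCoords_apply le_rfl]
  have h2 : mergeBits m 0 q = 0 := by
    funext i
    simp [mergeBits]
  rw [h2]
  by_cases hq : q = 0
  · subst hq
    simp [getBit]
  · rw [Pi.single_eq_of_ne hq, if_neg]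
    intro H
    exact hq (funext fun i => by simpa [getBit] using H i i.isLt)

/-- The product of the images of `x` under the group generated by `θ_0, …, θ_{p-1}`. -/
noncomputable def partialNorm (θ : ℕ → L ≃ₐ[K] L) (x : L) : ℕ → L
  | 0 => x
  | p + 1 => partialNorm θ x p * θ p (partialNorm θ x p)

/-- The cofactor of `x` in `partialNorm θ x p`. -/
noncomputable def partialCofactor (θ : ℕ → L ≃ₐ[K] L) (x : L) : ℕ → L
  | 0 => 1
  | p + 1 => partialCofactor θ x p * θ p (partialNorm θ x p)

theorem mul_partialCofactor (x : L) (p : ℕ) :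
    x * partialCofactor θ x p = partialNorm θ x p := by
  induction p with
  | zero => simp [partialCofactor, partialNorm]
  | succ p ih => rw [partialCofactor, partialNorm, ← ih]; ring

theorem partialNorm_ne_zero {x : L} (hx : x ≠ 0) (p : ℕ) : partialNorm θ x p ≠ 0 := by
  induction p with
  | zero => exact hx
  | succ p ih => exact mul_ne_zero ih (by simpa using ih)

theorem partialNorm_fixed (hθ : DualGenerators m θ a) (x : L) (p : ℕ) :
    FixedBelow θ p (partialNorm θ x p) := by
  induction p with
  | zero => exact fun i hi => absurd hi (Nat.not_lt_zero i)
  | succ p ih =>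
    intro i hi
    rw [partialNorm, map_mul]
    by_cases hip : i = p
    · subst hip
      rw [hθ.invol, mul_comm]
    · rw [hθ.comm, ih i (by omega)]

variable {I O : Type}

/-- In state `μ`, the registers `A` contain the coordinates of `v`. -/
def HasElt (a : ℕ → L) (x : I → K) (μ : Mem K) (A : BIdx m → I ⊕ ℕ) (v : L) : Prop :=
  ∃ X : BIdx m → K, (∀ q, μ.Holds x (A q) (X q)) ∧ ofC a X = v

theorem HasElt.ext {x : I → K} {μ ν : Mem K} {A : BIdx m → I ⊕ ℕ} {v : L}
    (h : HasElt a x μ A v) (hμ : μ.Ext ν) : HasElt a x ν A v := by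
  obtain ⟨X, h1, h2⟩ := h
  exact ⟨X, fun q => (h1 q).ext hμ, h2⟩

theorem HasElt.congr {x : I → K} {μ : Mem K} {A : BIdx m → I ⊕ ℕ} {v w : L}
    (h : HasElt a x μ A v) (hv : v = w) : HasElt a x μ A w := hv ▸ h

namespace Prog

variable (K I O) in
/-- Load a constant of `L`. -/
noncomputable def constL (m : ℕ) (a : ℕ → L) (v : L) : Prog K I O (BIdx m → I ⊕ ℕ) :=
  mapList (fun q => const (Function.invFun (ofC a : (BIdx m → K) → L) v q)) Finset.univ.toList

/-- Apply an arithmetic operation of `K` coordinatewise. -/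
noncomputable def pointwise (op : ArithOp) (A B : BIdx m → I ⊕ ℕ) : Prog K I O (BIdx m → I ⊕ ℕ) :=
  mapList (fun q => arith op (A q) (B q)) Finset.univ.toList

/-- Multiply two elements of `L`. -/
noncomputable def mulL (T : CompTree K (BIdx m ⊕ BIdx m) (BIdx m)) (A B : BIdx m → I ⊕ ℕ) :
    Prog K I O (BIdx m → I ⊕ ℕ) :=
  (const 0).bind fun z => embed (Sum.elim A B) T fun _ => z

/-- Apply `θ_p` to an element of `L`. -/
noncomputable def conjL (c₀ c₁ : K) (p : ℕ) (A : BIdx m → I ⊕ ℕ) : Prog K I O (BIdx m → I ⊕ ℕ) :=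
  mapList (fun q => if getBit q p = 1 then (const c₁).bind fun r => arith .mul r (A q)
    else (const c₀).bind fun r => (arith .mul r (A (setBit q p 1))).bind fun r' =>
      arith .add (A q) r') Finset.univ.toList

/-- Extract a coefficient of an element of `L`. -/
noncomputable def coordL (s : BIdx m) (h : ℕ) (A : BIdx m → I ⊕ ℕ) :
    Prog K I O (BIdx m → I ⊕ ℕ) :=
  open Classical in
  (const 0).bind fun z =>
    pure fun q => if ∀ i < h, getBit q i = 0 then A (mergeBits h s q) else z

/-- Invert an element of `L`. -/
noncomputable def invL (a : ℕ → L) (c₀ c₁ : K) (T : CompTree K (BIdx m ⊕ BIdx m) (BIdx m))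
    (A : BIdx m → I ⊕ ℕ) : Prog K I O (BIdx m → I ⊕ ℕ) :=
  (constL K I O m a 1).bind fun E =>
    (iter (fun p (C : (BIdx m → I ⊕ ℕ) × (BIdx m → I ⊕ ℕ)) =>
      (conjL c₀ c₁ p C.1).bind fun D => (mulL T C.1 D).bind fun X => (mulL T C.2 D).bind fun Y =>
        pure (X, Y)) m (A, E)).bind fun C => pointwise .div C.2 fun _ => C.1 0

/-- Add up elements of `L`. -/
noncomputable def sumL {ι : Type*} (a : ℕ → L) (f : ι → Prog K I O (BIdx m → I ⊕ ℕ))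
    (S : Finset ι) : Prog K I O (BIdx m → I ⊕ ℕ) :=
  sumList (constL K I O m a 0) (pointwise .add) f S.toList

variable (hS : MulSetting θ a c₀ c₁ T M) {x : I → K} {μ : Mem K} {A B : BIdx m → I ⊕ ℕ} {v w : L}

theorem Comp.mapUniv {A : Type*} [Inhabited A] {f : BIdx m → Prog K I O A} {c : ℕ}
    {R : BIdx m → Mem K → A → Prop} (hR : ∀ i μ ν a, Mem.Ext μ ν → R i μ a → R i ν a)
    (hf : ∀ q, ∀ ν, μ.Ext ν → Comp x ν (f q) c (R q)) :
    Comp x μ (Prog.mapList f Finset.univ.toList) (2 ^ m * c) fun ν g => ∀ q, R q ν (g q) :=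
  (Comp.mapList hR _ fun q _ => hf q).mono (by simp)
    fun ν g _ h q => h q (Finset.mem_toList.2 (Finset.mem_univ q))

include hS

theorem Comp.constL (v : L) :
    Comp x μ (constL K I O m a v) 0 fun ν A => HasElt a x ν A v := by
  refine (Comp.mapUniv (c := 0)
    (R := fun q ν r => ν.Holds x r (Function.invFun (ofC a : (BIdx m → K) → L) v q))
    (fun _ _ _ _ h h' => h'.ext h) fun q ν _ => Comp.const _).mono (by simp) ?_
  exact fun ν g _ h => ⟨_, h, Function.rightInverse_invFun hS.surj v⟩

theorem Comp.addL (hA : HasElt a x μ A v) (hB : HasElt a x μ B w) :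
    Comp x μ (pointwise .add A B : Prog K I O _) (2 * M) fun ν C => HasElt a x ν C (v + w) := by
  obtain ⟨X, hX, rfl⟩ := hA
  obtain ⟨Y, hY, rfl⟩ := hB
  refine (Comp.mapUniv (c := 1) (R := fun q ν r => ν.Holds x r (X q + Y q))
    (fun _ _ _ _ h h' => h'.ext h) fun q ν h => Comp.arith ((hX q).ext h) ((hY q).ext h) rfl).mono
    (by simpa using hS.le) ?_
  exact fun ν g _ h => ⟨_, h, ofC_add X Y⟩

theorem Comp.subL (hA : HasElt a x μ A v) (hB : HasElt a x μ B w) :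
    Comp x μ (pointwise .sub A B : Prog K I O _) (2 * M) fun ν C => HasElt a x ν C (v - w) := by
  obtain ⟨X, hX, rfl⟩ := hA
  obtain ⟨Y, hY, rfl⟩ := hB
  refine (Comp.mapUniv (c := 1) (R := fun q ν r => ν.Holds x r (X q - Y q))
    (fun _ _ _ _ h h' => h'.ext h) fun q ν h => Comp.arith ((hX q).ext h) ((hY q).ext h) rfl).mono
    (by simpa using hS.le) ?_
  exact fun ν g _ h => ⟨_, h, ofC_sub X Y⟩

theorem Comp.mulL (hA : HasElt a x μ A v) (hB : HasElt a x μ B w) :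
    Comp x μ (mulL T A B : Prog K I O _) M fun ν C => HasElt a x ν C (v * w) := by
  obtain ⟨X, hX, rfl⟩ := hA
  obtain ⟨Y, hY, rfl⟩ := hB
  obtain ⟨Z, c, h1, h2, h3⟩ := hS.mul X Y
  refine (Comp.bind (c' := M) (Comp.const 0) fun z ν hν hz => ?_).le (by simp)
  -- A run expects a workspace full of zeros; a single register containing 0 stands for all of it.
  refine (Yields.embed T (x' := Sum.elim X Y) (w := fun _ => 0) ?_ (fun _ => hz) h1).mono ?_
  · rintro (q | q)
    exacts [(hX q).ext hν, (hY q).ext hν]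
  · exact fun r ξ c' _ h => ⟨⟨Z, h.1, h3⟩, h.2 ▸ h2⟩

theorem Comp.conjL {p : ℕ} (hp : p < m) (hA : HasElt a x μ A v) :
    Comp x μ (conjL c₀ c₁ p A : Prog K I O _) (4 * M) fun ν C => HasElt a x ν C (θ p v) := by
  obtain ⟨X, hX, rfl⟩ := hA
  refine (Comp.mapUniv (c := 2) (R := fun q ν r => ν.Holds x r
    (if getBit q p = 1 then c₁ * X q else X q + c₀ * X (setBit q p 1)))
    (fun _ _ _ _ h h' => h'.ext h) fun q ν h => ?_).mono (by have := hS.le; omega) ?_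
  · split_ifs
    · exact (Comp.bind (c' := 1) (Comp.const c₁) fun r ξ hξ hr =>
        Comp.arith hr ((hX q).ext (h.trans hξ)) rfl).le (by simp)
    · exact (Comp.bind (c' := 2) (Comp.const c₀) fun r ξ hξ hr =>
        (Comp.arith hr ((hX (setBit q p 1)).ext (h.trans hξ)) rfl).bind (c := 1) (c' := 1)
          fun r' ξ' hξ' hr' =>
            Comp.arith ((hX q).ext ((h.trans hξ).trans hξ')) hr' rfl).le (by simp)
  · exact fun ν g _ h => ⟨_, h, (map_ofC hS.dual hp (hS.conj p hp) X).symm⟩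

theorem Comp.coordL {h : ℕ} (hh : h ≤ m) (s : BIdx m) (hA : HasElt a x μ A v) :
    Comp x μ (coordL s h A : Prog K I O _) 0 fun ν C => HasElt a x ν C (coord θ a s h v) := by
  obtain ⟨X, hX, rfl⟩ := hA
  refine Comp.bind (c' := 0) (Comp.const 0) fun z ν hν hz => Comp.pure ⟨coordCoords s h X, ?_, ?_⟩
  · intro q
    rw [coordCoords_apply hh]
    by_cases hq : ∀ i < h, getBit q i = 0
    · simpa only [if_pos hq] using (hX _).ext hν
    · simpa only [if_neg hq] using hz
  · exact (coord_ofC hS.dual hh s X).symm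

/-- The inverse is the cofactor divided by the norm, and the norm lies in `K`, so only divisions by
one element of `K` remain. Each of the m rounds needs one conjugation and two products; the number
of rounds is absorbed by m + 1 ≤ 2^m. -/
theorem Comp.invL (hA : HasElt a x μ A v) (hv : v ≠ 0) :
    Comp x μ (invL a c₀ c₁ T A : Prog K I O _) (6 * 2 ^ m * M) fun ν C =>
      HasElt a x ν C v⁻¹ := by
  have hle := hS.le
  refine (Comp.bind (c' := m * (6 * M) + 2 * M) (Comp.constL hS 1) fun E ν hν hE => ?_).le ?_
  · refine Comp.bind (R := fun ν (C : (BIdx m → I ⊕ ℕ) × (BIdx m → I ⊕ ℕ)) =>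
        HasElt a x ν C.1 (partialNorm θ v m) ∧
      HasElt a x ν C.2 (partialCofactor θ v m)) ?_ ?_
    · refine (Comp.iter (c := fun _ => 6 * M) (J := fun p ν (C : (BIdx m → I ⊕ ℕ) × (BIdx m → I ⊕ ℕ)) =>
        HasElt a x ν C.1 (partialNorm θ v p) ∧ HasElt a x ν C.2 (partialCofactor θ v p))
        ⟨hA.ext hν, hE⟩ ?_).le (by simp)
      rintro p hp ξ ⟨C, C'⟩ hξ ⟨hC, hC'⟩
      refine ((Comp.conjL hS hp hC).bind (c' := 2 * M) fun D ξ₁ h₁ hD => ?_).le (by omega)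
      refine ((Comp.mulL hS (hC.ext h₁) hD).bind (c' := M) fun X ξ₂ h₂ hX => ?_).le (by omega)
      refine (Comp.mulL hS (hC'.ext (h₁.trans h₂)) (hD.ext h₂)).bind (c' := 0)
        fun Y ξ₃ h₃ hY => Comp.pure ⟨hX.ext h₃, hY⟩
    · rintro ⟨C, C'⟩ ξ hξ ⟨⟨X, hX, hXv⟩, ⟨Y, hY, hYv⟩⟩
      obtain ⟨c, hc⟩ := exists_algebraMap_eq hS.dual hS.surj (partialNorm_fixed hS.dual v m)
      have hX0 : X 0 = c := by
        rw [ofC_injective hS.dual (hXv.trans hc), Pi.single_eq_same]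
      have hcv : v * ofC a Y = algebraMap K L c := by
        rw [hYv, mul_partialCofactor, hc, ofC_single, bas_zero, Algebra.smul_def, mul_one]
      have hc0 : c ≠ 0 := by
        rintro rfl
        refine partialNorm_ne_zero (θ := θ) hv m ?_
        rw [hc, Pi.single_zero, ofC_zero]
      refine (Comp.mapUniv (c := 1) (R := fun q ν r => ν.Holds x r (Y q / c))
        (fun _ _ _ _ h h' => h'.ext h)
        fun q ν h => Comp.arith ((hY q).ext h) ((hX 0).ext h) ?_).mono (by simpa using hle) ?_
      · rw [hX0]
        simp [ArithOp.apply, hc0]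
      · refine fun ν g _ h => ⟨_, h, ?_⟩
        rw [show (fun q => Y q / c) = c⁻¹ • Y by funext q; simp [div_eq_inv_mul], ofC_smul,
          Algebra.smul_def, map_inv₀]
        have hc0' : algebraMap K L c ≠ 0 := by simpa using hc0
        rw [inv_mul_eq_iff_eq_mul₀ hc0', ← hcv]
        field_simp
  · have h1 : m + 1 ≤ 2 ^ m := Nat.lt_two_pow_self
    nlinarith [Nat.mul_le_mul_right M h1]

theorem Comp.sumL {ι : Type*} {f : ι → Prog K I O (BIdx m → I ⊕ ℕ)} {c : ℕ} (w : ι → L)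
    (S : Finset ι)
    (hf : ∀ i ∈ S, ∀ ν, μ.Ext ν → Comp x ν (f i) c fun ξ A => HasElt a x ξ A (w i)) :
    Comp x μ (sumL a f S) (S.card * (c + 2 * M)) fun ν A => HasElt a x ν A (∑ i ∈ S, w i) := by
  refine (Comp.sumList (R := HasElt a x) (d := 2 * M) (c := c) (fun _ _ _ _ h h' => h'.ext h)
    (fun _ => Comp.constL hS 0) (fun _ _ _ _ _ h h' => Comp.addL hS h h') w S.toList ?_).mono
    (by simp) ?_
  · exact fun i hi => hf i (Finset.mem_toList.1 hi)
  · intro ν A _ h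
    rwa [Finset.sum_map_toList] at h

end Prog

end FieldPrograms

/-! ### A functional that vanishes on the span of the error. -/

section Annihilator

variable {K L : Type*} [Field K] [Field L] [Algebra K L] {m : ℕ}
variable {θ : ℕ → L ≃ₐ[K] L} {a : ℕ → L} {h : ℕ}

/-- An element whose products with the `u k` have no coefficient at the product of all `a_i`,
`i < h`. -/
noncomputable def annihilator (θ : ℕ → L ≃ₐ[K] L) (a : ℕ → L) (h : ℕ) (P : Finset (BIdx m))
    (u : BIdx m → L) (π : BIdx m) : L :=
  dualBas θ a π h - ∑ k ∈ P, coord θ a π h (u k) * dualBas θ a k h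

variable {P : Finset (BIdx m)} {u : BIdx m → L} {π : BIdx m}

theorem topCoord_annihilator_mul (hθ : DualGenerators m θ a) (hh : h ≤ m) (v : L) :
    topCoord θ a m h (annihilator θ a h P u π * v) =
      coord θ a π h v - ∑ k ∈ P, coord θ a π h (u k) * coord θ a k h v := by
  rw [annihilator, sub_mul, Finset.sum_mul, topCoord, coord_sub, coord_sum, ← topCoord,
    ← coord_eq_topCoord hθ hh]
  congr 1
  refine Finset.sum_congr rfl fun k _ => ?_
  rw [mul_assoc, coord_mul (coord_fixed hθ hh _ _), ← topCoord, ← coord_eq_topCoord hθ hh]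

/-- On the span, the coordinate at `π` is determined by those at the pivots, and the functional is
the difference of the two sides of this relation. -/
theorem topCoord_annihilator_mul_of_inSpan (hθ : DualGenerators m θ a) (hh : h ≤ m) {v : L}
    (hv : InSpan θ a h P u v) : topCoord θ a m h (annihilator θ a h P u π * v) = 0 := by
  rw [topCoord_annihilator_mul hθ hh, sub_eq_zero]
  conv_lhs => rw [hv]
  rw [coord_sum]
  refine Finset.sum_congr rfl fun k _ => ?_
  rw [coord_mul (coord_fixed hθ hh _ _), mul_comm]

/-- The functional takes the value 1 at `bas a π`, because `π` is not a pivot. -/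
theorem annihilator_ne_zero (hθ : DualGenerators m θ a) (hh : h ≤ m) (hP : P ⊆ low m h)
    (hπ : π ∈ low m h) (hπP : π ∉ P) : annihilator θ a h P u π ≠ 0 := by
  intro h0
  have h1 := topCoord_annihilator_mul (P := P) (u := u) (π := π) hθ hh (bas a π)
  rw [h0, zero_mul, coord_bas hθ hh hπ hπ, if_pos rfl, Finset.sum_eq_zero, topCoord,
    show coord θ a _ h 0 = 0 from map_zero (coordHom θ a h _)] at h1
  · simp at h1
  · intro k hk
    rw [coord_bas hθ hh (hP hk) hπ, if_neg, mul_zero]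
    rintro rfl
    exact hπP hk

/-- An unknown multiple of the basis elements can be read off from a family that is known up to
elements of the span of the `u k`. -/
theorem annihilator_inv_mul_sum (hθ : DualGenerators m θ a) (hh : h ≤ m) (hP : P ⊆ low m h)
    (hπ : π ∈ low m h) (hπP : π ∉ P) {ψ ψ' : BIdx m → L} {c : L}
    (hψ : ∀ s ∈ low m h, ψ s = ψ' s + c * bas a s) (hψ' : ∀ s ∈ low m h, InSpan θ a h P u (ψ' s)) :
    (annihilator θ a h P u π)⁻¹ * ∑ s ∈ low m h,
      topCoord θ a m h (annihilator θ a h P u π * ψ s) * dualBas θ a s h = c := by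
  have h1 : ∀ s ∈ low m h, topCoord θ a m h (annihilator θ a h P u π * ψ s) * dualBas θ a s h =
      topCoord θ a m h (annihilator θ a h P u π * c * bas a s) * dualBas θ a s h := by
    intro s hs
    rw [hψ s hs, mul_add, topCoord, coord_add, ← topCoord,
      topCoord_annihilator_mul_of_inSpan hθ hh (hψ' s hs), zero_add, mul_assoc]
    rfl
  -- The values that are left are those of the functional of `annihilator * c` on a basis; the dual
  -- basis reassembles this product.
  rw [Finset.sum_congr rfl h1, sum_topCoord_mul_dualBas hθ hh,
    inv_mul_cancel_left₀ (annihilator_ne_zero hθ hh hP hπ hπP)]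

end Annihilator

/-! ### The decoder as a program, and the cost of folding. -/

theorem sum_two_pow_le {p j : ℕ} (hj : j ≤ p) : ∑ i ∈ Finset.range j, 2 ^ (p - 1 - i) ≤ 2 ^ p := by
  have key : ∑ i ∈ Finset.range j, 2 ^ (p - 1 - i) + 2 ^ (p - j) = 2 ^ p := by
    induction j with
    | zero => simp
    | succ j ih =>
      rw [← ih (by omega), Finset.sum_range_succ, show p - (j + 1) = p - 1 - j by omega,
        show p - j = p - 1 - j + 1 by omega, pow_succ]
      omega
  exact key ▸ Nat.le_add_right _ _

section Decoder

variable {K L : Type*} [Field K] [Field L] [Algebra K L] {m : ℕ}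
variable {θ : ℕ → L ≃ₐ[K] L} {a : ℕ → L} {c₀ c₁ : K}
  {T : CompTree K (BIdx m ⊕ BIdx m) (BIdx m)} {M : ℕ} {I O : Type}

/-- In state `μ`, the arrays `A s`, `s ∈ S`, of registers contain the coordinates of `φ s`. -/
def HasArr (a : ℕ → L) (x : I → K) (μ : Mem K) (S : Finset (BIdx m))
    (A : BIdx m → BIdx m → I ⊕ ℕ) (φ : BIdx m → L) : Prop :=
  ∀ s ∈ S, HasElt a x μ (A s) (φ s)

theorem HasArr.ext {x : I → K} {μ ν : Mem K} {S : Finset (BIdx m)}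
    {A : BIdx m → BIdx m → I ⊕ ℕ} {φ : BIdx m → L}
    (h : HasArr a x μ S A φ) (hμ : μ.Ext ν) : HasArr a x ν S A φ :=
  fun s hs => (h s hs).ext hμ

namespace Prog

/-- Run a program for all members of a finite set. -/
noncomputable def mapArr (f : BIdx m → Prog K I O (BIdx m → I ⊕ ℕ)) (S : Finset (BIdx m)) :
    Prog K I O (BIdx m → BIdx m → I ⊕ ℕ) :=
  mapList f S.toList

theorem Comp.mapArr {x : I → K} {μ : Mem K} {f : BIdx m → Prog K I O (BIdx m → I ⊕ ℕ)}
    {S : Finset (BIdx m)} {c : ℕ} {φ : BIdx m → L}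
    (hf : ∀ s ∈ S, ∀ ν, μ.Ext ν → Comp x ν (f s) c fun ξ A => HasElt a x ξ A (φ s)) :
    Comp x μ (mapArr f S) (S.card * c) fun ν A => HasArr a x ν S A φ :=
  (Comp.mapList (R := fun s ν A => HasElt a x ν A (φ s)) (fun _ _ _ _ h h' => h'.ext h) S.toList
    fun s hs => hf s (Finset.mem_toList.1 hs)).mono (by simp)
    fun ν A _ h s hs => h s (Finset.mem_toList.2 hs)

variable (θ a c₀ c₁ T)

/-- From the values of an endomorphism at `bas a s`, `s ∈ low m (p + 1)`, compute those of its part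
`movePart θ a p` at `s ∈ low m p`. -/
noncomputable def foldStep (p : ℕ) (A : BIdx m → BIdx m → I ⊕ ℕ) :
    Prog K I O (BIdx m → BIdx m → I ⊕ ℕ) :=
  mapArr (fun s => (constL K I O m a (a p)).bind fun X => (mulL T X (A s)).bind fun X =>
    (pointwise .sub (A (setBit s p 1)) X).bind fun X =>
      (constL K I O m a (θ p (a p) - a p)⁻¹).bind fun D => mulL T D X) (low m p)

/-- Iterate `foldStep`. -/
noncomputable def foldSteps (p j : ℕ) (A : BIdx m → BIdx m → I ⊕ ℕ) :
    Prog K I O (BIdx m → BIdx m → I ⊕ ℕ) :=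
  iter (fun i A => foldStep θ a T (p - 1 - i) A) j A

/-- Compute the part of an endomorphism that moves all `a_p`, `h ≤ p`, and the parts that move all
of them except one. -/
noncomputable def foldAll (h : ℕ) (A : BIdx m → BIdx m → I ⊕ ℕ) :
    Prog K I O ((BIdx m → BIdx m → I ⊕ ℕ) × (ℕ → BIdx m → BIdx m → I ⊕ ℕ)) :=
  iter (fun i (C : (BIdx m → BIdx m → I ⊕ ℕ) × (ℕ → BIdx m → BIdx m → I ⊕ ℕ)) =>
    (foldStep θ a T (m - 1 - i) C.1).bind fun A' =>
    (mapArr (fun s => pointwise .sub (C.1 s) (A' s)) (low m (m - 1 - i))).bind fun X =>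
    (foldSteps θ a T (m - 1 - i) (m - 1 - i - h) X).bind fun G =>
      pure (A', Function.update C.2 (m - 1 - i) G)) (m - h) (A, fun _ => A)

/-- Take a new column into account in the reduction of the columns in `A`. -/
noncomputable def reduceStep (h : ℕ) (A : BIdx m → BIdx m → I ⊕ ℕ) (s : BIdx m)
    (C : Finset (BIdx m) × (BIdx m → BIdx m → I ⊕ ℕ) × (BIdx m → BIdx m → I ⊕ ℕ)) :
    Prog K I O (Finset (BIdx m) × (BIdx m → BIdx m → I ⊕ ℕ) × (BIdx m → BIdx m → I ⊕ ℕ)) :=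
  (sumL a (fun k => (coordL k h (A s)).bind fun c => mulL T c (C.2.1 k)) C.1).bind fun R =>
  (pointwise .sub (A s) R).bind fun R =>
  (findNonzero R Finset.univ.toList).bind fun o =>
  match o with
  | none => pure C
  | some q =>
    (coordL (mergeBits h q 0) h R).bind fun c =>
    (invL a c₀ c₁ T c).bind fun c =>
    (mulL T c R).bind fun u =>
    (sumL a (fun k => (coordL k h (A s)).bind fun c => mulL T c (C.2.2 k)) C.1).bind fun Z =>
    (constL K I O m a (bas a s)).bind fun b =>
    (pointwise .sub b Z).bind fun Z =>
    (mulL T c Z).bind fun β =>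
    (mapArr (fun k => (coordL (mergeBits h q 0) h (C.2.1 k)).bind fun c =>
      (mulL T c u).bind fun X => pointwise .sub (C.2.1 k) X) C.1).bind fun U =>
    (mapArr (fun k => (coordL (mergeBits h q 0) h (C.2.1 k)).bind fun c =>
      (mulL T c β).bind fun X => pointwise .sub (C.2.2 k) X) C.1).bind fun V =>
    pure (insert (mergeBits h q 0) C.1, Function.update U (mergeBits h q 0) u,
      Function.update V (mergeBits h q 0) β)

/-- Reduce the columns in `A` given by a list. -/
noncomputable def reduceList (h : ℕ) (A : BIdx m → BIdx m → I ⊕ ℕ) : List (BIdx m) →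
    Finset (BIdx m) × (BIdx m → BIdx m → I ⊕ ℕ) × (BIdx m → BIdx m → I ⊕ ℕ) →
    Prog K I O (Finset (BIdx m) × (BIdx m → BIdx m → I ⊕ ℕ) × (BIdx m → BIdx m → I ⊕ ℕ))
  | [], C => pure C
  | s :: l, C => (reduceStep a c₀ c₁ T h A s C).bind (reduceList h A l)

/-- Compute `annihilator` and its inverse. -/
noncomputable def annihilatorL (h : ℕ) (P : Finset (BIdx m)) (U : BIdx m → BIdx m → I ⊕ ℕ)
    (π : BIdx m) : Prog K I O ((BIdx m → I ⊕ ℕ) × (BIdx m → I ⊕ ℕ)) :=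
  (sumL a (fun k => (coordL π h (U k)).bind fun c =>
    (constL K I O m a (dualBas θ a k h)).bind fun d => mulL T c d) P).bind fun X =>
  (constL K I O m a (dualBas θ a π h)).bind fun d =>
  (pointwise .sub d X).bind fun y =>
  (invL a c₀ c₁ T y).bind fun z => pure (y, z)

/-- Remove the unknown multiple of the basis from the family in `G`. -/
noncomputable def correctL (h : ℕ) (y z : BIdx m → I ⊕ ℕ) (G : BIdx m → BIdx m → I ⊕ ℕ) :
    Prog K I O (BIdx m → BIdx m → I ⊕ ℕ) :=
  (sumL a (fun s => (mulL T y (G s)).bind fun X => (coordL (fun _ => 1) h X).bind fun X =>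
    (constL K I O m a (dualBas θ a s h)).bind fun d => mulL T X d) (low m h)).bind fun X =>
  (mulL T z X).bind fun c =>
  mapArr (fun s => (constL K I O m a (bas a s)).bind fun b => (mulL T c b).bind fun X =>
    pointwise .sub (G s) X) (low m h)

/-- From the values of `movePart θ a p f` at `s ∈ low m p`, compute those of `f` at
`s ∈ low m (p + 1)`. -/
noncomputable def unfoldStep (h p : ℕ) (P : Finset (BIdx m)) (V G F : BIdx m → BIdx m → I ⊕ ℕ) :
    Prog K I O (BIdx m → BIdx m → I ⊕ ℕ) :=
  (mapArr (fun k => sumL a (fun s => (coordL s h (V k)).bind fun X => (conjL c₀ c₁ p X).bind fun X =>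
    mulL T X (G s)) (low m h)) P).bind fun W =>
  (mapArr (fun s => sumL a (fun k => (coordL k h (F s)).bind fun X => (conjL c₀ c₁ p X).bind fun X =>
    mulL T (W k) X) P) (low m p)).bind fun X =>
  (mapArr (fun s => pointwise .add (X s) (F s)) (low m p)).bind fun N₀ =>
  (mapArr (fun s => (constL K I O m a (a p)).bind fun b => (mulL T b (X s)).bind fun Z =>
    (constL K I O m a (θ p (a p))).bind fun b => (mulL T b (F s)).bind fun Z' =>
      pointwise .add Z Z') (low m p)).bind fun N₁ =>
  pure fun s => if getBit s p = 1 then N₁ (setBit s p 0) else N₀ s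

/-- Compute the values of the error from its foldings. -/
noncomputable def unfoldAll (h : ℕ) (P : Finset (BIdx m)) (V : BIdx m → BIdx m → I ⊕ ℕ)
    (y z : BIdx m → I ⊕ ℕ) (G : ℕ → BIdx m → BIdx m → I ⊕ ℕ) (F : BIdx m → BIdx m → I ⊕ ℕ) :
    Prog K I O (BIdx m → BIdx m → I ⊕ ℕ) :=
  iter (fun i F => (correctL θ a T h y z (G (h + i))).bind fun G' =>
    unfoldStep θ a c₀ c₁ T h (h + i) P V G' F) (m - h) F

/-- The decoder: from the values of the received endomorphism, compute those of the codeword. -/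
noncomputable def decode (h : ℕ) (A : BIdx m → BIdx m → I ⊕ ℕ) :
    Prog K I O (BIdx m → BIdx m → I ⊕ ℕ) :=
  (foldAll θ a T h A).bind fun G =>
  (reduceList a c₀ c₁ T h G.1 (low m h).toList (∅, A, A)).bind fun C =>
  (annihilatorL θ a c₀ c₁ T h C.1 C.2.1
    (Classical.epsilon fun π => π ∈ low m h ∧ π ∉ C.1)).bind fun y =>
  (unfoldAll θ a c₀ c₁ T h C.1 C.2.2 y.1 y.2 G.2 G.1).bind fun E =>
  mapArr (fun s => pointwise .sub (A s) (E s)) Finset.univ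

variable {θ a c₀ c₁ T}
variable (hS : MulSetting θ a c₀ c₁ T M) {x : I → K} {μ : Mem K}
  {A : BIdx m → BIdx m → I ⊕ ℕ} {f g : L → L} {h : ℕ}

include hS

theorem Comp.foldStep {p : ℕ} (hp : p < m)
    (hA : HasArr a x μ (low m (p + 1)) A fun s => f (bas a s)) :
    Comp x μ (foldStep θ a T p A : Prog K I O _) (2 ^ p * (4 * M)) fun ν B =>
      HasArr a x ν (low m p) B fun s => movePart θ a p f (bas a s) := by
  rw [← card_low hp.le]
  refine Comp.mapArr fun s hs ν hν => ?_
  refine ((Comp.constL hS _).bind (c' := 4 * M) fun X ν₁ h₁ hX => ?_).le (by omega)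
  refine ((Comp.mulL hS hX ((hA s (low_mono (Nat.le_succ p) hs)).ext (hν.trans h₁))).bind
    (c' := 3 * M) fun X ν₂ h₂ hX => ?_).le (by omega)
  refine ((Comp.subL hS ((hA _ (setBit_one_mem_low hs 1)).ext ((hν.trans h₁).trans h₂)) hX).bind
    (c' := M) fun X ν₃ h₃ hX => ?_).le (by omega)
  refine ((Comp.constL hS _).bind (c' := M) fun D ν₄ h₄ hD => ?_).le (by omega)
  refine (Comp.mulL hS hD (hX.ext h₄)).mono le_rfl fun ξ B _ hB => hB.congr ?_
  dsimp only
  rw [movePart, bas_setBit_low hp hs, div_eq_inv_mul]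

theorem Comp.foldSteps {p j : ℕ} (hp : p ≤ m) (hj : j ≤ p)
    (hA : HasArr a x μ (low m p) A fun s => f (bas a s)) :
    Comp x μ (foldSteps θ a T p j A : Prog K I O _) (2 ^ p * (4 * M)) fun ν B =>
      HasArr a x ν (low m (p - j)) B fun s => moveParts θ a f p j (bas a s) := by
  refine (Comp.iter (c := fun i => 2 ^ (p - 1 - i) * (4 * M)) (J := fun i ν B =>
    HasArr a x ν (low m (p - i)) B fun s => moveParts θ a f p i (bas a s)) hA ?_).le ?_
  · intro i hi ν B hν hB
    rw [show p - i = p - 1 - i + 1 by omega] at hB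
    refine (Comp.foldStep hS (by omega) hB).mono le_rfl fun ξ C _ hC => ?_
    rwa [show p - (i + 1) = p - 1 - i by omega]
  · rw [← Finset.sum_mul]
    exact Nat.mul_le_mul_right _ (sum_two_pow_le hj)

omit hS in
/-- The part of `f` that fixes `a_p` and moves all other `a_q`, `h ≤ q`. -/
noncomputable def exceptPart (θ : ℕ → L ≃ₐ[K] L) (a : ℕ → L) (m h p : ℕ) (f : L → L) : L → L :=
  moveParts θ a (fixPart θ a p (moveParts θ a f m (m - 1 - p))) p (p - h)

/-- At level p there are 2^p columns. Folding, subtracting, and folding the complementary part down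
to level h cost at most 4M, 2M and 4M for each of them, and the levels form a geometric sum. -/
theorem Comp.foldAll (hh : h ≤ m) (hA : HasArr a x μ Finset.univ A fun s => f (bas a s)) :
    Comp x μ (foldAll θ a T h A : Prog K I O _) (10 * 2 ^ m * M) fun ν C =>
      HasArr a x ν (low m h) C.1 (fun s => moveParts θ a f m (m - h) (bas a s)) ∧
      ∀ p, h ≤ p → p < m → HasArr a x ν (low m h) (C.2 p) fun s =>
        exceptPart θ a m h p f (bas a s) := by
  refine ((Comp.iter (c := fun i => 2 ^ (m - 1 - i) * (10 * M)) (J := fun i ν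
    (C : (BIdx m → BIdx m → I ⊕ ℕ) × (ℕ → BIdx m → BIdx m → I ⊕ ℕ)) =>
      HasArr a x ν (low m (m - i)) C.1 (fun s => moveParts θ a f m i (bas a s)) ∧
      ∀ p, m - i ≤ p → p < m → HasArr a x ν (low m h) (C.2 p) fun s =>
        exceptPart θ a m h p f (bas a s)) ?_ ?_).le (c' := 10 * 2 ^ m * M) ?_).mono le_rfl ?_
  · refine ⟨?_, fun p h1 h2 => by omega⟩
    rw [Nat.sub_zero, low_top]
    exact hA
  · rintro i hi ν ⟨B, G⟩ hν ⟨hB, hG⟩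
    have hp : m - i = m - 1 - i + 1 := by omega
    dsimp only at hB ⊢
    have hB' := hB
    rw [hp] at hB'
    refine ((Comp.foldStep hS (by omega) hB').bind (c' := 2 ^ (m - 1 - i) * (6 * M))
      fun B' ν₁ h₁ hB₁ => ?_).le (by rw [← Nat.mul_add]; apply Nat.mul_le_mul_left; omega)
    have hX : Comp x ν₁ (Prog.mapArr (fun s => pointwise .sub (B s) (B' s)) (low m (m - 1 - i)) :
        Prog K I O _) ((low m (m - 1 - i)).card * (2 * M)) fun ξ X =>
        HasArr a x ξ (low m (m - 1 - i)) X fun s =>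
          fixPart θ a (m - 1 - i) (moveParts θ a f m i) (bas a s) :=
      Comp.mapArr fun s hs ξ hξ => Comp.subL hS
        ((hB' s (low_mono (Nat.le_succ _) hs)).ext (h₁.trans hξ)) ((hB₁ s hs).ext hξ)
    rw [card_low (by omega)] at hX
    refine (hX.bind (c' := 2 ^ (m - 1 - i) * (4 * M)) fun X ν₂ h₂ hX => ?_).le
      (by rw [← Nat.mul_add]; apply Nat.mul_le_mul_left; omega)
    refine (Comp.foldSteps hS (by omega) (j := m - 1 - i - h) (by omega) hX).bind (c' := 0)
      fun G' ν₃ h₃ hG' => Comp.pure ⟨?_, ?_⟩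
    · dsimp only
      rw [show m - (i + 1) = m - 1 - i by omega]
      exact (hB₁.ext h₂).ext h₃
    · intro p hp1 hp2
      by_cases hpi : p = m - 1 - i
      · subst hpi
        dsimp only
        rw [Function.update_self, exceptPart, show m - 1 - (m - 1 - i) = i by omega]
        rwa [show m - 1 - i - (m - 1 - i - h) = h by omega] at hG'
      · dsimp only
        rw [Function.update_of_ne hpi]
        exact (((hG p (by omega) hp2).ext h₁).ext h₂).ext h₃
  · rw [← Finset.sum_mul]
    calc _ ≤ 2 ^ m * (10 * M) := Nat.mul_le_mul_right _ (sum_two_pow_le (by omega))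
      _ = _ := by ring
  · rintro ν ⟨B, G⟩ _ ⟨h1, h2⟩
    rw [show m - (m - h) = h by omega] at h1 h2
    exact ⟨h1, h2⟩

end Prog

end Decoder

/-! ### Correctness and amortised cost of the column reduction. -/

section Reduction

variable {K L : Type*} [Field K] [Field L] [Algebra K L] {m : ℕ}
variable {θ : ℕ → L ≃ₐ[K] L} {a : ℕ → L} {c₀ c₁ : K}
  {T : CompTree K (BIdx m ⊕ BIdx m) (BIdx m)} {M : ℕ} {I O : Type}

namespace Prog

variable (hS : MulSetting θ a c₀ c₁ T M) {x : I → K} {μ : Mem K}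
  {A U V : BIdx m → BIdx m → I ⊕ ℕ} {h : ℕ} {φ u β : BIdx m → L} {P : Finset (BIdx m)} {t : ℕ}

include hS

theorem Comp.sumCoordMul (hh : h ≤ m) {B : BIdx m → I ⊕ ℕ} {v : L} (ht : P.card ≤ t)
    (hB : HasElt a x μ B v) (hU : HasArr a x μ P U u) :
    Comp x μ (Prog.sumL a (fun k => (Prog.coordL k h B).bind fun c => Prog.mulL T c (U k)) P :
        Prog K I O _) (t * (3 * M)) fun ν R =>
      HasElt a x ν R (∑ k ∈ P, coord θ a k h v * u k) := by
  refine (Comp.sumL hS (c := M) (fun k => coord θ a k h v * u k) P fun k hk ν hν => ?_).le ?_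
  · exact ((Comp.coordL hS hh k (hB.ext hν)).bind (c' := M) fun c ξ hξ hc =>
      Comp.mulL hS hc ((hU k hk).ext (hν.trans hξ))).le (by omega)
  · exact Nat.mul_le_mul ht (by omega)

theorem Comp.subCoordMul (hh : h ≤ m) {π : BIdx m} {B : BIdx m → I ⊕ ℕ} {v : L} (ht : P.card ≤ t)
    (hB : HasElt a x μ B v) (hU : HasArr a x μ P U u) (hV : HasArr a x μ P V β) :
    Comp x μ (Prog.mapArr (fun k => (Prog.coordL π h (U k)).bind fun c =>
        (Prog.mulL T c B).bind fun X => pointwise .sub (V k) X) P : Prog K I O _) (t * (3 * M)) fun ν W =>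
      HasArr a x ν P W fun k => β k - coord θ a π h (u k) * v := by
  refine (Comp.mapArr (c := 3 * M) fun k hk ν hν => ?_).le (Nat.mul_le_mul_right _ ht)
  refine ((Comp.coordL hS hh π ((hU k hk).ext hν)).bind (c' := 3 * M) fun c ξ hξ hc => ?_).le
    (by omega)
  refine ((Comp.mulL hS hc (hB.ext (hν.trans hξ))).bind (c' := 2 * M) fun X ξ' hξ' hX => ?_).le
    (by omega)
  exact Comp.subL hS ((hV k hk).ext ((hν.trans hξ).trans hξ')) hX

/-- The state of the reduction. -/
def ReduceInv (θ : ℕ → L ≃ₐ[K] L) (a : ℕ → L) (h : ℕ) (φ : BIdx m → L) (x : I → K) (ν : Mem K)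
    (C : Finset (BIdx m) × (BIdx m → BIdx m → I ⊕ ℕ) × (BIdx m → BIdx m → I ⊕ ℕ))
    (u β : BIdx m → L) : Prop :=
  PivotSystem θ a h φ C.1 u β ∧ HasArr a x ν C.1 C.2.1 u ∧ HasArr a x ν C.1 C.2.2 β

/-- The number of pivots serves as a potential. Every column pays for the computation of its residue
and the search for a nonzero entry; the inversion and the updates are paid for by the new pivot, and
there are at most `t` of these. -/
theorem Yields.reduceStep (hh : h ≤ m)
    (hcard : ∀ P u β, PivotSystem θ a h φ P u β → P.card ≤ t) {s : BIdx m} (hs : s ∈ low m h)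
    (hA : HasElt a x μ (A s) (φ s))
    {C : Finset (BIdx m) × (BIdx m → BIdx m → I ⊕ ℕ) × (BIdx m → BIdx m → I ⊕ ℕ)}
    (hC : ReduceInv θ a h φ x μ C u β) :
    Yields x (reduceStep a c₀ c₁ T h A s C : Prog K I O _) μ fun D ν c => ∃ u' β',
      ReduceInv θ a h φ x ν D u' β' ∧ (∀ v, InSpan θ a h C.1 u v → InSpan θ a h D.1 u' v) ∧
      InSpan θ a h D.1 u' (φ s) ∧ c + C.1.card * ((12 * t + 4 + 6 * 2 ^ m) * M) ≤
        (3 * t + 4) * M + D.1.card * ((12 * t + 4 + 6 * 2 ^ m) * M) := by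
  obtain ⟨P, U, V⟩ := C
  obtain ⟨hP, hU, hV⟩ := hC
  dsimp only at hP hU hV ⊢
  have ht := hcard P u β hP
  refine Yields.bind (Comp.sumCoordMul hS hh ht hA hU) fun R ν₁ d₁ h₁ hR => ?_
  obtain ⟨hR, hd₁⟩ := hR
  refine Yields.bind (Comp.subL hS (hA.ext h₁) hR) fun R ν₂ d₂ h₂ hR => ?_
  obtain ⟨⟨X, hX, hXr⟩, hd₂⟩ := hR
  refine Yields.bind (Comp.findNonzero (v := X) Finset.univ.toList fun q _ => hX q)
    fun o ν₃ d₃ h₃ ho => ?_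
  obtain ⟨⟨rfl, ho⟩, hd₃⟩ := ho
  have hd₃' : d₃ ≤ 2 * M := hd₃.trans (by simpa using hS.le)
  cases o with
  | none =>
    refine Yields.pure ⟨u, β, ⟨hP, (hU.ext h₁).ext h₂, (hV.ext h₁).ext h₂⟩, fun v hv => hv, ?_, ?_⟩
    -- All entries in `K` are zero, so the residue vanishes and the column already lies in the span.
    · have hX0 : X = 0 := funext fun q => ho q (Finset.mem_toList.2 (Finset.mem_univ q))
      rw [hX0, ofC_zero] at hXr
      exact (sub_eq_zero.1 hXr.symm)
    · have : (3 * t + 4) * M = t * (3 * M) + 2 * M + 2 * M := by ring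
      dsimp only
      omega
  | some q =>
    dsimp only at ho
    set π := mergeBits h q 0 with hπ
    have hU₂ := (hU.ext h₁).ext h₂
    have hV₂ := (hV.ext h₁).ext h₂
    have hR : HasElt a x ν₃ R (residue θ a h P u (φ s)) := ⟨X, hX, hXr⟩
    have hne : coord θ a π h (residue θ a h P u (φ s)) ≠ 0 := by
      rw [residue, ← hXr]
      exact coord_ofC_ne_zero hS.dual hh ho
    have key : Comp x ν₃ ((coordL π h R).bind fun c =>
        (invL a c₀ c₁ T c).bind fun c => (mulL T c R).bind fun u =>
        (sumL a (fun k => (coordL k h (A s)).bind fun c => mulL T c (V k)) P).bind fun Z =>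
        (constL K I O m a (bas a s)).bind fun b => (pointwise .sub b Z).bind fun Z =>
        (mulL T c Z).bind fun β =>
        (mapArr (fun k => (coordL π h (U k)).bind fun c =>
          (mulL T c u).bind fun X => pointwise .sub (U k) X) P).bind fun U' =>
        (mapArr (fun k => (coordL π h (U k)).bind fun c =>
          (mulL T c β).bind fun X => pointwise .sub (V k) X) P).bind fun V' =>
        Prog.pure (insert π P, Function.update U' π u, Function.update V' π β) : Prog K I O _)
        ((12 * t + 4 + 6 * 2 ^ m) * M)
        fun ν D => D.1 = insert π P ∧ ∃ u' β', π ∉ P ∧ ReduceInv θ a h φ x ν D u' β' ∧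
          (∀ v, InSpan θ a h P u v → InSpan θ a h D.1 u' v) ∧ InSpan θ a h D.1 u' (φ s) := by
      refine ((Comp.coordL hS hh π hR).bind (c' := (9 * t + 4 + 6 * 2 ^ m) * M)
        fun c ξ₁ e₁ hc => ?_).le (by rw [zero_add]; apply Nat.mul_le_mul_right; omega)
      refine ((Comp.invL hS hc hne).bind (c' := (9 * t + 4) * M)
        fun c ξ₂ e₂ hc => ?_).le (by ring_nf; rfl)
      have hR₂ := (hR.ext e₁).ext e₂
      refine ((Comp.mulL hS hc hR₂).bind (c' := (9 * t + 3) * M)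
        fun w ξ₃ e₃ hw => ?_).le (by ring_nf; rfl)
      have e₀₃ := (e₁.trans e₂).trans e₃
      refine ((Comp.sumCoordMul hS hh ht (((hA.ext h₁).ext h₂).ext e₀₃)
        (hV₂.ext e₀₃)).bind (c' := (6 * t + 3) * M) fun Z ξ₄ e₄ hZ => ?_).le (by ring_nf; rfl)
      refine ((Comp.constL hS (bas a s)).bind (c' := (6 * t + 3) * M)
        fun b ξ₅ e₅ hb => ?_).le (by omega)
      refine ((Comp.subL hS hb (hZ.ext e₅)).bind (c' := (6 * t + 1) * M)
        fun Z ξ₆ e₆ hZ => ?_).le (by ring_nf; rfl)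
      have e₂₆ := ((e₃.trans e₄).trans e₅).trans e₆
      refine ((Comp.mulL hS (hc.ext e₂₆) hZ).bind (c' := (6 * t) * M)
        fun γ ξ₇ e₇ hγ => ?_).le (by ring_nf; rfl)
      have e₃₇ := ((e₄.trans e₅).trans e₆).trans e₇
      have e₀₇ := e₀₃.trans e₃₇
      refine ((Comp.subCoordMul hS hh ht (hw.ext e₃₇) (hU₂.ext e₀₇) (hU₂.ext e₀₇)).bind
        (c' := (3 * t) * M) fun U' ξ₈ e₈ hU' => ?_).le (by ring_nf; rfl)
      refine ((Comp.subCoordMul hS hh ht (hγ.ext e₈) (hU₂.ext (e₀₇.trans e₈))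
        (hV₂.ext (e₀₇.trans e₈))).bind (c' := 0) fun V' ξ₉ e₉ hV' => ?_).le (by ring_nf; rfl)
      refine Comp.pure ⟨rfl, ?_⟩
      set u' : BIdx m → L := Function.update (fun k => u k - coord θ a π h (u k) *
        ((coord θ a π h (residue θ a h P u (φ s)))⁻¹ * residue θ a h P u (φ s))) π
        ((coord θ a π h (residue θ a h P u (φ s)))⁻¹ * residue θ a h P u (φ s)) with hu'
      set β' : BIdx m → L := Function.update (fun k => β k - coord θ a π h (u k) *
        ((coord θ a π h (residue θ a h P u (φ s)))⁻¹ *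
          (bas a s - ∑ k ∈ P, coord θ a k h (φ s) * β k))) π
        ((coord θ a π h (residue θ a h P u (φ s)))⁻¹ *
          (bas a s - ∑ k ∈ P, coord θ a k h (φ s) * β k)) with hβ'
      have hπP : π ∉ P := fun hk => hne (hP.coord_residue hS.dual hh _ hk)
      have hkne : ∀ k ∈ P, k ≠ π := by
        rintro k hk rfl
        exact hπP hk
      obtain ⟨h1, h2, h3, h4⟩ := hP.insert hS.dual hh (u' := u') (β' := β') hs
        (mergeBits_mem_low h q) hne (Function.update_self _ _ _) (Function.update_self _ _ _)
        (fun k hk => by rw [hu', Function.update_of_ne (hkne k hk), Function.update_self])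
        (fun k hk => by rw [hβ', Function.update_of_ne (hkne k hk), Function.update_self])
      refine ⟨u', β', hπP, ⟨h2, ?_, ?_⟩, h3, h4⟩
      · intro k hk
        dsimp only at hk ⊢
        rw [Finset.mem_insert] at hk
        rcases hk with rfl | hk
        · rw [Function.update_self, hu', Function.update_self]
          exact (hw.ext e₃₇).ext (e₈.trans e₉)
        · rw [Function.update_of_ne (hkne k hk), hu', Function.update_of_ne (hkne k hk)]
          exact (hU' k hk).ext e₉
      · intro k hk
        dsimp only at hk ⊢
        rw [Finset.mem_insert] at hk
        rcases hk with rfl | hk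
        · rw [Function.update_self, hβ', Function.update_self]
          exact hγ.ext (e₈.trans e₉)
        · rw [Function.update_of_ne (hkne k hk), hβ', Function.update_of_ne (hkne k hk)]
          exact hV' k hk
    refine Yields.mono key ?_
    rintro D ν d hν ⟨⟨hD, u', β', hπP, h1, h2, h3⟩, hd⟩
    refine ⟨u', β', h1, h2, h3, ?_⟩
    rw [hD, Finset.card_insert_of_notMem hπP, Nat.add_mul P.card 1]
    have : (3 * t + 4) * M = t * (3 * M) + 2 * M + 2 * M := by ring
    omega

theorem Yields.reduceList (hh : h ≤ m)
    (hcard : ∀ P u β, PivotSystem θ a h φ P u β → P.card ≤ t) (hA : HasArr a x μ (low m h) A φ)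
    (l : List (BIdx m)) (hl : ∀ s ∈ l, s ∈ low m h)
    {C : Finset (BIdx m) × (BIdx m → BIdx m → I ⊕ ℕ) × (BIdx m → BIdx m → I ⊕ ℕ)}
    (hC : ReduceInv θ a h φ x μ C u β) :
    Yields x (reduceList a c₀ c₁ T h A l C : Prog K I O _) μ fun D ν c => ∃ u' β',
      ReduceInv θ a h φ x ν D u' β' ∧ (∀ v, InSpan θ a h C.1 u v → InSpan θ a h D.1 u' v) ∧
      (∀ s ∈ l, InSpan θ a h D.1 u' (φ s)) ∧ c + C.1.card * ((12 * t + 4 + 6 * 2 ^ m) * M) ≤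
        l.length * ((3 * t + 4) * M) + D.1.card * ((12 * t + 4 + 6 * 2 ^ m) * M) := by
  induction l generalizing μ C u β with
  | nil => exact Yields.pure ⟨u, β, hC, fun v hv => hv, by simp, by simp⟩
  | cons s l ih =>
    refine Yields.bind (Yields.reduceStep hS hh hcard (hl s (by simp)) (hA s (hl s (by simp))) hC) ?_
    rintro D ν c hν ⟨u', β', hD, h1, h2, h3⟩
    refine Yields.mono (ih (hA.ext hν) (fun s hs => hl s (by simp [hs])) hD) ?_
    rintro D' ξ c' hξ ⟨u'', β'', hD', h1', h2', h3'⟩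
    refine ⟨u'', β'', hD', fun v hv => h1' v (h1 v hv), ?_, ?_⟩
    · intro s' hs'
      rcases List.mem_cons.1 hs' with rfl | hs'
      · exact h1' _ h2
      · exact h2' s' hs'
    · have := Nat.add_mul l.length 1 ((3 * t + 4) * M)
      rw [List.length_cons]
      omega

end Prog

end Reduction

/-! ### Correctness and cost of the decoder. -/

section DecoderCorrect

variable {K L : Type*} [Field K] [Field L] [Algebra K L] {m : ℕ}
variable {θ : ℕ → L ≃ₐ[K] L} {a : ℕ → L} {c₀ c₁ : K}
  {T : CompTree K (BIdx m ⊕ BIdx m) (BIdx m)} {M : ℕ} {I O : Type}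

/-- The properties of the received endomorphism `f` and the error `g` that the decoder relies on. -/
structure Decodable (m : ℕ) (θ : ℕ → L ≃ₐ[K] L) (a : ℕ → L) (h t : ℕ) (f g : L → L) : Prop where
  top_eq : ∀ s ∈ low m h, moveParts θ a f m (m - h) (bas a s) = moveParts θ a g m (m - h) (bas a s)
  except_eq : ∀ p, h ≤ p → p < m → ∃ c, ∀ s ∈ low m h,
    Prog.exceptPart θ a m h p f (bas a s) = Prog.exceptPart θ a m h p g (bas a s) + c * bas a s
  card_le : ∀ P u β, PivotSystem θ a h (fun s : BIdx m => moveParts θ a g m (m - h) (bas a s)) P u β →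
    P.card ≤ t
  lt : t < 2 ^ h
  full : ∀ P u β, PivotSystem θ a h (fun s : BIdx m => moveParts θ a g m (m - h) (bas a s)) P u β →
    (∀ s ∈ low m h, InSpan θ a h P u (moveParts θ a g m (m - h) (bas a s))) →
    ∀ p, h ≤ p → p < m →
      (∀ s ∈ low m h, InSpan θ a h P u (Prog.exceptPart θ a m h p g (bas a s))) ∧
      ∀ x, fixPart θ a p (moveParts θ a g m (m - 1 - p)) x =
        ∑ l ∈ P, (∑ s ∈ low m h, θ p (coord θ a s h (β l)) *
          Prog.exceptPart θ a m h p g (bas a s)) * θ p (coord θ a l h (moveParts θ a g m (m - p) x))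

namespace Prog

variable (hS : MulSetting θ a c₀ c₁ T M) {x : I → K} {μ : Mem K}
  {A U V G F : BIdx m → BIdx m → I ⊕ ℕ} {h t : ℕ} {φ u β ψ ψ' : BIdx m → L} {P : Finset (BIdx m)}
  {f g : L → L} {π : BIdx m} {Y Z : BIdx m → I ⊕ ℕ}

include hS

theorem Comp.annihilatorL (hh : h ≤ m) (ht : P.card ≤ t) (hP : P ⊆ low m h) (hπ : π ∈ low m h)
    (hπP : π ∉ P) (hU : HasArr a x μ P U u) :
    Comp x μ (annihilatorL θ a c₀ c₁ T h P U π : Prog K I O _) ((3 * t + 2 + 6 * 2 ^ m) * M)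
      fun ν y => HasElt a x ν y.1 (annihilator θ a h P u π) ∧
        HasElt a x ν y.2 (annihilator θ a h P u π)⁻¹ := by
  refine ((Comp.sumL hS (c := M) (fun k => coord θ a π h (u k) * dualBas θ a k h) P
    fun k hk ν hν => ?_).bind (c' := (2 + 6 * 2 ^ m) * M) fun X ν₁ h₁ hX => ?_).le ?_
  · refine ((Comp.coordL hS hh π ((hU k hk).ext hν)).bind (c' := M) fun c ξ hξ hc => ?_).le
      (by omega)
    exact ((Comp.constL hS _).bind (c' := M) fun d ξ' hξ' hd =>
      Comp.mulL hS (hc.ext hξ') hd).le (by omega)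
  · refine ((Comp.constL hS _).bind (c' := (2 + 6 * 2 ^ m) * M) fun d ν₂ h₂ hd => ?_).le (by omega)
    refine ((Comp.subL hS hd (hX.ext h₂)).bind (c' := 6 * 2 ^ m * M) fun y ν₃ h₃ hy => ?_).le
      (by ring_nf; rfl)
    exact (Comp.invL hS hy (annihilator_ne_zero hS.dual hh hP hπ hπP)).bind (c' := 0)
      fun z ν₄ h₄ hz => Comp.pure ⟨hy.ext h₄, hz⟩
  · nlinarith [Nat.mul_le_mul_right (3 * M) ht]

theorem Comp.correctL (hh : h ≤ m) (hP : P ⊆ low m h) (hπ : π ∈ low m h)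
    (hπP : π ∉ P) (hY : HasElt a x μ Y (annihilator θ a h P u π))
    (hZ : HasElt a x μ Z (annihilator θ a h P u π)⁻¹) (hG : HasArr a x μ (low m h) G ψ) {c : L}
    (hψ : ∀ s ∈ low m h, ψ s = ψ' s + c * bas a s) (hψ' : ∀ s ∈ low m h, InSpan θ a h P u (ψ' s)) :
    Comp x μ (correctL θ a T h Y Z G : Prog K I O _) (2 ^ h * (8 * M)) fun ν G' =>
      HasArr a x ν (low m h) G' ψ' := by
  have h1 : 1 ≤ 2 ^ h := Nat.one_le_two_pow
  refine ((Comp.sumL hS (c := 2 * M) (fun s => topCoord θ a m h (annihilator θ a h P u π * ψ s) *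
    dualBas θ a s h) (low m h) fun s hs ν hν => ?_).bind (c' := M + 2 ^ h * (3 * M))
    fun X ν₁ h₁ hX => ?_).le ?_
  · refine ((Comp.mulL hS (hY.ext hν) ((hG s hs).ext hν)).bind (c' := M) fun X ξ hξ hX => ?_).le
      (by omega)
    refine ((Comp.coordL hS hh (fun _ => 1) hX).bind (c' := M) fun X ξ₁ h₁ hX => ?_).le (by omega)
    exact ((Comp.constL hS _).bind (c' := M) fun d ξ' hξ' hd =>
      Comp.mulL hS (hX.ext hξ') hd).le (by omega)
  · refine (Comp.mulL hS (hZ.ext h₁) hX).bind fun C ν₂ h₂ hC => ?_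
    rw [annihilator_inv_mul_sum hS.dual hh hP hπ hπP hψ hψ'] at hC
    rw [← card_low hh]
    refine Comp.mapArr fun s hs ξ hξ => ?_
    refine ((Comp.constL hS _).bind (c' := 3 * M) fun b ξ₁ e₁ hb => ?_).le (by omega)
    refine ((Comp.mulL hS (hC.ext (hξ.trans e₁)) hb).bind (c' := 2 * M) fun X ξ₂ e₂ hX => ?_).le
      (by omega)
    refine (Comp.subL hS ((hG s hs).ext ((((h₁.trans h₂).trans hξ).trans e₁).trans e₂)) hX).mono
      le_rfl fun _ _ _ hR => hR.congr ?_
    rw [hψ s hs]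
    ring
  · rw [card_low hh]
    nlinarith [Nat.mul_le_mul_right M h1]

/-- The part fixing a_p is obtained from the part moving a_p by the semilinear map in `hf`, whose
values on the reduced basis are tabulated once. Then f(x) is the sum of both parts, and f(a_p x) is
the sum of a_p times the fixing part and θ_p(a_p) times the moving part. -/
theorem Comp.unfoldStep {p : ℕ} (hhp : h ≤ p) (hp : p < m) (ht : P.card ≤ t)
    (hV : HasArr a x μ P V β) (hG : HasArr a x μ (low m h) G ψ)
    (hF : HasArr a x μ (low m p) F fun s => movePart θ a p f (bas a s))
    (hf : ∀ y, fixPart θ a p f y = ∑ l ∈ P, (∑ s ∈ low m h, θ p (coord θ a s h (β l)) * ψ s) *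
      θ p (coord θ a l h (movePart θ a p f y))) :
    Comp x μ (unfoldStep θ a c₀ c₁ T h p P V G F : Prog K I O _) (2 ^ p * ((14 * t + 6) * M))
      fun ν B => HasArr a x ν (low m (p + 1)) B fun s => f (bas a s) := by
  have hh : h ≤ m := hhp.trans hp.le
  have hpow : 2 ^ h ≤ 2 ^ p := Nat.pow_le_pow_right (by norm_num) hhp
  refine ((Comp.mapArr (a := a) (c := 2 ^ h * (7 * M))
    (φ := fun l => ∑ s ∈ low m h, θ p (coord θ a s h (β l)) * ψ s) fun k hk ν hν => ?_).bind
    (c' := 2 ^ p * ((7 * t + 6) * M)) fun W ν₁ h₁ hW => ?_).le ?_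
  · rw [← card_low hh]
    refine (Comp.sumL hS (c := 5 * M) (fun s => θ p (coord θ a s h (β k)) * ψ s) _
      fun s hs ξ hξ => ?_).le (Nat.mul_le_mul_left _ (by omega))
    refine ((Comp.coordL hS hh s ((hV k hk).ext (hν.trans hξ))).bind (c' := 5 * M)
      fun X ξ₁ e₁ hX => ?_).le (by omega)
    refine ((Comp.conjL hS hp hX).bind (c' := M) fun X ξ₂ e₂ hX => ?_).le (by omega)
    exact Comp.mulL hS hX ((hG s hs).ext (((hν.trans hξ).trans e₁).trans e₂))
  · rw [← card_low hp.le]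
    refine ((Comp.mapArr (a := a) (c := t * (7 * M)) (φ := fun s => fixPart θ a p f (bas a s))
      fun s hs ν hν => ?_).bind (c' := (low m p).card * (6 * M)) fun X ν₂ h₂ hX => ?_).le
      (by ring_nf; rfl)
    · refine (Comp.sumL hS (c := 5 * M) (fun l => (∑ s ∈ low m h, θ p (coord θ a s h (β l)) * ψ s) *
        θ p (coord θ a l h (movePart θ a p f (bas a s)))) P fun k hk ξ hξ => ?_).mono
        (Nat.mul_le_mul ht (by omega)) fun _ _ _ hR => hR.congr (hf _).symm
      refine ((Comp.coordL hS hh k ((hF s hs).ext ((h₁.trans hν).trans hξ))).bind (c' := 5 * M)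
        fun X ξ₁ e₁ hX => ?_).le (by omega)
      refine ((Comp.conjL hS hp hX).bind (c' := M) fun X ξ₂ e₂ hX => ?_).le (by omega)
      exact Comp.mulL hS ((hW k hk).ext (((hν.trans hξ).trans e₁).trans e₂)) hX
    · have e₁₂ := h₁.trans h₂
      refine ((Comp.mapArr (a := a) (c := 2 * M) (φ := fun s => f (bas a s)) fun s hs ν hν => ?_).bind
        (c' := (low m p).card * (4 * M)) fun N₀ ν₃ h₃ hN₀ => ?_).le (by ring_nf; rfl)
      · refine (Comp.addL hS ((hX s hs).ext hν) ((hF s hs).ext (e₁₂.trans hν))).mono le_rfl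
          fun _ _ _ hR => hR.congr ?_
        simp [fixPart]
      · refine (Comp.mapArr (a := a) (c := 4 * M) (φ := fun s => f (a p * bas a s)) fun s hs ν hν => ?_).bind
          (c' := 0) fun N₁ ν₄ h₄ hN₁ => Comp.pure ?_
        · have hXs := (hX s hs).ext (h₃.trans hν)
          have hFs := (hF s hs).ext (e₁₂.trans (h₃.trans hν))
          refine ((Comp.constL hS (a p)).bind (c' := 4 * M) fun b ξ₁ e₁ hb => ?_).le (by omega)
          refine ((Comp.mulL hS hb (hXs.ext e₁)).bind (c' := 3 * M) fun B ξ₂ e₂ hB => ?_).le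
            (by omega)
          refine ((Comp.constL hS (θ p (a p))).bind (c' := 3 * M) fun b ξ₃ e₃ hb => ?_).le (by omega)
          refine ((Comp.mulL hS hb (hFs.ext ((e₁.trans e₂).trans e₃))).bind (c' := 2 * M)
            fun B' ξ₄ e₄ hB' => ?_).le (by omega)
          refine (Comp.addL hS (hB.ext (e₃.trans e₄)) hB').mono le_rfl fun _ _ _ hR => hR.congr ?_
          have hm := hS.dual.move p hp
          simp only [fixPart, movePart]
          field_simp
          ring
        · intro s hs
          have h0 := setBit_mem_low hs
          dsimp only
          by_cases hsp : getBit s p = 1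
          · rw [if_pos hsp]
            refine (hN₁ _ h0).congr ?_
            have h2 : setBit (setBit s p 0) p 1 = s := by
              rw [setBit_setBit, ← hsp, setBit_self]
            dsimp only
            rw [← bas_setBit_low hp h0, h2]
          · rw [if_neg hsp]
            have hsp0 : getBit s p = 0 := by omega
            have h2 : setBit s p 0 = s := by rw [← hsp0, setBit_self]
            rw [h2] at h0
            exact (hN₀ _ h0).ext h₄
  · have e1 : P.card * (2 ^ h * (7 * M)) ≤ t * (2 ^ p * (7 * M)) :=
      Nat.mul_le_mul ht (Nat.mul_le_mul_right _ hpow)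
    calc _ ≤ t * (2 ^ p * (7 * M)) + 2 ^ p * ((7 * t + 6) * M) := Nat.add_le_add_right e1 _
      _ = _ := by ring

omit hS in
theorem movePart_moveParts {p : ℕ} (hp : p < m) :
    movePart θ a p (moveParts θ a g m (m - 1 - p)) = moveParts θ a g m (m - p) := by
  rw [show m - p = m - 1 - p + 1 by omega, moveParts, show m - 1 - (m - 1 - p) = p by omega]

theorem Comp.unfoldAll {Gs : ℕ → BIdx m → BIdx m → I ⊕ ℕ} (hh : h ≤ m) (ht : P.card ≤ t) (h1 : 1 ≤ t)
    {t₀ : ℕ} (hD : Decodable m θ a h t₀ f g)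
    (hP : PivotSystem θ a h (fun s : BIdx m => moveParts θ a g m (m - h) (bas a s)) P u β)
    (hspan : ∀ s ∈ low m h, InSpan θ a h P u (moveParts θ a g m (m - h) (bas a s)))
    (hπ : π ∈ low m h) (hπP : π ∉ P) (hV : HasArr a x μ P V β)
    (hY : HasElt a x μ Y (annihilator θ a h P u π))
    (hZ : HasElt a x μ Z (annihilator θ a h P u π)⁻¹)
    (hG : ∀ p, h ≤ p → p < m → HasArr a x μ (low m h) (Gs p) fun s =>
      exceptPart θ a m h p f (bas a s))
    (hF : HasArr a x μ (low m h) F fun s => moveParts θ a g m (m - h) (bas a s)) :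
    Comp x μ (unfoldAll θ a c₀ c₁ T h P V Y Z Gs F : Prog K I O _) (2 ^ m * (28 * t * M))
      fun ν B => HasArr a x ν Finset.univ B fun s => g (bas a s) := by
  refine (Comp.iter (c := fun i => 2 ^ (h + i) * (28 * t * M)) (J := fun i ν B =>
    HasArr a x ν (low m (h + i)) B fun s => moveParts θ a g m (m - (h + i)) (bas a s)) hF ?_).mono
    ?_ ?_
  · intro i hi ν B hν hB
    obtain ⟨c, hc⟩ := hD.except_eq (h + i) (by omega) (by omega)
    obtain ⟨hs1, hs2⟩ := hD.full P u β hP hspan (h + i) (by omega) (by omega)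
    have hpow : 2 ^ h ≤ 2 ^ (h + i) := Nat.pow_le_pow_right (by norm_num) (by omega)
    refine ((Comp.correctL hS hh hP.subset hπ hπP (hY.ext hν) (hZ.ext hν)
      ((hG _ (by omega) (by omega)).ext hν) hc hs1).bind (c' := 2 ^ (h + i) * ((14 * t + 6) * M))
      fun G' ν₁ h₁ hG' => ?_).le ?_
    · have hB' := hB.ext h₁
      rw [← movePart_moveParts (by omega)] at hs2 hB'
      have := Comp.unfoldStep (O := O) hS (f := moveParts θ a g m (m - 1 - (h + i)))
        (by omega : h ≤ h + i) (by omega) ht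
        ((hV.ext hν).ext h₁) hG' hB' hs2
      rwa [show m - 1 - (h + i) = m - (h + (i + 1)) by omega] at this
    · calc _ ≤ 2 ^ (h + i) * (8 * M) + 2 ^ (h + i) * ((14 * t + 6) * M) :=
            Nat.add_le_add_right (Nat.mul_le_mul_right _ hpow) _
        _ = 2 ^ (h + i) * ((14 * t + 14) * M) := by ring
        -- Here 14t + 14 ≤ 28t because 1 ≤ t; the decoder therefore passes `max t 1`.
        _ ≤ _ := Nat.mul_le_mul_left _ (Nat.mul_le_mul_right _ (by omega))
  · rw [← Finset.sum_mul]
    refine Nat.mul_le_mul_right _ ?_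
    have key : ∀ n, ∑ i ∈ Finset.range n, 2 ^ (h + i) + 2 ^ h = 2 ^ (h + n) := by
      intro n
      induction n with
      | zero => simp
      | succ n ih =>
        rw [Finset.sum_range_succ, ← Nat.add_assoc h n 1, pow_succ, ← ih]
        omega
    have := key (m - h)
    rw [show h + (m - h) = m by omega] at this
    exact this ▸ Nat.le_add_right _ _
  · intro ν B _ hB
    rw [show h + (m - h) = m by omega, low_top, Nat.sub_self] at hB
    exact hB

theorem Comp.decode (hh : h ≤ m) (hD : Decodable m θ a h t f g)
    (hA : HasArr a x μ Finset.univ A fun s => f (bas a s)) :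
    Comp x μ (decode θ a c₀ c₁ T h A : Prog K I O _) (80 * (max t 1) * 2 ^ m * M)
      fun ν B => HasArr a x ν Finset.univ B fun s => f (bas a s) - g (bas a s) := by
  have hpow : 2 ^ h ≤ 2 ^ m := Nat.pow_le_pow_right (by norm_num) hh
  have htm := hD.lt.trans_le hpow
  refine Yields.bind (Comp.foldAll hS hh hA) ?_
  rintro G ν₁ d₁ h₁ ⟨⟨hF, hG⟩, hd₁⟩
  replace hF : HasArr a x ν₁ (low m h) G.1 fun s => moveParts θ a g m (m - h) (bas a s) :=
    fun s hs => (hF s hs).congr (hD.top_eq s hs)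
  refine Yields.bind (Yields.reduceList hS (C := (∅, A, A)) (u := fun _ => 0) (β := fun _ => 0) hh
    hD.card_le hF (low m h).toList (fun s hs => Finset.mem_toList.1 hs)
    ⟨PivotSystem.empty, fun s hs => by simp at hs, fun s hs => by simp at hs⟩) ?_
  rintro ⟨P, U, V⟩ ν₂ d₂ h₂ ⟨u, β, ⟨hP, hU, hV⟩, -, hspan, hd₂⟩
  dsimp only at hP hU hV hspan hd₂ ⊢
  have ht := hD.card_le P u β hP
  replace hspan : ∀ s ∈ low m h, InSpan θ a h P u (moveParts θ a g m (m - h) (bas a s)) :=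
    fun s hs => hspan s (Finset.mem_toList.2 hs)
  -- There are at most t < 2^h pivots, so some index is free; the chosen one depends only on the
  -- pivot set, which is known in each branch of the tree.
  have hπ : ∃ π, π ∈ low m h ∧ π ∉ P := by
    by_contra! hc
    exact absurd (Finset.card_le_card hc) (by rw [card_low hh]; exact not_le.2 (ht.trans_lt hD.lt))
  replace hπ := Classical.epsilon_spec hπ
  refine Yields.bind (Comp.annihilatorL hS hh ht hP.subset hπ.1 hπ.2 hU) ?_
  rintro y ν₃ d₃ h₃ ⟨⟨hy, hz⟩, hd₃⟩
  refine Yields.bind (Comp.unfoldAll hS hh (ht.trans (le_max_left t 1)) (le_max_right t 1) hD hP hspan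
    hπ.1 hπ.2 (hV.ext h₃) hy hz (fun p hp hp' => (hG p hp hp').ext (h₂.trans h₃))
    (hF.ext (h₂.trans h₃))) ?_
  rintro E ν₄ d₄ h₄ ⟨hE, hd₄⟩
  refine Yields.mono (Comp.mapArr fun s hs ξ hξ => Comp.subL hS
    ((hA s hs).ext ((((h₁.trans h₂).trans h₃).trans h₄).trans hξ)) ((hE s hs).ext hξ)) ?_
  rintro B ξ d₅ _ ⟨hB, hd₅⟩
  refine ⟨hB, ?_⟩
  simp only [Finset.card_empty, zero_mul, add_zero, Finset.length_toList, card_low hh] at hd₂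
  have hc : (Finset.univ : Finset (BIdx m)).card = 2 ^ m := by simp
  rw [hc] at hd₅
  have e₁ : 2 ^ h * ((3 * t + 4) * M) ≤ 2 ^ m * ((3 * t + 4) * M) := Nat.mul_le_mul_right _ hpow
  have e₂ : P.card * ((12 * t + 4 + 6 * 2 ^ m) * M) ≤ t * ((12 * t + 4 + 6 * 2 ^ m) * M) :=
    Nat.mul_le_mul_right _ ht
  have hT := le_max_left t 1
  have hT' := le_max_right t 1
  generalize max t 1 = S at *
  generalize 2 ^ m = N at *
  have b₁ : N ≤ N * S := Nat.le_mul_of_pos_right _ hT'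
  have b₂ : t * N ≤ N * S := by rw [mul_comm]; exact Nat.mul_le_mul_left _ hT
  -- The quadratic term comes from updating all pivots at each new pivot; it is harmless since t <
  -- 2^m.
  have b₃ : t * t ≤ N * S := Nat.mul_le_mul htm.le hT
  have b₄ : N * t ≤ N * S := Nat.mul_le_mul_left _ hT
  have b₅ : 10 * N + N * (3 * t + 4) + t * (12 * t + 4 + 6 * N) + (3 * t + 2 + 6 * N) +
      N * (28 * S) + N * 2 ≤ 80 * S * N := by
    have : 10 * N + N * (3 * t + 4) + t * (12 * t + 4 + 6 * N) + (3 * t + 2 + 6 * N) +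
      N * (28 * S) + N * 2 = 22 * N + 3 * (N * t) + 12 * (t * t) + 6 * (t * N) + 7 * t + 2 +
      28 * (N * S) := by ring
    rw [this, mul_assoc, mul_comm S N]
    omega
  have b₆ := Nat.mul_le_mul_right M b₅
  have b₇ : (10 * N + N * (3 * t + 4) + t * (12 * t + 4 + 6 * N) + (3 * t + 2 + 6 * N) +
      N * (28 * S) + N * 2) * M = 10 * N * M + N * ((3 * t + 4) * M) +
      t * ((12 * t + 4 + 6 * N) * M) + (3 * t + 2 + 6 * N) * M + N * (28 * S * M) + N * (2 * M) := by
    ring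
  omega

end Prog

end DecoderCorrect

/-! ### Upper and lower bounds for the cost of multiplication in L. -/

section MultiplicationCost

/-- The computation on the input `x` reads at most two inputs per operation; changing the others
affects the outcome only where an input is copied. -/
theorem CompTree.exec_agree {K I O : Type*} [Field K] (T : CompTree K I O) {x : I → K} {w : ℕ → K}
    {z : O → K} {c : ℕ} (h : T.exec x w = some (z, c)) :
    ∃ (U : Finset I) (f : O → Option I), U.card ≤ 2 * c ∧
      ∀ x', (∀ i ∈ U, x' i = x i) → T.exec x' w = some (fun o => (f o).elim (z o) x', c) := by
  classical
  let reads : I ⊕ ℕ → Finset I := fun a => Sum.elim (fun i => {i}) (fun _ => ∅) a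
  have hr1 : ∀ a, (reads a).card ≤ 1 := by rintro (i | d) <;> simp [reads]
  have hr2 : ∀ (w : ℕ → K) a x', (∀ i ∈ reads a, x' i = x i) → Sum.elim x' w a = Sum.elim x w a := by
    rintro w (i | d) x' h
    · exact h i (by simp [reads])
    · rfl
  induction T generalizing w z c with
  | output out =>
    simp only [CompTree.exec, Option.some.injEq, Prod.mk.injEq] at h
    obtain ⟨rfl, rfl⟩ := h
    refine ⟨∅, fun o => Sum.elim some (fun _ => none) (out o), by simp, fun x' _ => ?_⟩
    simp only [CompTree.exec, Option.some.injEq, Prod.mk.injEq, and_true]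
    funext o
    cases out o <;> rfl
  | const d v next ih => exact ih h
  | arith op d a b next ih =>
    simp only [CompTree.exec, Option.bind_eq_some_iff, Option.map_eq_some_iff] at h
    obtain ⟨v, hv, ⟨z', c₀⟩, hs, he⟩ := h
    simp only [Prod.mk.injEq] at he
    obtain ⟨rfl, rfl⟩ := he
    obtain ⟨U, f, hU, hf⟩ := ih hs
    refine ⟨U ∪ (reads a ∪ reads b), f, ?_, fun x' hx' => ?_⟩
    · have h1 := Finset.card_union_le U (reads a ∪ reads b)
      have h2 := Finset.card_union_le (reads a) (reads b)
      have := hr1 a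
      have := hr1 b
      omega
    · rw [CompTree.exec, hr2 w a x' fun i hi => hx' i (by simp [hi]),
        hr2 w b x' fun i hi => hx' i (by simp [hi]), hv, Option.bind_some,
        hf x' fun i hi => hx' i (by simp [hi])]
      rfl
  | test a p q ihp ihq =>
    simp only [CompTree.exec, Option.map_eq_some_iff] at h
    obtain ⟨⟨z', c₀⟩, hs, he⟩ := h
    simp only [Prod.mk.injEq] at he
    obtain ⟨rfl, rfl⟩ := he
    have key : ∃ (U : Finset I) (f : O → Option I), U.card ≤ 2 * c₀ ∧
        ∀ x', (∀ i ∈ U, x' i = x i) → (if Sum.elim x w a = 0 then p.exec x' w else q.exec x' w) =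
          some (fun o => (f o).elim (z' o) x', c₀) := by
      split_ifs at hs ⊢
      exacts [ihp hs, ihq hs]
    obtain ⟨U, f, hU, hf⟩ := key
    refine ⟨U ∪ reads a, f, ?_, fun x' hx' => ?_⟩
    · have h1 := Finset.card_union_le U (reads a)
      have := hr1 a
      omega
    · rw [CompTree.exec, hr2 w a x' fun i hi => hx' i (by simp [hi]),
        hf x' fun i hi => hx' i (by simp [hi])]
      rfl

variable {K L : Type*} [Field K] [Field L] [Algebra K L] {m : ℕ}
variable {θ : ℕ → L ≃ₐ[K] L} {a : ℕ → L} {c₀ c₁ : K}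

open Prog in
-- Schoolbook multiplication with structure constants; it shows that the infimum defining `mulCost`
-- is over a nonempty set and hence attained.
theorem exists_mul_tree (hsurj : Function.Surjective (ofC a : (BIdx m → K) → L)) :
    ∃ (c : ℕ) (T : CompTree K (BIdx m ⊕ BIdx m) (BIdx m)), ∀ X Y : BIdx m → K, ∃ Z c',
      T.run (Sum.elim X Y) = some (Z, c') ∧ c' ≤ c ∧ ofC a Z = ofC a X * ofC a Y := by
  let κ : BIdx m × BIdx m → BIdx m → K := fun p =>
    Function.invFun (ofC a : (BIdx m → K) → L) (bas a p.1 * bas a p.2)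
  have hκ : ∀ p, ofC a (κ p) = bas a p.1 * bas a p.2 := fun p =>
    Function.rightInverse_invFun hsurj _
  let prog : Prog K (BIdx m ⊕ BIdx m) (BIdx m) (BIdx m → (BIdx m ⊕ BIdx m) ⊕ ℕ) :=
    mapList (fun o => sumList (const 0) (arith .add) (fun p : BIdx m × BIdx m =>
      (const (κ p o)).bind fun k => (arith .mul (.inl (.inl p.1)) (.inl (.inr p.2))).bind fun r =>
        arith .mul k r) Finset.univ.toList) Finset.univ.toList
  refine ⟨2 ^ m * ((Finset.univ : Finset (BIdx m × BIdx m)).toList.length * (2 + 1)), toTree prog,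
    fun X Y => ?_⟩
  have h1 : Comp (Sum.elim X Y) ⟨0, fun _ => 0⟩ prog
      (2 ^ m * ((Finset.univ : Finset (BIdx m × BIdx m)).toList.length * (2 + 1))) fun ν g => ∀ o, ν.Holds (Sum.elim X Y) (g o)
      (∑ p : BIdx m × BIdx m, κ p o * (X p.1 * Y p.2)) := by
    refine Comp.mapUniv (R := fun o ν r => ν.Holds (Sum.elim X Y) r
      (∑ p : BIdx m × BIdx m, κ p o * (X p.1 * Y p.2))) (fun _ _ _ _ h h' => h'.ext h) ?_
    intro o ν _
    refine (Comp.sumList (c := 2) (d := 1) (R := Mem.Holds (Sum.elim X Y))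
      (fun _ _ _ _ h h' => h'.ext h)
      (fun _ => Comp.const 0) (fun _ _ _ _ _ h h' => Comp.arith h h' rfl)
      (fun p => κ p o * (X p.1 * Y p.2)) Finset.univ.toList fun p _ ξ _ => ?_).mono le_rfl ?_
    · refine (Comp.bind (c' := 2) (Comp.const (κ p o)) fun k ξ₁ _ hk => ?_).le (by simp)
      refine Comp.bind (c := 1) (c' := 1) (R := fun ν r => ν.Holds (Sum.elim X Y) r (X p.1 * Y p.2))
        (Comp.arith (u := X p.1) (v := Y p.2) ⟨fun d hd => by simp at hd, rfl⟩
        ⟨fun d hd => by simp at hd, rfl⟩ rfl) fun r ξ₂ h₂ hr => Comp.arith (hk.ext h₂) hr rfl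
    · intro ν r _ h
      rwa [Finset.sum_map_toList] at h
  obtain ⟨c', hc', h2⟩ := Comp.run_toTree h1
  refine ⟨_, c', h2, hc', ?_⟩
  have h3 : (fun o => ∑ p : BIdx m × BIdx m, κ p o * (X p.1 * Y p.2)) =
      ∑ p : BIdx m × BIdx m, (X p.1 * Y p.2) • κ p := by
    funext o
    simp [Finset.sum_apply, mul_comm]
  have h4 : ∀ S : Finset (BIdx m × BIdx m), ofC a (∑ p ∈ S, (X p.1 * Y p.2) • κ p) =
      ∑ p ∈ S, (X p.1 * Y p.2) • (bas a p.1 * bas a p.2) := by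
    classical
    intro S
    induction S using Finset.induction_on with
    | empty => simp [ofC_zero]
    | insert p S hp ih => rw [Finset.sum_insert hp, Finset.sum_insert hp, ofC_add, ih, ofC_smul, hκ]
  rw [h3, h4, ofC_eq, ofC_eq, Finset.sum_mul_sum, ← Finset.univ_product_univ, Finset.sum_product]
  refine Finset.sum_congr rfl fun s _ => Finset.sum_congr rfl fun t _ => ?_
  rw [smul_mul_smul_comm]

section LowerBound

variable {T : CompTree K (BIdx m ⊕ BIdx m) (BIdx m)} {M : ℕ} (hθ : DualGenerators m θ a)
  (hmul : ∀ X Y : BIdx m → K, ∃ Z c', T.run (Sum.elim X Y) = some (Z, c') ∧ c' ≤ M ∧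
    ofC a Z = ofC a X * ofC a Y)
include hθ hmul

/-- Without any operation, an output is a constant or a copy of an input, and the product of two
scalars is neither. -/
theorem one_le_of_mul_tree : 1 ≤ M := by
  by_contra! hM
  obtain rfl : M = 0 := by omega
  have key : ∀ u v : K, ∃ c, T.run (Sum.elim (Pi.single 0 u) (Pi.single 0 v)) =
      some (Pi.single 0 (u * v), c) := by
    intro u v
    obtain ⟨Z, c, h1, h2, h3⟩ := hmul (Pi.single 0 u) (Pi.single 0 v)
    refine ⟨c, ?_⟩
    obtain rfl : Z = Pi.single 0 (u * v) := by
      refine ofC_injective hθ (h3.trans ?_)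
      rw [ofC_single, ofC_single, ofC_single, bas_zero, smul_mul_smul_comm, mul_one]
    exact h1
  obtain ⟨Z, c, h1, h2, -⟩ := hmul 0 0
  obtain ⟨U, f, hU, hf⟩ := T.exec_agree h1
  have hU0 : U = ∅ := by
    rw [← Finset.card_eq_zero]
    omega
  have key' : ∀ u v : K, u * v = (f 0).elim (Z 0) (Sum.elim (Pi.single 0 u) (Pi.single 0 v)) := by
    intro u v
    obtain ⟨c', h⟩ := key u v
    have h' := hf (Sum.elim (Pi.single 0 u) (Pi.single 0 v)) (by simp [hU0])
    rw [CompTree.run, h'] at h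
    have := congrFun (congrArg Prod.fst (Option.some.inj h)) 0
    simpa using this.symm
  have h11 := key' 1 1
  have h10 := key' 1 0
  have h01 := key' 0 1
  cases hf0 : f 0 with
  | none =>
    rw [hf0] at h11 h10
    exact one_ne_zero (α := K) ((mul_one (1 : K)).symm.trans (h11.trans (h10.symm.trans (mul_zero 1))))
  | some i =>
    rcases i with i | i
    · rw [hf0] at h11 h10
      exact one_ne_zero (α := K) ((mul_one (1 : K)).symm.trans (h11.trans (h10.symm.trans (mul_zero 1))))
    · rw [hf0] at h11 h01
      exact one_ne_zero (α := K) ((mul_one (1 : K)).symm.trans (h11.trans (h01.symm.trans (zero_mul 1))))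

/-- If fewer than 2^m inputs are read when multiplying 0 by l, some coordinate i of the left factor
is not among them. Changing it to 1 leaves the path unchanged, so output i is an unchanged 0 or a
copied entry of the left factor, in any case 0 or 1. But the new product has l there. -/
theorem two_pow_le_of_ne {l : K} (h0 : l ≠ 0) (h1 : l ≠ 1) : 2 ^ m ≤ 2 * M := by
  obtain ⟨Z, c, hrun, hc, hZ⟩ := hmul 0 (Pi.single 0 l)
  rw [ofC_zero, zero_mul, ← ofC_zero (K := K) (m := m) (a := a)] at hZ
  obtain rfl := ofC_injective hθ hZ
  obtain ⟨U, f, hU, hf⟩ := T.exec_agree hrun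
  by_contra! hM
  have hlt : U.card < (Finset.univ : Finset (BIdx m)).card := by simp; omega
  obtain ⟨i, hi⟩ : ∃ i : BIdx m, Sum.inl i ∉ U := by
    by_contra! h
    have : (Finset.univ.map ⟨Sum.inl, Sum.inl_injective⟩ : Finset (BIdx m ⊕ BIdx m)) ⊆ U := by
      intro j hj
      obtain ⟨k, -, rfl⟩ := Finset.mem_map.1 hj
      exact h k
    have := Finset.card_le_card this
    rw [Finset.card_map] at this
    omega
  obtain ⟨Z', c', hrun', -, hZ'⟩ := hmul (Pi.single i 1) (Pi.single 0 l)
  have e1 : Z' = Pi.single i l := by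
    refine ofC_injective hθ (hZ'.trans ?_)
    rw [ofC_single, ofC_single, ofC_single, bas_zero, smul_mul_smul_comm, mul_one, one_mul]
  have e2 := hf (Sum.elim (Pi.single i 1) (Pi.single 0 l)) (by
    rintro (j | j) hj
    · have : j ≠ i := by rintro rfl; exact hi hj
      simp [this]
    · rfl)
  have e3 := hf (Sum.elim 0 (Pi.single 0 l)) (fun _ _ => rfl)
  rw [CompTree.run] at hrun hrun'
  rw [hrun'] at e2
  rw [hrun] at e3
  have e4 := congrFun (congrArg Prod.fst (Option.some.inj e2)) i
  have e5 := congrFun (congrArg Prod.fst (Option.some.inj e3)) i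
  simp only [e1, Pi.single_eq_same] at e4
  cases hfi : f i with
  | none => simp [hfi] at e4; exact h0 e4
  | some j =>
    simp only [hfi] at e4 e5
    rcases j with j | j
    · by_cases hj : j = i
      · subst hj
        simp at e4
        exact h1 e4
      · simp [hj] at e4
        exact h0 e4
    · exact h0 (e4.trans e5.symm)

/-- The preceding argument needs a third element of `K`. If there is none, then m ≤ 1, as a field
with two elements has only one quadratic extension, and one operation is enough for the bound. -/
theorem two_pow_le_two_mul (hsurj : Function.Surjective (ofC a : (BIdx m → K) → L))
    (hconj : ∀ p < m, θ p (a p) = algebraMap K L c₀ + algebraMap K L c₁ * a p) :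
    2 ^ m ≤ 2 * M := by
  by_cases hl : ∃ l : K, l ≠ 0 ∧ l ≠ 1
  · obtain ⟨l, h0, h1⟩ := hl
    exact two_pow_le_of_ne hθ hmul h0 h1
  push Not at hl
  have hM := one_le_of_mul_tree hθ hmul
  suffices hm : m ≤ 1 by
    calc 2 ^ m ≤ 2 ^ 1 := Nat.pow_le_pow_right (by norm_num) hm
      _ ≤ 2 * M := by omega
  by_contra! hm
  have hK : ∀ k : K, k = 0 ∨ k = 1 := fun k => or_iff_not_imp_left.2 (hl k)
  have h2 : (2 : L) = 0 := by
    have : (2 : K) = 0 := by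
      rcases hK 2 with h | h
      · exact h
      · exact absurd (by linear_combination h : (1 : K) = 0) one_ne_zero
    rw [← map_ofNat (algebraMap K L) 2, this, map_zero]
  have hc : ∀ p < m, θ p (a p) = 1 + a p := by
    intro p hp
    have hm := hθ.move p hp
    have hcp := hconj p hp
    have hi := hθ.invol p (a p)
    rw [hcp] at hm hi
    rcases hK c₁ with h | h <;> rcases hK c₀ with h' | h'
    · simp only [h, h', map_zero] at hi hm; simp at hi hm; exact absurd hi.symm hm
    · simp only [h, h', map_zero, map_one] at hi hm; simp at hi hm; rw [← hi] at hm; simp at hm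
    · simp [h, h'] at hm
    · rw [hcp, h, h', map_one, one_mul]
  have hs : ∀ p < m, a p ^ 2 + a p = 1 := by
    intro p hp
    have hx : FixedBelow θ m (a p ^ 2 + a p) := by
      intro i hi
      by_cases hip : i = p
      · subst hip
        rw [map_add, map_pow, hc i hi]
        linear_combination (1 + a i) * h2
      · rw [map_add, map_pow, hθ.fix i p hip]
    obtain ⟨c, hc'⟩ := exists_algebraMap_eq hθ hsurj hx
    rw [ofC_single, bas_zero] at hc'
    rcases hK c with rfl | rfl
    · have h : a p * (a p + 1) = 0 := by rw [zero_smul] at hc'; linear_combination hc'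
      have hcp := hc p hp
      rcases mul_eq_zero.1 h with h | h
      · rw [h] at hcp
        simp at hcp
      · rw [eq_neg_of_add_eq_zero_left h] at hcp
        simp at hcp
    · rw [hc', one_smul]
  -- Both generators solve x² + x = 1, so their sum is 0 or 1, although θ_0 moves it.
  have h3 : (a 0 + a 1) * (a 0 + a 1 + 1) = 0 := by
    linear_combination hs 0 (by omega) + hs 1 (by omega) + (a 0 * a 1 + 1) * h2
  have h4 : θ 0 (a 0 + a 1) = 1 + (a 0 + a 1) := by
    rw [map_add, hc 0 (by omega), hθ.fix 0 1 (by omega)]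
    ring
  rcases mul_eq_zero.1 h3 with h | h
  · rw [h] at h4
    simp at h4
  · rw [eq_neg_of_add_eq_zero_left h] at h4
    simp at h4

end LowerBound

end MultiplicationCost

/-! ### Errors that satisfy the folding assumption. -/

section DecodableErrors

variable {K L : Type*} [Field K] [Field L] [Algebra K L] {m : ℕ}
variable {θ : ℕ → L ≃ₐ[K] L} {a : ℕ → L}

theorem moveParts_moveParts (f : L → L) (p i j : ℕ) :
    moveParts θ a (moveParts θ a f p i) (p - i) j = moveParts θ a f p (i + j) := by
  induction j with
  | zero => rfl
  | succ j ih => rw [moveParts, ih, ← add_assoc, moveParts, show p - i - 1 - j = p - 1 - (i + j) by omega]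

namespace Prog

theorem exceptPart_add (h p : ℕ) (f g : L → L) : exceptPart θ a m h p (fun x => f x + g x) =
    fun x => exceptPart θ a m h p f x + exceptPart θ a m h p g x := by
  rw [exceptPart, moveParts_add, fixPart_add, moveParts_add]
  rfl

/-- An endomorphism whose values are fixed by the `θ_p` is sent by `exceptPart` to a conjugate of
its part that moves all `a_q`, `h ≤ q`. -/
theorem exceptPart_sum {ι : Type*} (hθ : DualGenerators m θ a) {h p : ℕ} (hh : h ≤ p) (hp : p < m)
    {f : ι → L → L} (hf : ∀ j x, FixedBelow θ m (f j x)) (S : Finset ι) (w : ι → L) (x : L) :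
    exceptPart θ a m h p (fun x => ∑ j ∈ S, w j * f j x) x =
      ∑ j ∈ S, w j * θ p (moveParts θ a (f j) m (m - h) x) := by
  rw [exceptPart, moveParts_sum, fixPart_sum, moveParts_sum]
  refine Finset.sum_congr rfl fun j _ => ?_
  have h1 : fixPart θ a p (moveParts θ a (f j) m (m - 1 - p)) =
      fun y => θ p (moveParts θ a (f j) m (m - p) y) := by
    funext y
    rw [fixPart_eq hθ hp, movePart_moveParts hp]
    exact fun y => moveParts_fixed hθ (hf j) (by omega) y p (by omega)
  rw [h1, ← map_moveParts hθ le_rfl _ (by omega : p - h ≤ p)]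
  have h2 := moveParts_moveParts (θ := θ) (a := a) (f j) m (m - p) (p - h)
  rw [show m - (m - p) = p by omega, show m - p + (p - h) = m - h by omega] at h2
  rw [h2]

end Prog

/-- Errors of rank `t` that satisfy the folding assumption can be corrected. -/
theorem Decodable.of_foldings (hθ : DualGenerators m θ a) (ha : ∀ i, a i ≠ 0) {h r t : ℕ}
    (hm : m = h + r + 1) (ht : t < 2 ^ h) {w : Fin t → L} {F : Fin t → L → L}
    (hF : ∀ j x, FixedBelow θ m (F j x)) {E : Matrix (BIdx m) (BIdx m) L}
    (hE : ∀ q s, E q s = coord θ a q m (∑ j, w j * F j (bas a s)))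
    (hr : FoldingsHaveRank t (r + 1) m (fun i => a i) E) {e : L → L}
    (he : ∀ s ∈ low m h, moveParts θ a e m (m - h) (bas a s) = 0)
    (he' : ∀ p, h ≤ p → p < m → ∃ c, ∀ s ∈ low m h,
      Prog.exceptPart θ a m h p e (bas a s) = c * bas a s) :
    Decodable m θ a h t (fun x => e x + ∑ j, w j * F j x) (fun x => ∑ j, w j * F j x) := by
  have hh : h ≤ m := by omega
  have hG : ∀ j s, FixedBelow θ h (moveParts θ a (F j) m (m - h) (bas a s : L)) := fun j s => by
    have := moveParts_fixed hθ (hF j) (by omega : m - h ≤ m) (bas a (s : BIdx m))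
    rwa [show m - (m - h) = h by omega] at this
  have hφ : ∀ s ∈ low m h, moveParts θ a (fun x => ∑ j, w j * F j x) m (m - h) (bas a s) =
      ∑ j, w j * moveParts θ a (F j) m (m - h) (bas a s) := fun s _ => by rw [moveParts_sum]
  have hcard : ∀ P u β, PivotSystem θ a h (fun s : BIdx m =>
      moveParts θ a (fun x => ∑ j, w j * F j x) m (m - h) (bas a s)) P u β → P.card ≤ t := by
    intro P u β hP
    simpa using hP.card_le hG hφ hθ hh
  refine ⟨?_, ?_, hcard, ht, ?_⟩
  · intro s hs
    rw [moveParts_add]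
    dsimp only
    rw [he s hs, zero_add]
  · intro p hp hp'
    obtain ⟨c, hc⟩ := he' p hp hp'
    refine ⟨c, fun s hs => ?_⟩
    rw [Prog.exceptPart_add]
    dsimp only
    rw [hc s hs, add_comm]
  · intro P u β hP hspan p hp hp'
    -- There are at most `t` pivots because the columns are combinations of the `w j`, and at least
    -- `t` because of the rank of the last folding. This is where the folding assumption enters.
    have hPt : P.card = Fintype.card (Fin t) := by
      rw [Fintype.card_fin]
      refine le_antisymm (hcard P u β hP) (le_card_of_foldingsHaveRank hθ ha hm
        (u := u) (f := fun x => ∑ j, w j * F j x) hE hr ?_)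
      rwa [show m - h = r + 1 by omega] at hspan
    have hφ' : ∀ s ∈ low m h, Prog.exceptPart θ a m h p (fun x => ∑ j, w j * F j x) (bas a s) =
        ∑ j, w j * θ p (moveParts θ a (F j) m (m - h) (bas a s)) :=
      fun s _ => Prog.exceptPart_sum hθ hp hp' hF _ _ _
    refine ⟨fun s hs => ?_, fun x => ?_⟩
    · rw [hφ' s hs]
      refine hP.inSpan_of_card hG hφ hθ hh hPt fun j i hi => ?_
      rw [hθ.comm, hG j s i hi]
    · rw [moveParts_sum, fixPart_sum, moveParts_sum]
      dsimp only
      have hc : ∀ j, FixedBelow θ h (moveParts θ a (F j) m (m - p) x) := fun j => by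
        have := moveParts_fixed hθ (hF j) (by omega : m - p ≤ m) x
        rw [show m - (m - p) = p by omega] at this
        exact this.mono hp
      rw [← hP.sum_conj hG hφ hθ hh hPt p hc hφ']
      refine Finset.sum_congr rfl fun j _ => ?_
      rw [fixPart_eq hθ hp', Prog.movePart_moveParts hp']
      exact fun y => moveParts_fixed hθ (hF j) (by omega) y p (by omega)

end DecodableErrors

/-! ### The Galois group, its weights, and the parts of codewords. -/

section GaloisGroup

variable {K L : Type*} [Field K] [Field L] [Algebra K L] {m : ℕ}

/-- The generators `θ_i`, extended by `1`. -/
noncomputable def galGen (e : Multiplicative (Fin m → ZMod 2) ≃* (L ≃ₐ[K] L)) (i : ℕ) : L ≃ₐ[K] L :=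
  if h : i < m then theta e ⟨i, h⟩ else 1

/-- The elements `α_i`, extended by `1`. -/
def fieldGen (α : Fin m → L) (i : ℕ) : L := if h : i < m then α ⟨i, h⟩ else 1

theorem fieldGen_coe (α : Fin m → L) : (fun i : Fin m => fieldGen α i) = α := by
  funext i
  simp [fieldGen]

theorem ofC_fieldGen (α : Fin m → L) (X : BIdx m → K) : ofC (fieldGen α) X = ofCoords α X := by
  rw [ofC, fieldGen_coe]

theorem bas_fieldGen (α : Fin m → L) (s : BIdx m) : bas (fieldGen α) s = basisElt α s := by
  rw [bas, fieldGen_coe]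

variable {e : Multiplicative (Fin m → ZMod 2) ≃* (L ≃ₐ[K] L)} {α : Fin m → L}

theorem galGen_conj (hα : AdaptedGenerators e α) {p : ℕ} (hp : p < m) :
    galGen e p (fieldGen α p) = algebraMap K L (if ringChar K = 2 then 1 else 0) +
      algebraMap K L (if ringChar K = 2 then 1 else -1) * fieldGen α p := by
  have h := hα.2 ⟨p, hp⟩ ⟨p, hp⟩
  rw [if_pos rfl] at h
  simp only [galGen, fieldGen, dif_pos hp, h]
  split_ifs <;> simp [add_comm]

theorem fieldGen_ne_zero (hα : AdaptedGenerators e α) (i : ℕ) : fieldGen α i ≠ 0 := by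
  rw [fieldGen]
  split_ifs with h
  exacts [hα.1 _, one_ne_zero]

theorem dualGenerators (hα : AdaptedGenerators e α) :
    DualGenerators m (galGen e) (fieldGen α) where
  comm i j x := by
    simp only [galGen]
    split_ifs
    · rw [← AlgEquiv.mul_apply, ← AlgEquiv.mul_apply, theta, theta, ← map_mul, mul_comm, map_mul]
    all_goals rfl
  invol i x := by
    simp only [galGen]
    split_ifs
    · have h2 : ∀ v : Fin m → ZMod 2, v + v = 0 := fun v => funext fun _ => CharTwo.add_self_eq_zero _
      rw [← AlgEquiv.mul_apply, theta, ← map_mul, ← ofAdd_add, h2, ofAdd_zero, map_one,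
        AlgEquiv.one_apply]
    · rfl
  fix i j hij := by
    simp only [galGen, fieldGen]
    split_ifs with h1 h2 h2
    · rw [hα.2, if_neg (by simpa using hij)]
    · rw [map_one]
    · rfl
    · rfl
  move i hi := by
    rw [galGen_conj hα hi]
    split_ifs with h
    · simp
    · have h2 : (2 : L) ≠ 0 := by
        rw [← map_ofNat (algebraMap K L) 2, ne_eq, map_eq_zero]
        exact Ring.two_ne_zero h
      intro h0
      have : 2 * fieldGen α i = 0 := by
        simp only [map_zero, map_neg, map_one] at h0
        linear_combination -h0
      exact (mul_ne_zero h2 (fieldGen_ne_zero hα i)) this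

/-- Injectivity suffices, since the degree of the extension is the order 2^m of the group. -/
theorem ofC_fieldGen_surjective [FiniteDimensional K L] [IsGalois K L]
    (hα : AdaptedGenerators e α) :
    Function.Surjective (ofC (fieldGen α) : (BIdx m → K) → L) := by
  let φ : (BIdx m → K) →ₗ[K] L :=
    { toFun := ofC (fieldGen α), map_add' := ofC_add, map_smul' := fun c X => ofC_smul c X }
  have hd : Module.finrank K (BIdx m → K) = Module.finrank K L := by
    rw [← IsGalois.card_aut_eq_finrank, ← Nat.card_congr e.toEquiv,
      Nat.card_congr Multiplicative.toAdd]
    simp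
  exact (LinearMap.injective_iff_surjective_of_finrank_eq_finrank (f := φ) hd).1
    (ofC_injective (dualGenerators hα))

theorem apply_fieldGen (hα : AdaptedGenerators e α) (v : Fin m → ZMod 2) (p : Fin m) :
    e (Multiplicative.ofAdd v) (fieldGen α p) =
      if v p = 0 then fieldGen α p else galGen e p (fieldGen α p) := by
  have hθ := dualGenerators hα
  have key : ∀ S : Finset (Fin m), e (Multiplicative.ofAdd (∑ i ∈ S, Pi.single i (v i)))
      (fieldGen α p) = if p ∈ S ∧ v p ≠ 0 then galGen e p (fieldGen α p) else fieldGen α p := by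
    have h1 : ∀ (i : Fin m) (x : L), e (Multiplicative.ofAdd (Pi.single i (v i))) x =
        if v i = 0 then x else galGen e i x := by
      intro i x
      by_cases hi : v i = 0
      · simp [hi]
      · have hv : v i = 1 := (by decide : ∀ z : ZMod 2, z ≠ 0 → z = 1) _ hi
        rw [if_neg hi, hv, galGen, dif_pos i.isLt]
        rfl
    intro S
    induction S using Finset.induction_on with
    | empty => simp
    | insert i S hi ih =>
      rw [Finset.sum_insert hi, ofAdd_add, map_mul, AlgEquiv.mul_apply, ih, h1]
      by_cases hip : i = p
      · subst hip
        by_cases hv : v i = 0 <;> simp [hi, hv]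
      · have hip' : (i : ℕ) ≠ p := fun h => hip (Fin.ext h)
        have h2 : ∀ x, x = fieldGen α p ∨ x = galGen e p (fieldGen α p) →
            (if v i = 0 then x else galGen e i x) = x := by
          rintro x (rfl | rfl)
          · rw [hθ.fix _ _ hip', ite_self]
          · rw [hθ.comm, hθ.fix _ _ hip', ite_self]
        rw [h2 _ (by split_ifs <;> simp)]
        simp [Ne.symm hip]
  have h := key Finset.univ
  rw [Finset.univ_sum_single] at h
  rw [h]
  by_cases hv : v p = 0 <;> simp [hv]

theorem apply_fieldGen_cases (hα : AdaptedGenerators e α) {q : ℕ} (hq : q < m) (g : L ≃ₐ[K] L) :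
    g (fieldGen α q) = fieldGen α q ∨ g (fieldGen α q) = galGen e q (fieldGen α q) := by
  have h := apply_fieldGen hα (e.symm g).toAdd ⟨q, hq⟩
  rw [ofAdd_toAdd, MulEquiv.apply_symm_apply] at h
  dsimp only at h
  rw [h]
  split_ifs <;> simp

theorem card_filter_val_ge (m h : ℕ) : (Finset.univ.filter fun q : Fin m => h ≤ q).card = m - h := by
  rw [← Finset.card_map Fin.valEmbedding, ← Nat.card_Ico]
  congr 1
  ext q
  simp only [Finset.mem_map, Finset.mem_filter, Finset.mem_univ, true_and, Finset.mem_Ico,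
    Fin.valEmbedding_apply]
  exact ⟨fun ⟨i, hi, h⟩ => h ▸ ⟨hi, i.isLt⟩, fun hq => ⟨⟨q, hq.2⟩, hq.1, rfl⟩⟩

/-- Translates the weight condition on codewords into a condition on moved generators, which is what
the parts of an endomorphism detect. -/
theorem galWeight_eq (hα : AdaptedGenerators e α) [DecidableEq L] (g : L ≃ₐ[K] L) :
    galWeight e g = (Finset.univ.filter fun q : Fin m => g (fieldGen α q) ≠ fieldGen α q).card := by
  rw [galWeight, hammingNorm]
  congr 1
  ext q
  have h := apply_fieldGen hα (e.symm g).toAdd q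
  rw [ofAdd_toAdd, MulEquiv.apply_symm_apply] at h
  have hm := (dualGenerators hα).move q q.isLt
  simp only [Finset.mem_filter, Finset.mem_univ, true_and, h]
  by_cases hv : (e.symm g).toAdd q = 0
  · simp [hv]
  · simpa [hv] using sub_ne_zero.1 hm

theorem toEndo_apply [Fintype (L ≃ₐ[K] L)] (f : SkewMonoidAlgebra L (L ≃ₐ[K] L)) (x : L) :
    toEndo f x = ∑ g, f.coeff g * g x := by
  rw [toEndo, SkewMonoidAlgebra.sum_def, Finsupp.sum_fintype _ _ (by simp)]
  simp [LinearMap.sum_apply]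

/-- Codewords have no part that moves more than `r` of the `α_i`. -/
theorem moveParts_toEndo [FiniteDimensional K L] (hα : AdaptedGenerators e α) {h r : ℕ}
    (hm : m = h + r + 1) {f : SkewMonoidAlgebra L (L ≃ₐ[K] L)} (hf : f ∈ reedMuller e r) (x : L) :
    moveParts (galGen e) (fieldGen α) (toEndo f) m (m - h) x = 0 := by
  classical
  have hθ := dualGenerators hα
  have := Fintype.ofFinite (L ≃ₐ[K] L)
  obtain ⟨c', h1, h2⟩ := moveParts_group (p := m) (j := m - h) hθ.move
    (fun q hq g => apply_fieldGen_cases hα hq g) f.coeff (by omega)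
  rw [show (toEndo f : L → L) = fun x => ∑ g, f.coeff g * g x from funext (toEndo_apply f), h1]
  refine Finset.sum_eq_zero fun g _ => ?_
  suffices c' g = 0 by rw [this, zero_mul]
  by_contra hc
  obtain ⟨h3, h4⟩ := h2 g hc
  have h5 := hf g h3
  rw [galWeight_eq hα] at h5
  have h6 : (Finset.univ.filter fun q : Fin m => h ≤ q).card ≤ r := by
    refine le_trans (Finset.card_le_card fun q hq => ?_) h5
    rw [Finset.mem_filter] at hq ⊢
    exact ⟨hq.1, h4 q (by omega) q.isLt⟩
  have h7 := card_filter_val_ge m h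
  omega

/-- A surviving group element moves the r generators with index ≥ h other than p. Its weight is at
most r, so it fixes all generators of index below h, and thus their products. -/
theorem exceptPart_toEndo [FiniteDimensional K L] (hα : AdaptedGenerators e α) {h r p : ℕ}
    (hm : m = h + r + 1) (hp : h ≤ p) (hp' : p < m) {f : SkewMonoidAlgebra L (L ≃ₐ[K] L)}
    (hf : f ∈ reedMuller e r) :
    ∃ c, ∀ s ∈ low m h, Prog.exceptPart (galGen e) (fieldGen α) m h p (toEndo f)
      (bas (fieldGen α) s) = c * bas (fieldGen α) s := by
  classical
  have hθ := dualGenerators hα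
  have := Fintype.ofFinite (L ≃ₐ[K] L)
  obtain ⟨c', h1, h2⟩ := moveParts_group (p := m) (j := m - 1 - p) hθ.move
    (fun q hq g => apply_fieldGen_cases hα hq g) f.coeff (by omega)
  obtain ⟨c'', h3, h4⟩ := moveParts_group (p := p) (j := p - h)
    (fun q hq => hθ.move q (by omega)) (fun q hq g => apply_fieldGen_cases hα (by omega) g)
    (fun g => if g (fieldGen α p) = fieldGen α p then c' g else 0) (by omega)
  refine ⟨∑ g, c'' g, fun s hs => ?_⟩
  rw [show (toEndo f : L → L) = fun x => ∑ g, f.coeff g * g x from funext (toEndo_apply f),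
    Prog.exceptPart, h1, fixPart_group (hθ.move p hp') fun g => apply_fieldGen_cases hα hp' g, h3,
    Finset.sum_mul]
  refine Finset.sum_congr rfl fun g _ => ?_
  by_cases hc : c'' g = 0
  · rw [hc, zero_mul, zero_mul]
  congr 1
  obtain ⟨h5, h6⟩ := h4 g hc
  have h7 : g (fieldGen α p) = fieldGen α p := by
    by_contra h
    exact h5 (if_neg h)
  rw [if_pos h7] at h5
  obtain ⟨h8, h9⟩ := h2 g h5
  have h10 := hf g h8
  rw [galWeight_eq hα] at h10
  have hmove : ∀ q : Fin m, h ≤ q → (q : ℕ) ≠ p → g (fieldGen α q) ≠ fieldGen α q := by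
    intro q hq hqp
    rcases lt_or_gt_of_ne hqp with hlt | hgt
    · exact h6 q (by omega) hlt
    · exact h9 q (by omega) q.isLt
  have hfix : ∀ q : Fin m, (q : ℕ) < h → g (fieldGen α q) = fieldGen α q := by
    intro q hq
    by_contra hne
    have h11 : insert q ((Finset.univ.filter fun q : Fin m => h ≤ q).erase ⟨p, hp'⟩) ⊆
        Finset.univ.filter fun q : Fin m => g (fieldGen α q) ≠ fieldGen α q := by
      intro i hi
      rw [Finset.mem_insert, Finset.mem_erase, Finset.mem_filter] at hi
      refine Finset.mem_filter.2 ⟨Finset.mem_univ _, ?_⟩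
      rcases hi with rfl | ⟨hip, -, hi⟩
      · exact hne
      · exact hmove i hi fun h => hip (Fin.ext h)
    have h12 := Finset.card_le_card h11
    have h7 := card_filter_val_ge m h
    rw [Finset.card_insert_of_notMem (by simp; intro _; omega), Finset.card_erase_of_mem (by simpa using hp), h7] at h12
    omega
  rw [bas, basisElt, map_prod]
  refine Finset.prod_congr rfl fun q _ => ?_
  rw [map_pow]
  by_cases hq : (q : ℕ) < h
  · rw [hfix q hq]
  · rw [mem_low.1 hs q (by omega)]
    simp

/-- The minimum distance is at most `2 ^ (m - r)`. -/
theorem minRankDist_le [FiniteDimensional K L] [IsGalois K L] (hα : AdaptedGenerators e α) {r : ℕ}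
    (hr : r ≤ m) : minRankDist (reedMuller e r) ≤ 2 ^ (m - r) := by
  classical
  have hθ := dualGenerators hα
  have := Fintype.ofFinite (L ≃ₐ[K] L)
  -- The sum of the subgroup generated by the last r of the θ_p: its support has weight at most r,
  -- and its values are fixed by this subgroup, hence lie in a space of dimension 2^(m-r).
  let f : SkewMonoidAlgebra L (L ≃ₐ[K] L) := ⟨Finsupp.equivFunOnFinite.symm fun g =>
    if ∀ i : Fin m, (i : ℕ) < m - r → (e.symm g).toAdd i = 0 then 1 else 0⟩
  have hf : ∀ g, f.coeff g =
    if ∀ i : Fin m, (i : ℕ) < m - r → (e.symm g).toAdd i = 0 then 1 else 0 := fun g => rfl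
  have hf0 : f ≠ 0 := by
    intro h
    have h1 := hf 1
    rw [h] at h1
    simp at h1
  have hfm : f ∈ reedMuller e r := by
    intro g hg
    rw [hf] at hg
    have hg' : ∀ i : Fin m, (i : ℕ) < m - r → (e.symm g).toAdd i = 0 := by
      by_contra h
      exact hg (if_neg h)
    have h7 := card_filter_val_ge m (m - r)
    rw [show r = m - (m - r) by omega, ← h7, galWeight, hammingNorm]
    refine Finset.card_le_card fun i hi => ?_
    rw [Finset.mem_filter] at hi ⊢
    refine ⟨hi.1, ?_⟩
    by_contra h
    exact hi.2 (hg' i (by omega))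
  have hfix : ∀ p, m - r ≤ p → p < m → ∀ x, galGen e p (toEndo f x) = toEndo f x := by
    intro p hp hp' x
    rw [toEndo_apply, map_sum, ← Equiv.sum_comp (Equiv.mulLeft (galGen e p))]
    refine Finset.sum_congr rfl fun g _ => ?_
    have h1 : f.coeff (galGen e p * g) = f.coeff g := by
      have h2 : ∀ i : Fin m, (i : ℕ) < m - r →
          (e.symm (galGen e p * g)).toAdd i = (e.symm g).toAdd i := by
        intro i hi
        rw [map_mul, toAdd_mul, Pi.add_apply, galGen, dif_pos hp', theta,
          MulEquiv.symm_apply_apply, toAdd_ofAdd, Pi.single_eq_of_ne, zero_add]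
        rintro rfl
        simp at hi
        omega
      rw [hf, hf]
      refine if_congr (forall_congr' fun i => ?_) rfl rfl
      exact ⟨fun h hi => h2 i hi ▸ h hi, fun h hi => (h2 i hi).trans (h hi)⟩
    rw [map_mul, Equiv.coe_mulLeft, h1, AlgEquiv.mul_apply, hf]
    split_ifs <;> simp [hθ.invol]
  have hrange : LinearMap.range (toEndo f) ≤
      Submodule.span K (((low m (m - r)).image (bas (fieldGen α)) : Finset L) : Set L) := by
    rintro _ ⟨x, rfl⟩
    obtain ⟨X, hX⟩ := ofC_fieldGen_surjective hα (toEndo f x)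
    have hX0 : ∀ s, s ∉ low m (m - r) → X s = 0 := by
      intro s hs
      rw [mem_low] at hs
      push Not at hs
      obtain ⟨i, hi, hsi⟩ := hs
      have h1 := coeffOp_ofC hθ i.isLt 1 X
      rw [hX, coeffOp, if_pos rfl, hfix i hi i.isLt, sub_self, zero_div,
        ← ofC_zero (K := K) (m := m) (a := fieldGen α)] at h1
      have h2 := congrFun (ofC_injective hθ h1) (setBit s i 0)
      rw [partCoords, if_pos (getBit_setBit i.isLt _ _), setBit_setBit] at h2
      have h3 : getBit s i = 1 := by
        have : getBit s i = s i := by simp [getBit]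
        omega
      rw [← h3, setBit_self] at h2
      exact h2.symm
    rw [← hX, ofC_eq]
    refine Submodule.sum_mem _ fun s _ => ?_
    by_cases hs : s ∈ low m (m - r)
    · exact Submodule.smul_mem _ _ (Submodule.subset_span (by
        simpa using ⟨s, hs, rfl⟩))
    · rw [hX0 s hs, zero_smul]
      exact Submodule.zero_mem _
  have hmem : Module.finrank K (LinearMap.range (toEndo f)) ∈ {d | ∃ f ∈ reedMuller e r, f ≠ 0 ∧
      d = Module.finrank K (LinearMap.range (toEndo f))} := ⟨f, hfm, hf0, rfl⟩
  refine (Nat.sInf_le hmem).trans ?_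
  refine (Submodule.finrank_mono hrange).trans ((finrank_span_finset_le_card _).trans ?_)
  exact Finset.card_image_le.trans (card_low (by omega)).le

end GaloisGroup

/-! ### The decoder for received matrices, and the theorem. -/

section MainTheorem

theorem Matrix.exists_mulVec_eq_sum_of_rank {K ι : Type*} [Field K] [Fintype ι]
    (E : Matrix ι ι K) : ∃ (w : Fin E.rank → ι → K) (φ : Fin E.rank → (ι → K) → K),
      ∀ X, E.mulVec X = ∑ j, φ j X • w j := by
  have b := Module.finBasisOfFinrankEq K (LinearMap.range E.mulVecLin) (n := E.rank) rfl
  refine ⟨fun j => b j, fun j X => b.repr ⟨E.mulVec X, X, rfl⟩ j, fun X => ?_⟩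
  have h := congrArg Subtype.val (b.sum_repr ⟨E.mulVec X, X, rfl⟩)
  rw [Submodule.coe_sum] at h
  exact h.symm

variable {K L : Type*} [Field K] [Field L] [Algebra K L] {m : ℕ}
variable {e : Multiplicative (Fin m → ZMod 2) ≃* (L ≃ₐ[K] L)} {α : Fin m → L}

theorem coord_ofC_top {θ : ℕ → L ≃ₐ[K] L} {a : ℕ → L} (hθ : DualGenerators m θ a) (q : BIdx m)
    (X : BIdx m → K) : coord θ a q m (ofC a X) = algebraMap K L (X q) := by
  have h1 : ∀ (s : BIdx m), coord θ a q m (X s • bas a s) =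
      if q = s then algebraMap K L (X s) else 0 := by
    intro s
    rw [Algebra.smul_def, coord_mul fun i _ => AlgEquiv.commutes _ _,
      coord_bas hθ le_rfl (by simp [low_top]) (by simp [low_top])]
    simp
  rw [ofC_eq, coord_sum]
  simp_rw [h1]
  simp

variable [FiniteDimensional K L] [IsGalois K L]

theorem exists_mulSetting (hα : AdaptedGenerators e α) :
    ∃ (c₀ c₁ : K) (T : CompTree K (BIdx m ⊕ BIdx m) (BIdx m)),
      MulSetting (galGen e) (fieldGen α) c₀ c₁ T (mulCost K α) := by
  have hsurj := ofC_fieldGen_surjective hα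
  have hne : {c : ℕ | ∃ T : CompTree K (BIdx m ⊕ BIdx m) (BIdx m), ∀ x y : BIdx m → K,
    ∃ (z : BIdx m → K) (c' : ℕ), T.run (Sum.elim x y) = some (z, c') ∧ c' ≤ c ∧
      ofCoords α z = ofCoords α x * ofCoords α y}.Nonempty := by
    simp only [← ofC_fieldGen]
    exact exists_mul_tree hsurj
  obtain ⟨T, hT⟩ := Nat.sInf_mem hne
  have hT' : ∀ X Y : BIdx m → K, ∃ Z c, T.run (Sum.elim X Y) = some (Z, c) ∧ c ≤ mulCost K α ∧
      ofC (fieldGen α) Z = ofC (fieldGen α) X * ofC (fieldGen α) Y := by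
    simp only [ofC_fieldGen]
    exact hT
  have hconj := fun p (hp : p < m) => galGen_conj hα hp
  exact ⟨_, _, T, dualGenerators hα, hsurj, hconj, hT',
    two_pow_le_two_mul (dualGenerators hα) hT' hsurj hconj⟩

omit [IsGalois K L] in
-- A rank factorisation of the error matrix yields the form ∑ w_j F_j with `F_j` valued in `K`, as
-- required by `Decodable.of_foldings`.
theorem exists_decodable (hα : AdaptedGenerators e α) {h r : ℕ} (hm : m = h + r + 1)
    {f : SkewMonoidAlgebra L (L ≃ₐ[K] L)} (hf : f ∈ reedMuller e r)
    {E : Matrix (BIdx m) (BIdx m) K} (hE : FoldingAssumption α r E) (ht : E.rank < 2 ^ h) :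
    ∃ g, Decodable m (galGen e) (fieldGen α) h E.rank (fun x => toEndo f x + g x) g ∧
      ∀ s, g (bas (fieldGen α) s) = ofC (fieldGen α) fun q => E q s := by
  have hθ := dualGenerators hα
  obtain ⟨w, φ, hwφ⟩ := E.exists_mulVec_eq_sum_of_rank
  let crd : L → BIdx m → K := Function.invFun (ofC (fieldGen α))
  have hcrd : ∀ s, crd (bas (fieldGen α) s) = Pi.single s 1 := by
    intro s
    rw [← one_smul K (bas (fieldGen α) s), ← ofC_single]
    exact Function.leftInverse_invFun (ofC_injective hθ) _
  have hg : ∀ s, ∑ j, ofC (fieldGen α) (w j) * algebraMap K L (φ j (crd (bas (fieldGen α) s))) =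
      ofC (fieldGen α) fun q => E q s := by
    intro s
    have h1 : ∀ S : Finset (Fin E.rank), ∑ j ∈ S, ofC (fieldGen α) (w j) *
        algebraMap K L (φ j (crd (bas (fieldGen α) s))) =
        ofC (fieldGen α) (∑ j ∈ S, φ j (crd (bas (fieldGen α) s)) • w j) := by
      intro S
      induction S using Finset.induction_on with
      | empty => simp [ofC_zero]
      | insert j S hj ih =>
        rw [Finset.sum_insert hj, Finset.sum_insert hj, ih, ofC_add, ofC_smul, Algebra.smul_def,
          mul_comm]
    rw [h1, ← hwφ, hcrd, Matrix.mulVec_single_one]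
    rfl
  refine ⟨fun x => ∑ j, ofC (fieldGen α) (w j) * algebraMap K L (φ j (crd x)), ?_, hg⟩
  refine Decodable.of_foldings (E := E.map (algebraMap K L)) hθ (fieldGen_ne_zero hα) hm ht
    (fun j x i _ => AlgEquiv.commutes _ _) ?_ ?_ (fun s _ => moveParts_toEndo hα hm hf _)
    fun p hp hp' => exceptPart_toEndo hα hm hp hp' hf
  · intro q s
    rw [hg, coord_ofC_top hθ, Matrix.map_apply]
  · rw [fieldGen_coe]
    exact hE

/-- The decoder, as a computation tree. -/
theorem exists_decoder (hα : AdaptedGenerators e α) {r : ℕ} (hr : r ≤ m) :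
    ∃ D : CompTree K (BIdx m × BIdx m) (BIdx m × BIdx m),
      ∀ C E : Matrix (BIdx m) (BIdx m) K, C ∈ reedMullerMatrices e α r →
        2 * E.rank < minRankDist (reedMuller e r) → FoldingAssumption α r E →
        ∃ c : ℕ, D.run (fun p => (C + E) p.1 p.2) = some (fun p => C p.1 p.2, c) ∧
          c ≤ 80 * max E.rank 1 * 2 ^ m * mulCost K α := by
  have hdist : ∀ E : Matrix (BIdx m) (BIdx m) K, 2 * E.rank < minRankDist (reedMuller e r) →
      2 * E.rank < 2 ^ (m - r) := fun E h => h.trans_le (minRankDist_le hα hr)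
  rcases hr.eq_or_lt with rfl | hr
  -- For r = m the minimum distance is at most 1, so the error is zero and the input is copied.
  · refine ⟨.output Sum.inl, fun C E _ ht _ => ⟨0, ?_, Nat.zero_le _⟩⟩
    have h0 := hdist E ht
    rw [Nat.sub_self, pow_zero] at h0
    have hE : E = 0 := by
      obtain ⟨w, φ, h⟩ := E.exists_mulVec_eq_sum_of_rank
      have : IsEmpty (Fin E.rank) := by
        rw [show E.rank = 0 by omega]
        infer_instance
      exact Matrix.ext_of_mulVec_single fun i => by
        simp [h]
        rfl
    rw [hE, add_zero]
    rfl
  · obtain ⟨h, hm⟩ : ∃ h, m = h + r + 1 := ⟨m - r - 1, by omega⟩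
    obtain ⟨c₀, c₁, T, hS⟩ := exists_mulSetting hα
    -- The value at a basis element is a column of the matrix, hence the exchange of indices here
    -- and in the output.
    let A : BIdx m → BIdx m → (BIdx m × BIdx m) ⊕ ℕ := fun s q => .inl (q, s)
    refine ⟨Prog.toTree ((Prog.decode (galGen e) (fieldGen α) c₀ c₁ T h A).bind fun B =>
      Prog.pure fun p => B p.2 p.1), fun C E hC ht hE => ?_⟩
    obtain ⟨f, hf, hfC⟩ := hC
    have ht' : E.rank < 2 ^ h := by
      have h0 := hdist E ht
      rw [show m - r = h + 1 by omega, pow_succ] at h0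
      omega
    obtain ⟨g, hg, hgE⟩ := exists_decodable hα hm hf hE ht'
    have hfC' : ∀ s, toEndo f (bas (fieldGen α) s) = ofC (fieldGen α) fun q => C q s := by
      intro s
      rw [bas_fieldGen, ofC_fieldGen, hfC]
    have hA : HasArr (fieldGen α) (fun p : BIdx m × BIdx m => (C + E) p.1 p.2) ⟨0, fun _ => 0⟩
        Finset.univ A fun s => toEndo f (bas (fieldGen α) s) + g (bas (fieldGen α) s) := by
      intro s _
      refine ⟨fun q => (C + E) q s, fun q => ⟨fun d hd => by simp [A] at hd, rfl⟩, ?_⟩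
      change ofC (fieldGen α) ((fun q => C q s) + fun q => E q s) =
        toEndo f (bas (fieldGen α) s) + g (bas (fieldGen α) s)
      rw [ofC_add, hfC', hgE]
    have hB := (Prog.Comp.decode (O := BIdx m × BIdx m) hS (by omega) hg hA).bind (c' := 0)
      (f := fun B => Prog.pure fun p : BIdx m × BIdx m => B p.2 p.1)
      (S := fun ν B => ∀ p : BIdx m × BIdx m,
        ν.Holds (fun p : BIdx m × BIdx m => (C + E) p.1 p.2) (B p) (C p.1 p.2))
      fun B ν _ hB => Prog.Comp.pure fun p => by
        obtain ⟨X, hX, hXv⟩ := hB p.2 (Finset.mem_univ _)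
        dsimp only at hXv
        rw [add_sub_cancel_right, hfC'] at hXv
        rw [ofC_injective (dualGenerators hα) hXv] at hX
        exact hX p.1
    obtain ⟨c, hc, hrun⟩ := Prog.Comp.run_toTree hB
    exact ⟨c, hrun, hc⟩

end MainTheorem

theorem mainTheorem5 (ω : ℝ) (hω : 2 < ω) (Cω : ℝ) :
    ∃ κ : ℝ, 0 < κ ∧
      ∀ (K : Type*) (L : Type*) [Field K] [Field L] [Algebra K L] [FiniteDimensional K L]
        [IsGalois K L] (m r : ℕ) (e : Multiplicative (Fin m → ZMod 2) ≃* (L ≃ₐ[K] L))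
        (α : Fin m → L),
        r ≤ m → AdaptedGenerators e α → MatMulBound L ω Cω →
        ∃ D : CompTree K (BIdx m × BIdx m) (BIdx m × BIdx m),
          ∀ Y C E : Matrix (BIdx m) (BIdx m) K,
            Y = C + E → C ∈ reedMullerMatrices e α r →
            2 * E.rank < minRankDist (reedMuller e r) →
            FoldingAssumption α r E →
            ∃ c : ℕ, D.run (fun p => Y p.1 p.2) = some (fun p => C p.1 p.2, c) ∧
              (c : ℝ) ≤ κ * ((max E.rank 1 : ℕ) : ℝ) ^ (ω - 1) * 2 ^ m * (mulCost K α : ℝ) ∧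
              ∀ CM : ℝ, (mulCost K α : ℝ) ≤ CM * (2 ^ m * Real.log (2 ^ m)) →
                (c : ℝ) ≤ κ * CM * ((max E.rank 1 : ℕ) : ℝ) ^ (ω - 1) *
                  ((2 ^ m) ^ 2 * Real.log (2 ^ m)) := by
  refine ⟨80, by norm_num, fun K L _ _ _ _ _ m r e α hr hα _ => ?_⟩
  obtain ⟨D, hD⟩ := exists_decoder hα hr
  refine ⟨D, fun Y C E hY hC ht hE => ?_⟩
  subst hY
  obtain ⟨c, hrun, hc⟩ := hD C E hC ht hE
  have h1 : (1 : ℝ) ≤ ((max E.rank 1 : ℕ) : ℝ) := by exact_mod_cast le_max_right _ _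
  -- The decoder is linear in max(t,1), which the exponent ω - 1 > 1 dominates; so the constant 80
  -- serves for all ω.
  have h2 := Real.self_le_rpow_of_one_le h1 (by linarith : 1 ≤ ω - 1)
  have h3 : (c : ℝ) ≤ 80 * ((max E.rank 1 : ℕ) : ℝ) ^ (ω - 1) * 2 ^ m * (mulCost K α : ℝ) := by
    calc (c : ℝ) ≤ 80 * ((max E.rank 1 : ℕ) : ℝ) * 2 ^ m * (mulCost K α : ℝ) := by exact_mod_cast hc
      _ ≤ _ := by gcongr
  refine ⟨c, hrun, h3, fun CM hCM => ?_⟩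
  calc (c : ℝ) ≤ 80 * ((max E.rank 1 : ℕ) : ℝ) ^ (ω - 1) * 2 ^ m * (mulCost K α : ℝ) := h3
    _ ≤ 80 * ((max E.rank 1 : ℕ) : ℝ) ^ (ω - 1) * 2 ^ m * (CM * (2 ^ m * Real.log (2 ^ m))) := by
      gcongr
    _ = _ := by ring
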